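/- **Setting.** A restricted Boltzmann machine (RBM) with $n$ visible and $m$ latent nodes is given by $J\in\mathbb R^{n\times m}$, $f\in\mathbb R^n$, $g\in\mathbb R^m$, and is the distribution $P(X=x,Y=y)=\frac1Z\exp(x^{\mathsf T}Jy+f^{\mathsf T}x+g^{\mathsf T}y)$ on $\{\pm1\}^n\times\{\pm1\}^m$. It is ferromagnetic if all entries of $J,f,g$ are non-negative. It is $(\alpha,\beta)$-non-degenerate if $|J_{ij}|\ge\alpha$ whenever $J_{ij}\ne0$, $\sum_j|J_{ij}|+|f_i|\le\beta$ for all $i\in[n]$, and $\sum_i|J_{ij}|+|g_j|\le\beta$ for all $j\in[m]$. The two-hop neighborhood $\mathcal N_2(u)$ of a visible node $u$ is the smallest set $S\subseteq[n]\setminus\{u\}$ such that, given $X_S$, $X_u$ is conditionally independent of $X_j$ for every visible $j\notin S\cup\{u\}$; the two-hop degree is $d_2=\max_u|\mathcal N_2(u)|$. For samples $x^1,\dots,x^M\in\{\pm1\}^n$ and $S\subseteq[n]\setminus\{u\}$ the empirical influence is $\widehat I_u(S)=2\,\widehat P(X_{S\cup\{u\}}=1)/\widehat P(X_S=1)-1$,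 where $\widehat P$ is the empirical distribution of the samples (and $0/0=0$). **Computational model.** A classical controller composes quantum circuits on an index register of $q=\lceil\log_2 n\rceil$ qubits and a constant number of word registers, with exact real arithmetic. The elementary gates are the Hadamard gate on an index qubit, a sign flip controlled by a word, a basic arithmetic operation or comparison on words and the index, and, for each sample $i\in[M]$, the query $|j\rangle|w\rangle\mapsto|j\rangle|w+x^i_j\rangle$ and its inverse. A circuit is run on $|0\cdots0\rangle$ and all registers are then measured in the computational basis. Each gate, each measured qubit or word, each query on a basis state, each elementary classical operation and each draw of a uniformly random integer takes one unit of time. **Algorithm** (input: a visible node $u$, a threshold $\eta$, a number of rounds $K$, $\delta$, and query access to the $M$ samples). Start with $S=\varnothing$. In each of $K$ rounds compute the lists $M_S$ and $M_{S\cup\{u\}}$ of the samples with $x_S=1$, respectively $x_{S\cup\{u\}}=1$; find a $j\in[n]\setminus(S\cup\{u\})$ that maximizes $\widehat I_u(S\cup\{j\})$ by Dürr–Høyer quantum maximum finding with failure probability $\delta/(2K)$, applied to a circuit that computes $|j\rangle|0\rangle\mapsto|j\rangle|\widehat I_u(S\cup\{j\})\rangle$ from queries and elementary gates; and replace $S$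 by $S\cup\{j\}$ ($S$ is kept if the index found is not such a node). Finally return $\{j\in S:\widehat I_u(S)-\widehat I_u(S\setminus\{j\})\ge\eta\}$. Here maximum finding with failure probability $\rho$ takes the best result of $\lceil\log_2(1/\rho)\rceil$ runs. A run starts from a uniformly random index in $\{0,\dots,2^q-1\}$ (indices that are not candidates have a value below $-1$) and repeatedly searches for an index of larger value by Grover search with an unknown number of solutions: the number $l$ of Grover iterations is uniform among the non-negative integers smaller than $\mu$, where $\mu=1$ initially and after every improvement, and $\mu\leftarrow\min(\tfrac65\mu,\sqrt{2^q})$ after every failure. A round with $l$ iterations uses $l+1$ units of a budget of $100\lceil\sqrt{2^q}\rceil$, and the run stops when the budget is exhausted. **Theorem.** There is an absolute constant $C>0$ such that the following holds. Let $\alpha>0$, $0<\delta<1$, and let an $(\alpha,\beta)$-non-degenerate ferromagnetic RBM with $n$ visible nodes and two-hop degree $d_2\ge1$ be given. Put $$\eta=\alpha^2\sigma(-2\beta)(1-\tanh\beta)^2,\qquad k=d_2\log(4/\eta),\qquad \sigma(x)=\frac1{1+e^{-x}},$$ and assume $k\le n$ and $$M\ \ge\ 2^{2k+3}\Big(\frac{d_2}{\eta}\Big)^2\Big(\log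 n+k\log\frac{en}{k}\Big)\log\frac8\delta .$$ Then for every visible node $u$ the algorithm with threshold $\eta$, $K=\lceil k\rceil$ rounds and parameter $\delta$, given quantum query access to $M$ independent samples from the observable distribution of the RBM, returns $\mathcal N_2(u)$ with probability at least $1-\delta$ (over the samples, the measurements and the random choices), and its running time is always at most $$C\big(Mk^2+Mk\sqrt n\,\log(k/\delta)\big).$$ -/

import Mathlib

/-! ## Restricted Boltzmann machines -/

/-- A configuration of `n` nodes with values in `{±1}`: `true` stands for `+1`, `false` for `-1`. -/
abbrev Config (n : ℕ) : Type := Fin n → Bool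

/-- The value in `{±1}` of a node. -/
def spin (b : Bool) : ℝ := if b then 1 else -1

/-- A restricted Boltzmann machine with `n` visible nodes and `m` latent nodes: interaction
matrix `J` and external fields `f` (visible) and `g` (latent). -/
structure RBM (n m : ℕ) where
  J : Matrix (Fin n) (Fin m) ℝ
  f : Fin n → ℝ
  g : Fin m → ℝ

noncomputable section

namespace RBM

variable {n m : ℕ} (R : RBM n m)

/-- `exp (xᵀ J y + fᵀ x + gᵀ y)`. -/
def weight (x : Config n) (y : Config m) : ℝ :=
  Real.exp ((∑ i, ∑ j, spin (x i) * R.J i j * spin (y j)) + (∑ i, R.f i * spin (x i))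
    + ∑ j, R.g j * spin (y j))

/-- The partition function `Z`. -/
def partition : ℝ := ∑ x : Config n, ∑ y : Config m, R.weight x y

/-- `P(X = x, Y = y)`. -/
def jointProb (x : Config n) (y : Config m) : ℝ := R.weight x y / R.partition

/-- `P(X = x)`, the observable distribution. -/
def visibleProb (x : Config n) : ℝ := ∑ y : Config m, R.jointProb x y

/-- `P(X_T = x_T)`. -/
def marginal (T : Finset (Fin n)) (x : Config n) : ℝ :=
  ∑ z : Config n, if ∀ i ∈ T, z i = x i then R.visibleProb z else 0

/-- `X_i` and `X_j` are conditionally independent given `X_S`: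
`P(x_i, x_j | x_S) = P(x_i | x_S) P(x_j | x_S)` for all values
(every configuration has positive probability, so we may clear the denominators). -/
def CondIndep (i j : Fin n) (S : Finset (Fin n)) : Prop :=
  ∀ x : Config n, R.marginal (insert i (insert j S)) x * R.marginal S x
    = R.marginal (insert i S) x * R.marginal (insert j S) x

/-- `S ⊆ [n] \ {i}`, and given `X_S` the variable `X_i` is conditionally independent of `X_j`
for all visible `j` outside `S ∪ {i}`. -/
def Separates (i : Fin n) (S : Finset (Fin n)) : Prop :=
  i ∉ S ∧ ∀ j, j ∉ S → j ≠ i → R.CondIndep i j S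

open Classical in
/-- The two-hop neighborhood of `i`: the smallest separating set (the smallest set of a family,
if the family has one, is the intersection of the family). -/
def twoHopNbhd (i : Fin n) : Finset (Fin n) :=
  Finset.univ.filter fun v => ∀ S, R.Separates i S → v ∈ S

/-- The two-hop degree `d₂ = max_i |N₂(i)|`. -/
def twoHopDegree : ℕ := Finset.univ.sup fun i => (R.twoHopNbhd i).card

/-- All pairwise interactions and external fields are non-negative. -/
def Ferromagnetic : Prop := (∀ i j, 0 ≤ R.J i j) ∧ (∀ i, 0 ≤ R.f i) ∧ ∀ j, 0 ≤ R.g j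

/-- `(α, β)`-non-degeneracy. -/
def NonDegenerate (α β : ℝ) : Prop :=
  (∀ i j, |R.J i j| ≠ 0 → α ≤ |R.J i j|) ∧
  (∀ i, (∑ j, |R.J i j|) + |R.f i| ≤ β) ∧
  (∀ j, (∑ i, |R.J i j|) + |R.g j| ≤ β)

end RBM

/-! ## Quantum circuits with query access to the samples

The quantum memory consists of an index register of `q` qubits and of a constant number of word
registers, each of which holds a real number (exact arithmetic model: the basic arithmetic
operations and comparisons on words are single gates). -/

/-- The word registers of the quantum memory. -/
inductive Reg
  | bit | cntS | cntSu | probS | probSu | val | bad | flag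
  deriving DecidableEq

/-- The computational basis states: content of the index qubits and of the word registers. -/
abbrev Basis (q : ℕ) : Type := (Fin q → Bool) × (Reg → ℝ)

/-- A quantum state: amplitudes in the computational basis. -/
abbrev QState (q : ℕ) : Type := Basis q →₀ ℂ

/-- The number written in binary in the index register. -/
def idx {q : ℕ} (b : Fin q → Bool) : ℕ := ∑ t : Fin q, if b t then 2 ^ (t : ℕ) else 0

/-- Operands of a word operation: a constant, a word register, or the index register. -/
inductive Operand
  | const (c : ℝ) | reg (r : Reg) | index

def Operand.eval {q : ℕ} (s : Basis q) : Operand → ℝ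
  | .const c => c
  | .reg r => s.2 r
  | .index => idx s.1

/-- Elementary word operations: multiplication, division, and the comparisons `=`, `<`, `≤`
(with value `1` if true and `0` if false). -/
inductive WordOp
  | mul | div | eq | lt | le

def WordOp.eval : WordOp → ℝ → ℝ → ℝ
  | .mul, a, b => a * b
  | .div, a, b => a / b
  | .eq, a, b => if a = b then 1 else 0
  | .lt, a, b => if a < b then 1 else 0
  | .le, a, b => if a ≤ b then 1 else 0

/-- Elementary gates for `M` samples. -/
inductive Gate (M q : ℕ)
  /-- Hadamard gate on the index qubit `t` -/
  | had (t : Fin q)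
  /-- sign flip `-1` if the word `r` is non-zero -/
  | sign (r : Reg)
  /-- oracle of sample `i`: `|j⟩|w⟩ ↦ |j⟩|w + x^i_j⟩`, with `w` in the register `r` -/
  | query (i : Fin M) (r : Reg)
  /-- inverse of `query` -/
  | unquery (i : Fin M) (r : Reg)
  /-- `r += o(a, b)`, where `r` counts as `0` if it is itself read by `a` or `b` -/
  | acc (r : Reg) (o : WordOp) (a b : Operand)
  /-- inverse of `acc` -/
  | unacc (r : Reg) (o : WordOp) (a b : Operand)

/-- A quantum circuit: a sequence of elementary gates. -/
abbrev Circuit (M q : ℕ) : Type := List (Gate M q)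

/-- The entry `x^i_j` of a sample, for a natural number `j` (`0` if `j` is not a node). -/
def sampleEntry {n M : ℕ} (x : Fin M → Config n) (i : Fin M) (j : ℕ) : ℝ :=
  if h : j < n then spin (x i ⟨j, h⟩) else 0

/-- The value that a gate `acc r o a b` adds to the register `r`. -/
def accValue {q : ℕ} (s : Basis q) (r : Reg) (o : WordOp) (a b : Operand) : ℝ :=
  o.eval (a.eval (s.1, Function.update s.2 r 0)) (b.eval (s.1, Function.update s.2 r 0))

/-- The action of a gate on a computational basis state, given the samples `x`. -/
def Gate.onBasis {n M q : ℕ} (x : Fin M → Config n) (s : Basis q) : Gate M q → QState q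
  | .had t =>
      Finsupp.single (Function.update s.1 t false, s.2) ((√2 : ℝ) : ℂ)⁻¹ +
      Finsupp.single (Function.update s.1 t true, s.2)
        (if s.1 t then -((√2 : ℝ) : ℂ)⁻¹ else ((√2 : ℝ) : ℂ)⁻¹)
  | .sign r => Finsupp.single s (if s.2 r = 0 then 1 else -1)
  | .query i r =>
      Finsupp.single (s.1, Function.update s.2 r (s.2 r + sampleEntry x i (idx s.1))) 1
  | .unquery i r =>
      Finsupp.single (s.1, Function.update s.2 r (s.2 r - sampleEntry x i (idx s.1))) 1
  | .acc r o a b => Finsupp.single (s.1, Function.update s.2 r (s.2 r + accValue s r o a b)) 1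
  | .unacc r o a b => Finsupp.single (s.1, Function.update s.2 r (s.2 r - accValue s r o a b)) 1

/-- The linear action of a gate on states. -/
def Gate.apply {n M q : ℕ} (x : Fin M → Config n) (g : Gate M q) (ψ : QState q) : QState q :=
  ψ.sum fun s a => a • g.onBasis x s

/-- The gates of a circuit are applied from left to right. -/
def Circuit.apply {n M q : ℕ} (x : Fin M → Config n) (c : Circuit M q) (ψ : QState q) :
    QState q :=
  c.foldl (fun φ g => g.apply x φ) ψ

/-- The inverse gate. -/
def Gate.inv {M q : ℕ} : Gate M q → Gate M q
  | .had t => .had t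
  | .sign r => .sign r
  | .query i r => .unquery i r
  | .unquery i r => .query i r
  | .acc r o a b => .unacc r o a b
  | .unacc r o a b => .acc r o a b

/-- The inverse circuit. -/
def Circuit.inv {M q : ℕ} (c : Circuit M q) : Circuit M q := (c.map Gate.inv).reverse

/-- The initial state `|0⋯0⟩`. -/
def zeroState (q : ℕ) : QState q := Finsupp.single (fun _ => false, fun _ => 0) 1

/-! ## Hybrid quantum-classical programs, their output distribution and running time -/

/-- Programs of a classical controller with a quantum memory of `q` index qubits and with query
access to `M` samples of `n` visible nodes. The program does not depend on the samples. -/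
inductive Prog (n M q : ℕ) (A : Type) : Type
  /-- stop with output `a` -/
  | ret (a : A)
  /-- one elementary classical operation -/
  | step (next : Prog n M q A)
  /-- query `x^i_j` on the basis state `|j⟩` and read the answer (`true` for `+1`) -/
  | query (i : Fin M) (j : Fin n) (next : Bool → Prog n M q A)
  /-- draw a uniformly random integer in `{0, …, L - 1}` -/
  | coin (L : ℕ) (next : ℕ → Prog n M q A)
  /-- run a circuit on `|0⋯0⟩`, then measure the memory in the computational basis -/
  | circuit (c : Circuit M q) (next : Basis q → Prog n M q A)

namespace Prog

variable {n M q : ℕ} {A B : Type}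

/-- Sequential composition. -/
def bind : Prog n M q A → (A → Prog n M q B) → Prog n M q B
  | .ret a, k => k a
  | .step p, k => .step (p.bind k)
  | .query i j p, k => .query i j fun b => (p b).bind k
  | .coin L p, k => .coin L fun l => (p l).bind k
  | .circuit c p, k => .circuit c fun b => (p b).bind k

instance : Monad (Prog n M q) where
  pure := Prog.ret
  bind := Prog.bind

open Classical in
/-- The probability that the output lies in `E`, if the samples are `x`. A measurement has the
outcome `b` with the squared modulus of the amplitude of `b` as probability. -/
def prob (x : Fin M → Config n) (E : Set A) : Prog n M q A → ℝ
  | .ret a => if a ∈ E then 1 else 0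
  | .step p => p.prob x E
  | .query i j p => (p (x i j)).prob x E
  | .coin L p => (∑ l ∈ Finset.range L, (p l).prob x E) / L
  | .circuit c p => (c.apply x (zeroState q)).sum fun b a => ‖a‖ ^ 2 * (p b).prob x E

/-- The running time is at most `t`, whatever the samples, the random choices and the outcomes of
the measurements are. Classical operations, queries and random choices take one unit of time; a
circuit takes one unit for each gate, each measured index qubit and each measured word. -/
def TimeLE : Prog n M q A → ℝ → Prop
  | .ret _, t => 0 ≤ t
  | .step p, t => p.TimeLE (t - 1)
  | .query _ _ p, t => ∀ b, (p b).TimeLE (t - 1)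
  | .coin _ p, t => ∀ l, (p l).TimeLE (t - 1)
  | .circuit c p, t => ∀ b, (p b).TimeLE (t - (c.length + q + 8))

/-- `c` elementary classical operations. -/
def tick : ℕ → Prog n M q Unit
  | 0 => .ret ()
  | c + 1 => .step (tick c)

/-- `select v L` keeps the sample indices `i` in the list `L` with `x^i_v = 1`. -/
def select (v : Fin n) : List (Fin M) → Prog n M q (List (Fin M))
  | [] => pure []
  | i :: L => do
      let b ← Prog.query i v .ret
      tick 1
      let L' ← select v L
      pure (if b then i :: L' else L')

/-- The list of the sample indices in `L` with `x^i_v = 1` for all `v` in `S`. -/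
def selectAll : List (Fin n) → List (Fin M) → Prog n M q (List (Fin M))
  | [], L => pure L
  | v :: S, L => do
      let L' ← select v L
      selectAll S L'

/-- The list `M_S` of the sample indices with `x^i_S = (1, …, 1)`. -/
def indexSet (S : List (Fin n)) : Prog n M q (List (Fin M)) := do
  tick M
  selectAll S (List.finRange M)

/-- The empirical influence of `S` on `u`: `2 P̂(X_{S ∪ u} = 1) / P̂(X_S = 1) - 1`. The two
probabilities are computed by counting the index sets. -/
def empInfluence (u : Fin n) (S : List (Fin n)) : Prog n M q ℝ := do
  let L ← indexSet S
  let Lu ← select u L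
  tick (L.length + Lu.length + 5)
  pure (2 * (((Lu.length : ℝ) / M) / ((L.length : ℝ) / M)) - 1)

end Prog

/-! ## The quantum greedy algorithm -/

section Circuits

variable {n M q : ℕ}

/-- `w += #{i ∈ L : x^i_j = 1}` for the index `j`. The register `bit` is cleared again. -/
def countCircuit (w : Reg) (L : List (Fin M)) : Circuit M q :=
  L.flatMap fun i => [.query i .bit, .acc w .eq (.reg .bit) (.const 1), .unquery i .bit]

/-- The unitary that, for a node `j` outside `S ∪ {u}`, computes in the register `val` the empirical
influence of `S ∪ {j}` on `u`, that is
`2 P̂(X_{S ∪ {u, j}} = 1) / P̂(X_{S ∪ {j}} = 1) - 1`,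
from the index sets `MS = M_S` and `MSu = M_{S ∪ u}`. It lies in `[-1, 1]`. The register `bad`
counts the reasons for which the index `j` is not in `[n] \ (S ∪ {u})`; if there is one, `val` is
pushed below `-1`. -/
def influenceCircuit (n : ℕ) {M q : ℕ} (u : Fin n) (S : List (Fin n)) (MS MSu : List (Fin M)) :
    Circuit M q :=
  countCircuit .cntS MS ++ countCircuit .cntSu MSu ++
  [.acc .probS .div (.reg .cntS) (.const M),
   .acc .probSu .div (.reg .cntSu) (.const M),
   .acc .val .div (.reg .probSu) (.reg .probS),
   .acc .val .div (.reg .probSu) (.reg .probS),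
   .acc .val .mul (.const (-1)) (.const 1)] ++
  (u :: S).map (fun v => .acc .bad .eq .index (.const ((v : ℕ) : ℝ))) ++
  [.acc .bad .le (.const n) .index,
   .acc .val .mul (.const (-4)) (.reg .bad)]

/-- Hadamard gates on all index qubits. -/
def hadamards : Circuit M q := (List.finRange q).map Gate.had

/-- Sign flip of the basis states with `o(a, b) = 1`. -/
def signIf (o : WordOp) (a b : Operand) : Circuit M q :=
  [.acc .flag o a b, .sign .flag, .unacc .flag o a b]

/-- The phase oracle that marks the indices with value larger than `y`, where `U` computes the
value of an index in the register `val`. -/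
def markCircuit (U : Circuit M q) (y : ℝ) : Circuit M q :=
  U ++ signIf .lt (.const y) (.reg .val) ++ U.inv

/-- One Grover iteration (up to a global sign): the phase oracle, then the reflection about the
uniform superposition. -/
def groverIter (U : Circuit M q) (y : ℝ) : Circuit M q :=
  markCircuit U y ++ hadamards ++ signIf .eq .index (.const 0) ++ hadamards

/-- Uniform superposition of all indices, `l` Grover iterations, and computation of the values. -/
def groverCircuit (U : Circuit M q) (y : ℝ) (l : ℕ) : Circuit M q :=
  hadamards ++ (List.replicate l (groverIter U y)).flatten ++ U

end Circuits

namespace Prog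

variable {n M q : ℕ}

/-- The main loop of Dürr–Høyer maximum finding over the indices `0, …, 2 ^ q - 1`, where `best`
holds the current index and its value. It searches an index of larger value by the quantum
exponential search with unknown number of solutions: `l` is drawn uniformly among the non-negative
integers smaller than `m`, and `l` Grover iterations are applied; after a failure `m` grows by the
factor `6/5`, up to `√(2 ^ q)`, and after a success the threshold is raised and the search starts
again with `m = 1`. The loop is interrupted when the budget `t` is exhausted; a round with `l`
Grover iterations costs `l + 1`. The first argument bounds the number of rounds. -/
def maxLoop (U : Circuit M q) : ℕ → ℕ → ℝ → Basis q → Prog n M q (Basis q)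
  | 0, _, _, best => pure best
  | r + 1, t, m, best => do
      let l ← Prog.coin ⌈m⌉₊ .ret
      tick 8
      if t < l + 1 then pure best
      else do
        let b ← Prog.circuit (groverCircuit U (best.2 .val) l) .ret
        if best.2 .val < b.2 .val then maxLoop U r (t - (l + 1)) 1 b
        else maxLoop U r (t - (l + 1)) (min (6 / 5 * m) √(2 ^ q)) best

/-- One run of Dürr–Høyer maximum finding: start at a uniformly random index; the budget is
`100 ⌈√N⌉` for `N = 2 ^ q`. -/
def maxRun (U : Circuit M q) : Prog n M q (Basis q) := do
  let b ← Prog.circuit (groverCircuit U 0 0) .ret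
  tick 4
  maxLoop U (100 * ⌈√(2 ^ q : ℝ)⌉₊) (100 * ⌈√(2 ^ q : ℝ)⌉₊) 1 b

/-- The best of `best` and the results of `r` further runs. -/
def maxRepeat (U : Circuit M q) : ℕ → Basis q → Prog n M q (Basis q)
  | 0, best => pure best
  | r + 1, best => do
      let b ← maxRun U
      tick 2
      maxRepeat U r (if best.2 .val < b.2 .val then b else best)

/-- Quantum maximum finding with failure probability `ρ`: `⌈log₂ (1/ρ)⌉` runs (and at least one),
of which the best result is kept. -/
def maxFind (U : Circuit M q) (ρ : ℝ) : Prog n M q (Basis q) := do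
  tick 4
  let b ← maxRun U
  maxRepeat U (⌈Real.logb 2 (1 / ρ)⌉₊ - 1) b

/-- One round of the greedy algorithm: `S ↦ S ∪ {j}`, where `j` is found by quantum maximum finding
of the empirical influence of `S ∪ {j}` on `u` over the nodes `j` outside `S ∪ {u}`.
(`S` is unchanged if the index found is not such a node, as when there is none left.) -/
def greedyRound (u : Fin n) (ρ : ℝ) (S : List (Fin n)) : Prog n M q (List (Fin n)) := do
  let MS ← indexSet S
  let MSu ← select u MS
  let b ← maxFind (influenceCircuit n u S MS MSu) ρ
  tick (S.length + 3)
  if h : idx b.1 < n then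
    if (⟨idx b.1, h⟩ : Fin n) ∈ u :: S then pure S else pure (⟨idx b.1, h⟩ :: S)
  else pure S

/-- `K` rounds of the greedy algorithm. -/
def greedyRounds (u : Fin n) (ρ : ℝ) : ℕ → List (Fin n) → Prog n M q (List (Fin n))
  | 0, S => pure S
  | K + 1, S => do
      tick 1
      let S' ← greedyRound u ρ S
      greedyRounds u ρ K S'

/-- The list of the `j` in `L` whose removal from `S` lowers the empirical influence, which is `v`
for `S`, by at least `η`. -/
def prune (u : Fin n) (η : ℝ) (S : List (Fin n)) (v : ℝ) :
    List (Fin n) → Prog n M q (List (Fin n))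
  | [] => pure []
  | j :: L => do
      tick S.length
      let w ← empInfluence u (S.erase j)
      tick 3
      let L' ← prune u η S v L
      pure (if η ≤ v - w then j :: L' else L')

/-- The quantum greedy algorithm with threshold `η`, `K` rounds and failure probability `δ`. -/
def quantumGreedy (M q : ℕ) (u : Fin n) (η : ℝ) (K : ℕ) (δ : ℝ) :
    Prog n M q (Finset (Fin n)) := do
  let S ← greedyRounds u (δ / (2 * K)) K []
  let v ← empInfluence u S
  let N ← prune u η S v S
  pure N.toFinset

end Prog

/-- The probability that the output of `p` lies in `E` if the `M` samples are drawn independently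
from the observable distribution of `R`. -/
def RBM.successProb {n m M q : ℕ} {A : Type} (R : RBM n m) (p : Prog n M q A) (E : Set A) : ℝ :=
  ∑ x : Fin M → Config n, (∏ i, R.visibleProb (x i)) * p.prob x E

/-- `η = α² σ(-2β) (1 - tanh β)²`. -/
def etaOf (α β : ℝ) : ℝ := α ^ 2 * Real.sigmoid (-2 * β) * (1 - Real.tanh β) ^ 2

end

/-! The influence of S on u is I_u(S) = E[X_u | X_S = 1]. In a ferromagnetic model it is
nonnegative, monotone and submodular in S, and all of this comes from one positivity principle. Take
four independent copies of the model and pass, at each site, to an orthogonal transformation of the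
four spins (`quadMode`). The joint energy becomes a polynomial in the new variables with nonnegative
coefficients, and their mixed moments at a single site are nonnegative, so every replica expectation
of a monomial is nonnegative. Conditioning on the value +1 preserves this, since the indicator is a
limit of exponentials. Conditioning the copies on S, S ∪ {i}, S ∪ {j}, S ∪ {i, j} and averaging the
mode with signs -, +, +, - at u gives `influence_submodular`; monotonicity is its case j = u.

Summing out the latent nodes turns the weight into a product of hyperbolic cosines. The conditional
law of X_u then depends only on the nodes that share a latent neighbor with u. Each of these, if
outside S, has gain at least 2η (`two_mul_etaOf_le_gain`): by submodularity the worst case has all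
other nodes fixed to +1, which is a two-spin system. Both facts together identify the two-hop
neighborhood (`twoHopNbhd_eq`).

Nonnegative influence also gives P(X_S = 1) ≥ 2^{-|S|}. So an exponential moment bound and a union
over the sets with at most ⌈k⌉ elements make all their empirical influences accurate up to η/(4d),
except with probability δ/2. Greedy maximization of a monotone submodular function contracts the gap
to I_u(N₂(u)) by 1 - 1/d per round, up to the sampling error. After ⌈k⌉ rounds the gap is below 2η,
so no neighbor is missing. Removing a selected node changes the true influence by 0 or by at least
2η, and the threshold η tells the two cases apart.

On the quantum side, the states between complete subcircuits have the form ∑ α_j |j, w_j⟩, and a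
Grover iteration rotates by twice an angle θ. With a uniformly random number of iterations below m,
a search succeeds with probability at least 1/4 once m ≥ 1 / sin θ. A potential function bounds the
expected cost of climbing to the maximum by 30√N, so a budget of 100√N suffices with probability at
least 1/2 (`le_expect_maxLoop`, a Markov inequality built into an induction). Repetition brings the
failure probability of a round down to δ/(2K). For the time, each unit of the budget costs O(M)
gates, because the assumption on M makes k and log n at most M. -/

/-! ## Positivity of replica expectations -/

/-- The sums of `F` against all monomials in the functions `e a` are nonnegative. -/
def PosMoments {Ω ι : Type*} [Fintype Ω] (e : ι → Ω → ℝ) (F : Ω → ℝ) : Prop :=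
  ∀ l : List ι, 0 ≤ ∑ ω, F ω * (l.map fun a => e a ω).prod

/-- Multiplication by `X` preserves `PosMoments`. -/
def PosMultiplier {Ω ι : Type*} [Fintype Ω] (e : ι → Ω → ℝ) (X : Ω → ℝ) : Prop :=
  ∀ F, PosMoments e F → PosMoments e fun ω => X ω * F ω

namespace PosMultiplier

variable {Ω ι : Type*} [Fintype Ω] {e : ι → Ω → ℝ} {X Y : Ω → ℝ}

lemma gen (a : ι) : PosMultiplier e (e a) := by
  intro F hF l
  have := hF (a :: l)
  simp only [List.map_cons, List.prod_cons] at this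
  refine this.trans_eq (Finset.sum_congr rfl fun ω _ => by ring)

lemma const {c : ℝ} (hc : 0 ≤ c) : PosMultiplier e fun _ => c := by
  intro F hF l
  have := mul_nonneg hc (hF l)
  rw [Finset.mul_sum] at this
  exact this.trans_eq (Finset.sum_congr rfl fun ω _ => by ring)

lemma add (hX : PosMultiplier e X) (hY : PosMultiplier e Y) :
    PosMultiplier e fun ω => X ω + Y ω := by
  intro F hF l
  have := add_nonneg (hX F hF l) (hY F hF l)
  rw [← Finset.sum_add_distrib] at this
  exact this.trans_eq (Finset.sum_congr rfl fun ω _ => by ring)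

lemma mul (hX : PosMultiplier e X) (hY : PosMultiplier e Y) :
    PosMultiplier e fun ω => X ω * Y ω := by
  intro F hF
  have := hX _ (hY F hF)
  simpa only [mul_assoc] using this

lemma sum {κ : Type*} (s : Finset κ) {X : κ → Ω → ℝ} (hX : ∀ a ∈ s, PosMultiplier e (X a)) :
    PosMultiplier e fun ω => ∑ a ∈ s, X a ω := by
  classical
  induction s using Finset.induction_on with
  | empty => simpa using const (e := e) le_rfl
  | insert a s ha ih =>
    simp only [Finset.sum_insert ha]
    exact (hX a (Finset.mem_insert_self a s)).add
      (ih fun b hb => hX b (Finset.mem_insert_of_mem hb))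

lemma prod {κ : Type*} (s : Finset κ) {X : κ → Ω → ℝ} (hX : ∀ a ∈ s, PosMultiplier e (X a)) :
    PosMultiplier e fun ω => ∏ a ∈ s, X a ω := by
  classical
  induction s using Finset.induction_on with
  | empty => simpa using const (e := e) zero_le_one
  | insert a s ha ih =>
    simp only [Finset.prod_insert ha]
    exact (hX a (Finset.mem_insert_self a s)).mul
      (ih fun b hb => hX b (Finset.mem_insert_of_mem hb))

lemma pow (hX : PosMultiplier e X) (k : ℕ) : PosMultiplier e fun ω => X ω ^ k := by
  induction k with
  | zero => simpa using const (e := e) zero_le_one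
  | succ k ih => simpa only [pow_succ] using ih.mul hX

/-- The moments are finite sums, so pointwise limits suffice. This closure property yields both
exponentials (power series) and indicators. -/
lemma of_tendsto {X : ℕ → Ω → ℝ} {Y : Ω → ℝ} (hX : ∀ k, PosMultiplier e (X k))
    (hY : ∀ ω, Filter.Tendsto (fun k => X k ω) Filter.atTop (nhds (Y ω))) :
    PosMultiplier e Y := by
  intro F hF l
  refine ge_of_tendsto' (f := fun k => ∑ ω, X k ω * F ω * (l.map fun a => e a ω).prod)
    (tendsto_finsetSum _ fun ω _ => ((hY ω).mul_const _).mul_const _) fun k => hX k F hF l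

lemma exp (hX : PosMultiplier e X) : PosMultiplier e fun ω => Real.exp (X ω) := by
  refine of_tendsto (X := fun k ω => ∑ i ∈ Finset.range k, X ω ^ i / (i.factorial : ℝ))
    (fun k => sum _ fun i _ => ?_) fun ω => ?_
  · simpa only [div_eq_mul_inv] using (hX.pow i).mul (const (by positivity))
  · have := NormedSpace.expSeries_div_hasSum_exp (𝔸 := ℝ) (X ω)
    rw [← congrFun Real.exp_eq_exp_ℝ] at this
    exact this.tendsto_sum_nat

lemma sum_nonneg (hX : PosMultiplier e X) (h1 : PosMoments e fun _ => 1) : 0 ≤ ∑ ω, X ω := by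
  simpa using hX _ h1 []

end PosMultiplier

/-- Product configurations have positive moments if the single-site measure has. -/
lemma posMoments_one_pi {V G Q : Type*} [Fintype V] [DecidableEq V] [Fintype G] [DecidableEq G]
    [Fintype Q] (e : G → Q → ℝ) (he : ∀ p : G → ℕ, 0 ≤ ∑ q, ∏ g, e g q ^ p g) :
    PosMoments (fun (a : V × G) (ω : V → Q) => e a.2 (ω a.1)) fun _ => 1 := by
  intro l
  obtain ⟨t, ht⟩ : ∃ t : Multiset (V × G), t = l := ⟨_, rfl⟩
  -- Collecting the factors of the monomial by site makes the sum over configurations a product of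
  -- single-site moments.
  have key : ∀ ω : V → Q, (l.map fun a : V × G => e a.2 (ω a.1)).prod
      = ∏ v, ∏ g, e g (ω v) ^ t.count (v, g) := by
    intro ω
    rw [← Multiset.prod_coe, ← Multiset.map_coe, ← ht, Finset.prod_multiset_map_count,
      ← Fintype.prod_prod_type (f := fun a : V × G => e a.2 (ω a.1) ^ t.count a)]
    apply Finset.prod_subset (Finset.subset_univ _)
    intro a _ ha
    rw [Multiset.mem_toFinset] at ha
    simp [Multiset.count_eq_zero_of_notMem ha]
  simp only [key, one_mul]
  rw [← Fintype.prod_sum (f := fun (v : V) (q : Q) => ∏ g, e g q ^ t.count (v, g))]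
  exact Finset.prod_nonneg fun v _ => he _

/-! ### Four replicas of a spin -/

/-- The spins of four replicas at a site. -/
abbrev Quad : Type := Bool × Bool × Bool × Bool

/-- An orthogonal transformation (up to a factor `2`) of the four spins. -/
def quadMode (g : Fin 4) (q : Quad) : ℝ :=
  match g with
  | 0 => spin q.1 + spin q.2.1 + spin q.2.2.1 + spin q.2.2.2
  | 1 => -spin q.1 - spin q.2.1 + spin q.2.2.1 + spin q.2.2.2
  | 2 => -spin q.1 + spin q.2.1 - spin q.2.2.1 + spin q.2.2.2
  | 3 => -spin q.1 + spin q.2.1 + spin q.2.2.1 - spin q.2.2.2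

/-- A global flip negates all modes, so moments of odd total degree vanish. If an even number of the
four spins is -1, one mode is ±4 and the others are 0. If exactly one spin is deviant, all modes are
±2, and the four choices of the deviant spin contribute signs that add up to 4 or 0 in even total
degree. The proof checks all parities of the exponents. -/
lemma quadMode_moment_nonneg (p : Fin 4 → ℕ) : 0 ≤ ∑ q : Quad, ∏ g, quadMode g q ^ p g := by
  obtain ⟨a, ha⟩ : ∃ a, a = p 0 := ⟨_, rfl⟩
  obtain ⟨b, hb⟩ : ∃ a, a = p 1 := ⟨_, rfl⟩
  obtain ⟨c, hc⟩ : ∃ a, a = p 2 := ⟨_, rfl⟩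
  obtain ⟨d, hd⟩ : ∃ a, a = p 3 := ⟨_, rfl⟩
  simp only [Fin.prod_univ_four, quadMode, ← ha, ← hb, ← hc, ← hd, Fintype.sum_prod_type,
    Fintype.sum_bool, spin]
  norm_num
  have e1 : ∀ k : ℕ, (-2 : ℝ) ^ k = (-1) ^ k * 2 ^ k := fun k => by rw [← mul_pow]; norm_num
  have e2 : ∀ k : ℕ, (-4 : ℝ) ^ k = (-1) ^ k * 4 ^ k := fun k => by rw [← mul_pow]; norm_num
  simp only [e1, e2]
  have h0 : ∀ k : ℕ, (0 : ℝ) ≤ 0 ^ k := fun k => pow_nonneg le_rfl k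
  have z1 := h0 a
  have z2 := h0 b
  have z3 := h0 c
  have z4 := h0 d
  rcases neg_one_pow_eq_or ℝ a with h1 | h1 <;> rcases neg_one_pow_eq_or ℝ b with h2 | h2 <;>
    rcases neg_one_pow_eq_or ℝ c with h3 | h3 <;> rcases neg_one_pow_eq_or ℝ d with h4 | h4 <;>
    simp only [h1, h2, h3, h4] <;> ring_nf <;> positivity

namespace PosMultiplier

variable {Ω ι : Type*} [Fintype Ω] {e : ι → Ω → ℝ} {X Y : Ω → ℝ}

lemma congr (hX : PosMultiplier e X) (h : ∀ ω, X ω = Y ω) : PosMultiplier e Y :=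
  (funext h : X = Y) ▸ hX

/-- exp (k (X - c)) converges to the indicator of X = c, as c is an upper bound. This is how
conditioning on spins +1 enters: a sum of spins is maximal exactly if all of them are +1. -/
lemma indicator_max (hX : PosMultiplier e X) (c : ℝ) (hc : ∀ ω, X ω ≤ c) :
    PosMultiplier e fun ω => if X ω = c then 1 else 0 := by
  refine of_tendsto (X := fun k ω => Real.exp (-(k * c)) * Real.exp (k * X ω))
    (fun k => (const (Real.exp_pos _).le).mul ((const k.cast_nonneg).mul hX).exp) fun ω => ?_
  have hexp : ∀ k : ℕ, Real.exp (-(k * c)) * Real.exp (k * X ω) = Real.exp (X ω - c) ^ k := by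
    intro k
    rw [← Real.exp_add, ← Real.exp_nat_mul]
    congr 1
    ring
  simp only [hexp]
  split_ifs with h
  · simp [h]
  · exact tendsto_pow_atTop_nhds_zero_of_lt_one (Real.exp_pos _).le
      (by rw [Real.exp_lt_one_iff, sub_neg]; exact lt_of_le_of_ne (hc ω) h)

end PosMultiplier

lemma ite_mul_ite_one_zero (P Q : Prop) [Decidable P] [Decidable Q] :
    (if P then (1 : ℝ) else 0) * (if Q then 1 else 0) = if P ∧ Q then 1 else 0 := by
  by_cases P <;> by_cases Q <;> simp [*]

lemma spin_eq_ite (b : Bool) : spin b = 2 * (if b = true then 1 else 0) - 1 := by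
  cases b <;> norm_num [spin]

/-! ### The observable distribution -/

namespace RBM

variable {n m : ℕ} (R : RBM n m)

/-- The unnormalized observable distribution. -/
noncomputable def visWeight (x : Config n) : ℝ := ∑ y : Config m, R.weight x y

lemma weight_pos (x : Config n) (y : Config m) : 0 < R.weight x y := Real.exp_pos _

lemma visWeight_pos (x : Config n) : 0 < R.visWeight x :=
  Finset.sum_pos (fun y _ => R.weight_pos x y) Finset.univ_nonempty

lemma partition_pos : 0 < R.partition :=
  Finset.sum_pos (fun x _ => R.visWeight_pos x) Finset.univ_nonempty

lemma visibleProb_eq (x : Config n) : R.visibleProb x = R.visWeight x / R.partition := by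
  simp only [visibleProb, jointProb, visWeight, Finset.sum_div]

lemma visibleProb_pos (x : Config n) : 0 < R.visibleProb x := by
  rw [visibleProb_eq]
  exact div_pos (R.visWeight_pos x) R.partition_pos

lemma sum_visibleProb : ∑ x, R.visibleProb x = 1 := by
  simp only [visibleProb_eq, ← Finset.sum_div]
  exact div_self R.partition_pos.ne'

/-! ### Replicas -/

/-- Configurations of four replicas of all nodes. -/
abbrev Replicas (n m : ℕ) : Type := Fin n ⊕ Fin m → Quad

/-- The generators of the algebra of functions on four replicas. -/
def replicaMode (n m : ℕ) (a : (Fin n ⊕ Fin m) × Fin 4) (ω : Replicas n m) : ℝ :=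
  quadMode a.2 (ω a.1)

lemma posMoments_replicaMode : PosMoments (replicaMode n m) fun _ => 1 :=
  posMoments_one_pi quadMode quadMode_moment_nonneg

/-- The weight of four replicas. -/
noncomputable def replicaWeight (ω : Replicas n m) : ℝ :=
  R.weight (fun i => (ω (.inl i)).1) (fun j => (ω (.inr j)).1) *
  R.weight (fun i => (ω (.inl i)).2.1) (fun j => (ω (.inr j)).2.1) *
  R.weight (fun i => (ω (.inl i)).2.2.1) (fun j => (ω (.inr j)).2.2.1) *
  R.weight (fun i => (ω (.inl i)).2.2.2) (fun j => (ω (.inr j)).2.2.2)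

/-- The modes are an orthogonal transformation up to the factor 2, so the sum of the four products
of spins at two sites is a quarter of the sum of the four products of modes. The external fields
couple only to mode 0. -/
lemma posMultiplier_replicaWeight {R : RBM n m} (hR : R.Ferromagnetic) :
    PosMultiplier (replicaMode n m) R.replicaWeight := by
  obtain ⟨hJ, hf, hg⟩ := hR
  have h : PosMultiplier (replicaMode n m) fun ω => Real.exp
      ((∑ i, ∑ j, ∑ g, R.J i j / 4 * (replicaMode n m (.inl i, g) ω * replicaMode n m (.inr j, g) ω))
        + (∑ i, R.f i * replicaMode n m (.inl i, 0) ω)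
        + ∑ j, R.g j * replicaMode n m (.inr j, 0) ω) := by
    refine (PosMultiplier.add (.add (.sum _ fun i _ => .sum _ fun j _ => .sum _ fun g _ => ?_)
      (.sum _ fun i _ => ?_)) (.sum _ fun j _ => ?_)).exp
    · exact (PosMultiplier.const (by have := hJ i j; positivity)).mul
        ((PosMultiplier.gen _).mul (.gen _))
    · exact (PosMultiplier.const (hf i)).mul (.gen _)
    · exact (PosMultiplier.const (hg j)).mul (.gen _)
  refine h.congr fun ω => ?_
  simp only [replicaWeight, weight, ← Real.exp_add]
  congr 1
  have e1 : ∀ i j, ∑ g, R.J i j / 4 *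
        (replicaMode n m (.inl i, g) ω * replicaMode n m (.inr j, g) ω)
      = spin (ω (.inl i)).1 * R.J i j * spin (ω (.inr j)).1
        + spin (ω (.inl i)).2.1 * R.J i j * spin (ω (.inr j)).2.1
        + spin (ω (.inl i)).2.2.1 * R.J i j * spin (ω (.inr j)).2.2.1
        + spin (ω (.inl i)).2.2.2 * R.J i j * spin (ω (.inr j)).2.2.2 := by
    intro i j
    simp only [Fin.sum_univ_four, replicaMode, quadMode]
    ring
  simp only [e1, Finset.sum_add_distrib]
  simp only [replicaMode, quadMode, mul_add, Finset.sum_add_distrib]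
  ring

/-- The replicas are independent, and each test function sees only the visible nodes, so the latent
nodes are summed out in each replica. -/
lemma sum_replicas (A B C D : Config n → ℝ) :
    ∑ ω : Replicas n m, A (fun i => (ω (.inl i)).1) * B (fun i => (ω (.inl i)).2.1) *
        C (fun i => (ω (.inl i)).2.2.1) * D (fun i => (ω (.inl i)).2.2.2) * R.replicaWeight ω
      = (∑ x, A x * R.visWeight x) * (∑ x, B x * R.visWeight x) * (∑ x, C x * R.visWeight x)
        * (∑ x, D x * R.visWeight x) := by
  have key : ∀ A : Config n → ℝ, ∑ x, A x * R.visWeight x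
      = ∑ z : Fin n ⊕ Fin m → Bool, A (fun i => z (.inl i)) *
          R.weight (fun i => z (.inl i)) (fun j => z (.inr j)) := by
    intro A
    rw [← (Equiv.sumArrowEquivProdArrow (Fin n) (Fin m) Bool).symm.sum_comp,
      Fintype.sum_prod_type]
    simp [visWeight, Finset.mul_sum, Equiv.sumArrowEquivProdArrow]
  simp only [key]
  let E : Replicas n m ≃ ((Fin n ⊕ Fin m → Bool) × (Fin n ⊕ Fin m → Bool) ×
      (Fin n ⊕ Fin m → Bool) × (Fin n ⊕ Fin m → Bool)) :=
    (Equiv.arrowProdEquivProdArrow _ _ _).trans (Equiv.prodCongr (Equiv.refl _)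
      ((Equiv.arrowProdEquivProdArrow _ _ _).trans (Equiv.prodCongr (Equiv.refl _)
        (Equiv.arrowProdEquivProdArrow _ _ _))))
  rw [← E.symm.sum_comp]
  simp only [Fintype.sum_prod_type, mul_assoc]
  rw [Finset.sum_mul]
  refine Finset.sum_congr rfl fun a _ => ?_
  rw [Finset.sum_mul, Finset.mul_sum]
  refine Finset.sum_congr rfl fun b _ => ?_
  rw [Finset.sum_mul, Finset.mul_sum, Finset.mul_sum]
  refine Finset.sum_congr rfl fun c _ => ?_
  rw [Finset.mul_sum, Finset.mul_sum, Finset.mul_sum]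
  refine Finset.sum_congr rfl fun d _ => ?_
  simp only [replicaWeight, E, Equiv.arrowProdEquivProdArrow, Equiv.symm_trans_apply,
    Equiv.prodCongr_symm, Equiv.prodCongr_apply, Equiv.refl_symm, Equiv.coe_fn_symm_mk,
    Prod.map, Equiv.refl_apply]
  ring

lemma sum_replicas_quadMode_three (u : Fin n) (A B C D : Config n → ℝ) :
    ∑ ω : Replicas n m, A (fun i => (ω (.inl i)).1) * B (fun i => (ω (.inl i)).2.1) *
        C (fun i => (ω (.inl i)).2.2.1) * D (fun i => (ω (.inl i)).2.2.2) *
        quadMode 3 (ω (.inl u)) * R.replicaWeight ω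
      = -((∑ x, A x * spin (x u) * R.visWeight x) * (∑ x, B x * R.visWeight x) * (∑ x, C x * R.visWeight x) * (∑ x, D x * R.visWeight x))
        + (∑ x, A x * R.visWeight x) * (∑ x, B x * spin (x u) * R.visWeight x) * (∑ x, C x * R.visWeight x) * (∑ x, D x * R.visWeight x)
        + (∑ x, A x * R.visWeight x) * (∑ x, B x * R.visWeight x) * (∑ x, C x * spin (x u) * R.visWeight x) * (∑ x, D x * R.visWeight x)
        - (∑ x, A x * R.visWeight x) * (∑ x, B x * R.visWeight x) * (∑ x, C x * R.visWeight x) * (∑ x, D x * spin (x u) * R.visWeight x) := by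
  rw [← R.sum_replicas (fun x => A x * spin (x u)) B C D,
    ← R.sum_replicas A (fun x => B x * spin (x u)) C D,
    ← R.sum_replicas A B (fun x => C x * spin (x u)) D,
    ← R.sum_replicas A B C (fun x => D x * spin (x u)),
    ← Finset.sum_neg_distrib, ← Finset.sum_add_distrib, ← Finset.sum_add_distrib, ← Finset.sum_sub_distrib]
  refine Finset.sum_congr rfl fun ω _ => ?_
  simp only [quadMode]
  ring

lemma sum_replicas_quadMode_zero (u : Fin n) (A B C D : Config n → ℝ) :
    ∑ ω : Replicas n m, A (fun i => (ω (.inl i)).1) * B (fun i => (ω (.inl i)).2.1) *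
        C (fun i => (ω (.inl i)).2.2.1) * D (fun i => (ω (.inl i)).2.2.2) *
        quadMode 0 (ω (.inl u)) * R.replicaWeight ω
      = (∑ x, A x * spin (x u) * R.visWeight x) * (∑ x, B x * R.visWeight x) * (∑ x, C x * R.visWeight x) * (∑ x, D x * R.visWeight x)
        + (∑ x, A x * R.visWeight x) * (∑ x, B x * spin (x u) * R.visWeight x) * (∑ x, C x * R.visWeight x) * (∑ x, D x * R.visWeight x)
        + (∑ x, A x * R.visWeight x) * (∑ x, B x * R.visWeight x) * (∑ x, C x * spin (x u) * R.visWeight x) * (∑ x, D x * R.visWeight x)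
        + (∑ x, A x * R.visWeight x) * (∑ x, B x * R.visWeight x) * (∑ x, C x * R.visWeight x) * (∑ x, D x * spin (x u) * R.visWeight x) := by
  rw [← R.sum_replicas (fun x => A x * spin (x u)) B C D,
    ← R.sum_replicas A (fun x => B x * spin (x u)) C D,
    ← R.sum_replicas A B (fun x => C x * spin (x u)) D,
    ← R.sum_replicas A B C (fun x => D x * spin (x u)),
    ← Finset.sum_add_distrib, ← Finset.sum_add_distrib, ← Finset.sum_add_distrib]
  refine Finset.sum_congr rfl fun ω _ => ?_
  simp only [quadMode]
  ring

/-! ### Influence -/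

/-- The indicator of `x_T = 1`. -/
def ones (T : Finset (Fin n)) (x : Config n) : ℝ := if ∀ i ∈ T, x i = true then 1 else 0

/-- `P(X_T = 1)`. -/
noncomputable def probOnes (T : Finset (Fin n)) : ℝ := ∑ x, ones T x * R.visibleProb x

/-- The influence of `T` on `u`: the expectation of `X_u` given `X_T = 1`. -/
noncomputable def influence (u : Fin n) (T : Finset (Fin n)) : ℝ :=
  (∑ x, ones T x * spin (x u) * R.visibleProb x) / R.probOnes T

lemma ones_nonneg (T : Finset (Fin n)) (x : Config n) : 0 ≤ ones T x := by
  unfold ones; split_ifs <;> norm_num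

lemma probOnes_pos (T : Finset (Fin n)) : 0 < R.probOnes T := by
  refine Finset.sum_pos' (fun x _ => mul_nonneg (ones_nonneg T x) (R.visibleProb_pos x).le)
    ⟨fun _ => true, Finset.mem_univ _, ?_⟩
  simp [ones, R.visibleProb_pos]

lemma probOnes_eq (T : Finset (Fin n)) :
    R.probOnes T = (∑ x, ones T x * R.visWeight x) / R.partition := by
  simp only [probOnes, visibleProb_eq, Finset.sum_div, mul_div_assoc]

lemma marginal_eq_probOnes (T : Finset (Fin n)) : R.marginal T (fun _ => true) = R.probOnes T := by
  simp [marginal, probOnes, ones]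

lemma ones_insert (u : Fin n) (T : Finset (Fin n)) (x : Config n) :
    ones (insert u T) x = ones T x * (if x u = true then 1 else 0) := by
  simp only [ones, ite_mul_ite_one_zero, Finset.forall_mem_insert, and_comm]

lemma influence_eq (u : Fin n) (T : Finset (Fin n)) :
    R.influence u T = 2 * (R.probOnes (insert u T) / R.probOnes T) - 1 := by
  have h := (R.probOnes_pos T).ne'
  rw [influence, div_eq_iff h, sub_mul, mul_assoc, div_mul_cancel₀ _ h, one_mul]
  simp only [probOnes, ones_insert, Finset.mul_sum, ← Finset.sum_sub_distrib, spin_eq_ite]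
  exact Finset.sum_congr rfl fun x _ => by ring

lemma influence_eq_visWeight (u : Fin n) (T : Finset (Fin n)) :
    R.influence u T = (∑ x, ones T x * spin (x u) * R.visWeight x) /
      ∑ x, ones T x * R.visWeight x := by
  rw [influence, probOnes_eq]
  simp only [visibleProb_eq, ← mul_div_assoc, ← Finset.sum_div]
  rw [div_div_div_cancel_right₀ R.partition_pos.ne']

lemma influence_of_mem {u : Fin n} {T : Finset (Fin n)} (h : u ∈ T) : R.influence u T = 1 := by
  rw [influence_eq, Finset.insert_eq_of_mem h, div_self (R.probOnes_pos T).ne']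
  norm_num

variable {R}

lemma posMultiplier_indicator4 (v : Fin n) : PosMultiplier (replicaMode n m) fun ω =>
    if (ω (.inl v)).1 = true ∧ (ω (.inl v)).2.1 = true ∧ (ω (.inl v)).2.2.1 = true ∧
      (ω (.inl v)).2.2.2 = true then 1 else 0 := by
  refine ((PosMultiplier.gen (e := replicaMode n m) (.inl v, 0)).indicator_max 4
    fun ω => ?_).congr fun ω => ?_ <;> simp only [replicaMode] <;>
  · obtain ⟨⟨a, b, c, d⟩, hq⟩ : ∃ q, ω (.inl v) = q := ⟨_, rfl⟩
    cases a <;> cases b <;> cases c <;> cases d <;> norm_num [quadMode, spin, hq]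

/-- The modes 0 and 2 add up to twice the sum of the second and fourth spins. With mode 1 instead of
mode 2 the third and fourth spins remain. These are the replicas conditioned on i, respectively on
j, in the submodularity inequality. -/
lemma posMultiplier_indicator24 (v : Fin n) : PosMultiplier (replicaMode n m) fun ω =>
    if (ω (.inl v)).2.1 = true ∧ (ω (.inl v)).2.2.2 = true then 1 else 0 := by
  refine (((PosMultiplier.gen (e := replicaMode n m) (.inl v, 0)).add
    (.gen (.inl v, 2))).indicator_max 4 fun ω => ?_).congr fun ω => ?_ <;>
    simp only [replicaMode] <;>
  · obtain ⟨⟨a, b, c, d⟩, hq⟩ : ∃ q, ω (.inl v) = q := ⟨_, rfl⟩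
    cases a <;> cases b <;> cases c <;> cases d <;> norm_num [quadMode, spin, hq]

lemma posMultiplier_indicator34 (v : Fin n) : PosMultiplier (replicaMode n m) fun ω =>
    if (ω (.inl v)).2.2.1 = true ∧ (ω (.inl v)).2.2.2 = true then 1 else 0 := by
  refine (((PosMultiplier.gen (e := replicaMode n m) (.inl v, 0)).add
    (.gen (.inl v, 1))).indicator_max 4 fun ω => ?_).congr fun ω => ?_ <;>
    simp only [replicaMode] <;>
  · obtain ⟨⟨a, b, c, d⟩, hq⟩ : ∃ q, ω (.inl v) = q := ⟨_, rfl⟩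
    cases a <;> cases b <;> cases c <;> cases d <;> norm_num [quadMode, spin, hq]

lemma ones_mul_four (S : Finset (Fin n)) (a b c d : Config n) :
    ones S a * ones S b * ones S c * ones S d
      = ∏ v ∈ S, if a v = true ∧ b v = true ∧ c v = true ∧ d v = true then 1 else 0 := by
  rw [Finset.prod_boole]
  simp only [ones, ite_mul_ite_one_zero]
  congr 1
  simp only [eq_iff_iff]
  exact ⟨fun h v hv => ⟨h.1.1.1 v hv, h.1.1.2 v hv, h.1.2 v hv, h.2 v hv⟩,
    fun h => ⟨⟨⟨fun v hv => (h v hv).1, fun v hv => (h v hv).2.1⟩,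
      fun v hv => (h v hv).2.2.1⟩, fun v hv => (h v hv).2.2.2⟩⟩

/-- The Griffiths–Hurst–Sherman inequality, in the form of submodularity of the influence. -/
theorem influence_submodular (hR : R.Ferromagnetic) (u i j : Fin n) (S : Finset (Fin n)) :
    R.influence u S + R.influence u (insert i (insert j S))
      ≤ R.influence u (insert i S) + R.influence u (insert j S) := by
  have hpos : 0 ≤ ∑ ω : Replicas n m,
      ones S (fun i => (ω (.inl i)).1) * ones (insert i S) (fun i => (ω (.inl i)).2.1) *
        ones (insert j S) (fun i => (ω (.inl i)).2.2.1) *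
        ones (insert i (insert j S)) (fun i => (ω (.inl i)).2.2.2) *
        quadMode 3 (ω (.inl u)) * R.replicaWeight ω := by
    refine PosMultiplier.sum_nonneg (e := replicaMode n m) ?_ posMoments_replicaMode
    refine ((((PosMultiplier.prod S fun v _ => posMultiplier_indicator4 v).mul
      ((posMultiplier_indicator24 i).mul (posMultiplier_indicator34 j))).mul
        (.gen (.inl u, 3))).mul (posMultiplier_replicaWeight hR)).congr fun ω => ?_
    rw [replicaMode]
    congr 2
    rw [← ones_mul_four S (fun i => (ω (.inl i)).1) (fun i => (ω (.inl i)).2.1)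
      (fun i => (ω (.inl i)).2.2.1) (fun i => (ω (.inl i)).2.2.2)]
    simp only [ones_insert, ← ite_mul_ite_one_zero]
    ring
  have hZ : ∀ T : Finset (Fin n), 0 < ∑ x, ones T x * R.visWeight x := fun T => by
    have := R.probOnes_pos T
    rw [probOnes_eq] at this
    exact (div_pos_iff_of_pos_right R.partition_pos).1 this
  replace hpos := hpos.trans_eq (R.sum_replicas_quadMode_three u _ _ _ _)
  simp only [influence_eq_visWeight]
  have h1 := hZ S
  have h2 := hZ (insert i S)
  have h3 := hZ (insert j S)
  have h4 := hZ (insert i (insert j S))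
  -- Over the common denominator, the four products of sums in `hpos` are the four numerators.
  rw [div_add_div _ _ h1.ne' h4.ne', div_add_div _ _ h2.ne' h3.ne',
    div_le_div_iff₀ (by positivity) (by positivity)]
  linarith

/-- All four replicas are conditioned on S. The mean of mode 0 at u is then four times the
influence. -/
lemma influence_nonneg (hR : R.Ferromagnetic) (u : Fin n) (S : Finset (Fin n)) :
    0 ≤ R.influence u S := by
  have hpos : 0 ≤ ∑ ω : Replicas n m,
      ones S (fun i => (ω (.inl i)).1) * ones S (fun i => (ω (.inl i)).2.1) *
        ones S (fun i => (ω (.inl i)).2.2.1) * ones S (fun i => (ω (.inl i)).2.2.2) *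
        quadMode 0 (ω (.inl u)) * R.replicaWeight ω := by
    refine PosMultiplier.sum_nonneg (e := replicaMode n m) ?_ posMoments_replicaMode
    refine (((PosMultiplier.prod S fun v _ => posMultiplier_indicator4 v).mul
        (.gen (.inl u, 0))).mul (posMultiplier_replicaWeight hR)).congr fun ω => ?_
    rw [replicaMode, ← ones_mul_four S (fun i => (ω (.inl i)).1) (fun i => (ω (.inl i)).2.1)
      (fun i => (ω (.inl i)).2.2.1) (fun i => (ω (.inl i)).2.2.2)]
  have hZ : 0 < ∑ x, ones S x * R.visWeight x := by
    have := R.probOnes_pos S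
    rw [probOnes_eq] at this
    exact (div_pos_iff_of_pos_right R.partition_pos).1 this
  replace hpos := hpos.trans_eq (R.sum_replicas_quadMode_zero u _ _ _ _)
  rw [influence_eq_visWeight]
  refine div_nonneg ?_ hZ.le
  have h3 : 0 < (∑ x, ones S x * R.visWeight x) ^ 3 := by positivity
  refine nonneg_of_mul_nonneg_left (b := 4 * (∑ x, ones S x * R.visWeight x) ^ 3) ?_
    (by positivity)
  linarith

lemma influence_le_one (u : Fin n) (S : Finset (Fin n)) : R.influence u S ≤ 1 := by
  rw [influence, div_le_one (R.probOnes_pos S)]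
  refine Finset.sum_le_sum fun x _ => mul_le_mul_of_nonneg_right ?_ (R.visibleProb_pos x).le
  refine mul_le_of_le_one_right (ones_nonneg S x) ?_
  unfold spin; split_ifs <;> norm_num

/-- Submodularity with j = u: the two sets that contain u have influence 1, and these terms cancel.
-/
lemma influence_le_insert (hR : R.Ferromagnetic) (u i : Fin n) (S : Finset (Fin n)) :
    R.influence u S ≤ R.influence u (insert i S) := by
  have h := influence_submodular hR u i u S
  rw [R.influence_of_mem (Finset.mem_insert_self u S),
    R.influence_of_mem (Finset.mem_insert_of_mem (Finset.mem_insert_self u S))] at h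
  linarith

lemma influence_mono (hR : R.Ferromagnetic) (u : Fin n) {S T : Finset (Fin n)} (h : S ⊆ T) :
    R.influence u S ≤ R.influence u T := by
  rw [← Finset.union_sdiff_of_subset h]
  induction T \ S using Finset.induction_on with
  | empty => simp
  | insert i A _ ih =>
    rw [Finset.union_insert]
    exact ih.trans (influence_le_insert hR u i _)

end RBM

/-! ### Diminishing gains, and the probability of the conditioning events -/

namespace RBM

variable {n m : ℕ} {R : RBM n m}

lemma influence_union_sub_le (hR : R.Ferromagnetic) (u : Fin n) (S A : Finset (Fin n)) :
    R.influence u (S ∪ A) - R.influence u S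
      ≤ ∑ j ∈ A, (R.influence u (insert j S) - R.influence u S) := by
  induction A using Finset.induction_on with
  | empty => simp
  | insert i A hi ih =>
    rw [Finset.sum_insert hi, Finset.union_insert]
    suffices h : R.influence u (insert i (S ∪ A)) - R.influence u (S ∪ A)
        ≤ R.influence u (insert i S) - R.influence u S by linarith
    clear hi ih
    induction A using Finset.induction_on with
    | empty => simp
    | insert j A _ ih =>
      rw [Finset.union_insert]
      linarith [influence_submodular hR u i j (S ∪ A)]

lemma influence_gain_antitone (hR : R.Ferromagnetic) (u i : Fin n) {S T : Finset (Fin n)}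
    (h : S ⊆ T) : R.influence u (insert i T) - R.influence u T
      ≤ R.influence u (insert i S) - R.influence u S := by
  rw [← Finset.union_sdiff_of_subset h]
  induction T \ S using Finset.induction_on with
  | empty => simp
  | insert j A _ ih =>
    rw [Finset.union_insert]
    linarith [influence_submodular hR u i j (S ∪ A)]

lemma probOnes_empty : R.probOnes ∅ = 1 := by simp [probOnes, ones, sum_visibleProb]

/-- Nonnegative influence of S on i says P(X_i = 1 | X_S = 1) ≥ 1/2. The chain rule multiplies these
bounds. -/
lemma half_pow_card_le_probOnes (hR : R.Ferromagnetic) (S : Finset (Fin n)) :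
    (1 / 2 : ℝ) ^ S.card ≤ R.probOnes S := by
  induction S using Finset.induction_on with
  | empty => simp [probOnes_empty]
  | insert i S hi ih =>
    have h := influence_nonneg hR i S
    have hp := R.probOnes_pos S
    rw [influence_eq] at h
    have h2 : 1 / 2 ≤ R.probOnes (insert i S) / R.probOnes S := by linarith
    rw [le_div_iff₀ hp] at h2
    rw [Finset.card_insert_of_notMem hi, pow_succ]
    linarith

/-! ### Summing out the latent nodes -/

/-- The field at the latent node `k`. -/
def latentField (R : RBM n m) (x : Config n) (k : Fin m) : ℝ :=
  R.g k + ∑ i, R.J i k * spin (x i)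

lemma visWeight_eq (x : Config n) :
    R.visWeight x = Real.exp (∑ i, R.f i * spin (x i)) *
      ∏ k, (2 * Real.cosh (R.latentField x k)) := by
  have h1 : ∀ k, 2 * Real.cosh (R.latentField x k)
      = ∑ b : Bool, Real.exp (spin b * R.latentField x k) := by
    intro k
    simp [spin, Real.cosh_eq]
    ring
  simp only [h1, Fintype.prod_sum, visWeight, weight, Finset.mul_sum, ← Real.exp_sum,
    ← Real.exp_add]
  refine Finset.sum_congr rfl fun y _ => ?_
  congr 1
  simp only [latentField, mul_add, Finset.sum_add_distrib, Finset.mul_sum]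
  rw [Finset.sum_comm]
  have e1 : ∑ k, R.g k * spin (y k) = ∑ k, spin (y k) * R.g k :=
    Finset.sum_congr rfl fun k _ => by ring
  have e2 : ∑ k, ∑ i, spin (x i) * R.J i k * spin (y k)
      = ∑ k, ∑ i, spin (y k) * (R.J i k * spin (x i)) :=
    Finset.sum_congr rfl fun k _ => Finset.sum_congr rfl fun i _ => by ring
  rw [e1, e2]
  ring

lemma spin_update {x : Config n} {u : Fin n} {b : Bool} (i : Fin n) :
    spin (Function.update x u b i) = if i = u then spin b else spin (x i) := by
  by_cases h : i = u <;> simp [h]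

lemma abs_spin (b : Bool) : |spin b| = 1 := by cases b <;> norm_num [spin]

lemma abs_spin_sub_le (a b : Bool) : |spin a - spin b| ≤ 2 := by
  cases a <;> cases b <;> norm_num [spin]

/-- For each fixed latent configuration the local field at u is at most β in absolute value, so a
flip of u changes the exponent by at most 2β. -/
lemma visWeight_update_le {α β : ℝ} (hN : R.NonDegenerate α β) (x : Config n) (u : Fin n)
    (a b : Bool) : R.visWeight (Function.update x u a)
      ≤ Real.exp (2 * β) * R.visWeight (Function.update x u b) := by
  simp only [visWeight, Finset.mul_sum]
  refine Finset.sum_le_sum fun y _ => ?_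
  simp only [weight, ← Real.exp_add]
  rw [Real.exp_le_exp]
  have key : ∀ a, (∑ i, ∑ j, spin (Function.update x u a i) * R.J i j * spin (y j))
      + (∑ i, R.f i * spin (Function.update x u a i))
      = spin a * ((∑ j, R.J u j * spin (y j)) + R.f u)
        + ∑ i ∈ Finset.univ.erase u, ((∑ j, spin (x i) * R.J i j * spin (y j)) +
          R.f i * spin (x i)) := by
    intro a
    rw [← Finset.sum_add_distrib, ← Finset.add_sum_erase _ _ (Finset.mem_univ u)]
    congr 1
    · simp only [Function.update_self, mul_add, Finset.mul_sum]
      rw [mul_comm (R.f u)]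
      congr 1
      exact Finset.sum_congr rfl fun j _ => by ring
    · refine Finset.sum_congr rfl fun i hi => ?_
      simp only [Function.update_of_ne (Finset.ne_of_mem_erase hi)]
  rw [key, key]
  have hb : |(∑ j, R.J u j * spin (y j)) + R.f u| ≤ β := by
    refine (abs_add_le _ _).trans (le_trans ?_ (hN.2.1 u))
    gcongr
    refine (Finset.abs_sum_le_sum_abs _ _).trans (Finset.sum_le_sum fun j _ => ?_)
    rw [abs_mul, abs_spin, mul_one]
  have h := (le_abs_self _).trans_eq (abs_mul (spin a - spin b)
    ((∑ j, R.J u j * spin (y j)) + R.f u))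
  have h2 := mul_le_mul (abs_spin_sub_le a b) hb (abs_nonneg _) zero_le_two
  linarith

/-! ### The two-hop neighborhood -/

open Classical in
/-- The visible nodes that share a latent neighbor with `u`. -/
noncomputable def commonNbhd (R : RBM n m) (u : Fin n) : Finset (Fin n) :=
  Finset.univ.filter fun v => v ≠ u ∧ ∃ k, R.J u k ≠ 0 ∧ R.J v k ≠ 0

lemma mem_commonNbhd {u v : Fin n} :
    v ∈ R.commonNbhd u ↔ v ≠ u ∧ ∃ k, R.J u k ≠ 0 ∧ R.J v k ≠ 0 := by
  simp [commonNbhd]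

lemma latentField_update (x : Config n) (u : Fin n) (b : Bool) (k : Fin m) :
    R.latentField (Function.update x u b) k = R.J u k * spin b +
      (R.g k + ∑ i ∈ Finset.univ.erase u, R.J i k * spin (x i)) := by
  rw [latentField, ← Finset.add_sum_erase _ _ (Finset.mem_univ u)]
  rw [Finset.sum_congr rfl fun i hi => by
    rw [Function.update_of_ne (Finset.ne_of_mem_erase hi)]]
  simp
  ring

/-- This is the Markov property in cross-multiplied form. A latent factor not coupled to u does not
see the value at u and appears on both sides. A factor coupled to u sees, besides u, only nodes of
`commonNbhd`, where x and y agree. -/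
lemma visWeight_update_mul (u : Fin n) {x y : Config n} (h : ∀ i ∈ R.commonNbhd u, x i = y i)
    (a b : Bool) :
    R.visWeight (Function.update x u a) * R.visWeight (Function.update y u b)
      = R.visWeight (Function.update y u a) * R.visWeight (Function.update x u b) := by
  simp only [visWeight_eq]
  rw [mul_mul_mul_comm, mul_mul_mul_comm (Real.exp (∑ i, R.f i * spin (Function.update y u a i))),
    ← Real.exp_add, ← Real.exp_add, ← Finset.prod_mul_distrib, ← Finset.prod_mul_distrib,
    ← Finset.sum_add_distrib, ← Finset.sum_add_distrib]
  congr 1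
  · congr 1
    refine Finset.sum_congr rfl fun i _ => ?_
    simp only [spin_update]
    split_ifs <;> ring
  · refine Finset.prod_congr rfl fun k _ => ?_
    by_cases hk : R.J u k = 0
    · simp only [latentField_update, hk, zero_mul]
      ring
    · have : ∀ b, R.latentField (Function.update x u b) k
          = R.latentField (Function.update y u b) k := by
        intro b
        simp only [latentField_update]
        congr 2
        refine Finset.sum_congr rfl fun i hi => ?_
        by_cases hi' : R.J i k = 0
        · simp [hi']
        · rw [h i (mem_commonNbhd.2 ⟨Finset.ne_of_mem_erase hi, k, hk, hi'⟩)]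
      rw [this, this]

/-- The last factor is the conditional probability of x_u. It does not involve T, from which both
conditional independence and the constancy of the influence on the sets containing `commonNbhd`
follow. -/
lemma marginal_insert (u : Fin n) {T : Finset (Fin n)} (hu : u ∉ T) (hT : R.commonNbhd u ⊆ T)
    (x : Config n) : R.marginal (insert u T) x = R.marginal T x *
      (R.visWeight x / (R.visWeight x + R.visWeight (Function.update x u (!x u)))) := by
  have hpos := R.visWeight_pos x
  have hpos' := R.visWeight_pos (Function.update x u (!x u))
  obtain ⟨E, hE⟩ : ∃ E : Config n ≃ Config n, ∀ z, E z = Function.update z u (!z u) :=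
    have h : Function.Involutive fun z : Config n => Function.update z u (!z u) := fun z => by simp
    ⟨h.toPerm, fun _ => rfl⟩
  have hsplit : R.marginal T x = R.marginal (insert u T) x +
      R.marginal (insert u T) (Function.update x u (!x u)) := by
    simp only [marginal, ← Finset.sum_add_distrib]
    refine Finset.sum_congr rfl fun z _ => ?_
    have e : (∀ i ∈ T, z i = Function.update x u (!x u) i) ↔ ∀ i ∈ T, z i = x i :=
      forall₂_congr fun i hi => by
        rw [Function.update_of_ne (fun h : i = u => hu (h ▸ hi))]
    simp only [Finset.forall_mem_insert, e, Function.update_self]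
    by_cases h1 : ∀ i ∈ T, z i = x i <;> cases h2 : z u <;> cases h3 : x u <;> simp [h1]
  -- Reindexing by the flip of u reduces this to the cross-multiplied Markov property, term by term.
  have hflip : R.marginal (insert u T) (Function.update x u (!x u)) * R.visWeight x
      = R.marginal (insert u T) x * R.visWeight (Function.update x u (!x u)) := by
    rw [marginal, ← E.sum_comp]
    simp only [marginal, Finset.sum_mul]
    refine Finset.sum_congr rfl fun z _ => ?_
    have e : (∀ i ∈ T, E z i = Function.update x u (!x u) i) ↔ ∀ i ∈ T, z i = x i :=
      forall₂_congr fun i hi => by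
        have hi' : i ≠ u := fun h => hu (h ▸ hi)
        simp [hE, hi']
    have e' : E z u = Function.update x u (!x u) u ↔ z u = x u := by simp [hE]
    simp only [Finset.forall_mem_insert, e, e']
    split_ifs with h
    · have := visWeight_update_mul (R := R) u (x := z) (y := x)
        (fun i hi => h.2 i (hT hi)) (!x u) (x u)
      rw [Function.update_eq_self, ← h.1, Function.update_eq_self] at this
      simp only [visibleProb_eq, hE, div_mul_eq_mul_div, ← h.1]
      rw [this, mul_comm]
    · simp
  rw [hsplit, ← mul_div_assoc, eq_div_iff (by positivity)]
  linarith

lemma condIndep_of_commonNbhd_subset {u j : Fin n} {S : Finset (Fin n)} (hu : u ∉ S)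
    (hS : R.commonNbhd u ⊆ S) (hj : j ≠ u) : R.CondIndep u j S := by
  intro x
  rw [marginal_insert u hu hS, marginal_insert u (by simp [hu, hj.symm])
    (hS.trans (Finset.subset_insert j S))]
  ring

lemma influence_eq_of_commonNbhd_subset {u : Fin n} {S T : Finset (Fin n)} (hS : u ∉ S)
    (hT : u ∉ T) (hS' : R.commonNbhd u ⊆ S) (hT' : R.commonNbhd u ⊆ T) :
    R.influence u S = R.influence u T := by
  have h := marginal_insert u hS hS' fun _ => true
  have h' := marginal_insert u hT hT' fun _ => true
  rw [marginal_eq_probOnes, marginal_eq_probOnes] at h h'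
  rw [influence_eq, influence_eq, h, h', mul_div_cancel_left₀ _ (R.probOnes_pos S).ne',
    mul_div_cancel_left₀ _ (R.probOnes_pos T).ne']

/-! ### Lower bound on the gain of a two-hop neighbor -/

lemma two_mul_cosh_mul_cosh (r t : ℝ) :
    2 * (Real.cosh (r + t) * Real.cosh (r - t)) = Real.cosh (2 * r) + Real.cosh (2 * t) := by
  have h1 := Real.cosh_add (r + t) (r - t)
  have h2 := Real.cosh_sub (r + t) (r - t)
  rw [show (r + t) + (r - t) = 2 * r by ring] at h1
  rw [show (r + t) - (r - t) = 2 * t by ring] at h2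
  linarith

lemma cosh_two_mul_add_sub (p s : ℝ) : Real.cosh (2 * (p + s)) - Real.cosh (2 * (p - s))
    = 2 * (Real.sinh (2 * p) * Real.sinh (2 * s)) := by
  rw [mul_add, mul_sub, Real.cosh_add, Real.cosh_sub]
  ring

/-- For a latent node with couplings p, s to the two spins and remaining field r, the products
compare equal with opposite spins. Their difference is sinh 2p · sinh 2s ≥ 4α², and their sum is at
most 2e^{2β}. -/
lemma cosh_sq_le {α β p s r : ℝ} (hα : 0 < α) (hp : α ≤ p) (hs : α ≤ s) (hr : 0 ≤ r)
    (h : r + p + s ≤ β) :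
    (2 * α ^ 2) * (Real.cosh (r + p + s) * Real.cosh (r - p - s)
        + Real.cosh (r + p - s) * Real.cosh (r - p + s))
      ≤ Real.exp (2 * β) * (Real.cosh (r + p + s) * Real.cosh (r - p - s)
        - Real.cosh (r + p - s) * Real.cosh (r - p + s)) := by
  have hp0 : 0 < p := hα.trans_le hp
  have hs0 : 0 < s := hα.trans_le hs
  have e1 : Real.cosh (r + p + s) * Real.cosh (r - p - s)
      = (Real.cosh (2 * r) + Real.cosh (2 * (p + s))) / 2 := by
    rw [← two_mul_cosh_mul_cosh, ← add_assoc, ← sub_sub, mul_div_cancel_left₀ _ two_ne_zero]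
  have e2 : Real.cosh (r + p - s) * Real.cosh (r - p + s)
      = (Real.cosh (2 * r) + Real.cosh (2 * (p - s))) / 2 := by
    rw [← two_mul_cosh_mul_cosh, ← add_sub_assoc, ← sub_add, mul_div_cancel_left₀ _ two_ne_zero]
  have hle : ∀ t, |t| ≤ β → Real.cosh (2 * t) ≤ Real.exp (2 * β) := by
    intro t ht
    rw [← Real.cosh_abs, abs_mul, abs_two, Real.cosh_eq]
    have h1 : Real.exp (2 * |t|) ≤ Real.exp (2 * β) := Real.exp_le_exp.2 (by linarith)
    have h2 : Real.exp (-(2 * |t|)) ≤ Real.exp (2 * β) :=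
      Real.exp_le_exp.2 (by linarith [abs_nonneg t])
    linarith
  have h1 := hle r (by rw [abs_of_nonneg hr]; linarith)
  have h2 := hle (p + s) (by rw [abs_of_nonneg (by positivity)]; linarith)
  have h3 := hle (p - s) (abs_le.2 ⟨by linarith, by linarith⟩)
  have h4 := cosh_two_mul_add_sub p s
  have h5 : (2 * α) * (2 * α) ≤ Real.sinh (2 * p) * Real.sinh (2 * s) := by
    have := Real.self_le_sinh_iff.2 (by linarith : 0 ≤ 2 * p)
    have := Real.self_le_sinh_iff.2 (by linarith : 0 ≤ 2 * s)
    exact mul_le_mul (by linarith) (by linarith) (by linarith) (by linarith)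
  rw [e1, e2]
  have hE := Real.exp_pos (2 * β)
  calc (2 * α ^ 2) * ((Real.cosh (2 * r) + Real.cosh (2 * (p + s))) / 2
        + (Real.cosh (2 * r) + Real.cosh (2 * (p - s))) / 2)
      ≤ (2 * α ^ 2) * (2 * Real.exp (2 * β)) :=
        mul_le_mul_of_nonneg_left (by linarith) (by positivity)
    _ = Real.exp (2 * β) * ((2 * α) * (2 * α)) := by ring
    _ ≤ Real.exp (2 * β) * (Real.sinh (2 * p) * Real.sinh (2 * s)) := by gcongr
    _ = _ := by linarith [congrArg (Real.exp (2 * β) * ·) h4]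

/-- `tanh β = (e^{2β} - 1) / (e^{2β} + 1)` in `etaOf`. -/
lemma etaOf_eq (α β : ℝ) : etaOf α β = 4 * α ^ 2 / (1 + Real.exp (2 * β)) ^ 3 := by
  have h := Real.exp_pos β
  have h2 : Real.exp (2 * β) = Real.exp β ^ 2 := by rw [← Real.exp_nat_mul]; norm_num
  rw [etaOf, Real.sigmoid_def, Real.tanh_eq, show -(-2 * β) = 2 * β by ring, h2, Real.exp_neg]
  field_simp
  ring

lemma etaOf_pos {α β : ℝ} (hα : 0 < α) : 0 < etaOf α β := by
  rw [etaOf_eq]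
  positivity

/-- Lower bound on the gain in a two-spin system with weights `A`, `B`, `C`, `D`. -/
lemma two_spin_gain {A B C D E a : ℝ} (hA : 0 < A) (hB : 0 < B) (hC : 0 < C) (hD : 0 < D)
    (hE : 0 < E) (ha : 0 ≤ a) (hAC : A ≤ E * C) (hCA : C ≤ E * A) (hBD : B ≤ E * D)
    (hDB : D ≤ E * B) (hAB : A ≤ E * B) (hCD : C ≤ E * D)
    (h : 2 * a * (A * D + B * C) ≤ E * (A * D - B * C)) :
    2 * (4 * a / (1 + E) ^ 3)
      ≤ (A - C) / (A + C) - (A + B - C - D) / (A + B + C + D) := by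
  have hgain : (A - C) / (A + C) - (A + B - C - D) / (A + B + C + D)
      = 2 * (A * D - B * C) / ((A + C) * (A + B + C + D)) := by
    field_simp
    ring
  rw [hgain, ← mul_div_assoc, div_le_div_iff₀ (by positivity) (by positivity)]
  have h1 : A + B + C + D ≤ (1 + E) * (B + D) := by linarith
  -- Adding (EA - C)(ED - B) ≥ 0 and (EC - A)(EB - D) ≥ 0 gives 2E(AB + CD) ≤ (1 + E²)(AD + BC). Add
  -- 2E(AD + BC) to both sides.
  have h2 : 2 * E * ((A + C) * (B + D)) ≤ (A * D + B * C) * (1 + E) ^ 2 := by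
    nlinarith [mul_nonneg (sub_nonneg.2 hCA) (sub_nonneg.2 hBD),
      mul_nonneg (sub_nonneg.2 hAC) (sub_nonneg.2 hDB)]
  have h3 : 4 * a * ((A + C) * (B + D)) ≤ (A * D - B * C) * (1 + E) ^ 2 := by
    have h4 : E * (4 * a * ((A + C) * (B + D))) ≤ E * ((A * D - B * C) * (1 + E) ^ 2) := by
      calc E * (4 * a * ((A + C) * (B + D))) = 2 * a * (2 * E * ((A + C) * (B + D))) := by ring
        _ ≤ 2 * a * ((A * D + B * C) * (1 + E) ^ 2) := by gcongr
        _ = 2 * a * (A * D + B * C) * (1 + E) ^ 2 := by ring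
        _ ≤ E * (A * D - B * C) * (1 + E) ^ 2 := by gcongr
        _ = _ := by ring
    exact le_of_mul_le_mul_left h4 hE
  calc 2 * (4 * a) * ((A + C) * (A + B + C + D))
      ≤ 2 * (4 * a) * ((A + C) * ((1 + E) * (B + D))) := by gcongr
    _ = 2 * (1 + E) * (4 * a * ((A + C) * (B + D))) := by ring
    _ ≤ 2 * (1 + E) * ((A * D - B * C) * (1 + E) ^ 2) := by gcongr
    _ = _ := by ring

/-- The configuration with values `a` at `u`, `b` at `v`, and `1` elsewhere. -/
def pairConfig (u v : Fin n) (a b : Bool) : Config n :=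
  Function.update (Function.update (fun _ => true) u a) v b

lemma sum_ones_pair {u v : Fin n} (h : v ≠ u) (F : Config n → ℝ) :
    ∑ x, ones (Finset.univ \ {u, v}) x * F x = ∑ a, ∑ b, F (pairConfig u v a b) := by
  rw [← Fintype.sum_prod_type']
  simp only [ones, ite_mul, one_mul, zero_mul]
  rw [← Finset.sum_filter]
  symm
  refine Finset.sum_bij (fun p _ => pairConfig u v p.1 p.2) (fun p _ => ?_) (fun p _ p' _ hp => ?_)
    (fun x hx => ?_) fun p _ => rfl
  · simp only [Finset.mem_filter, Finset.mem_univ, true_and, Finset.mem_sdiff, Finset.mem_insert,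
      Finset.mem_singleton, not_or]
    rintro i ⟨h1, h2⟩
    simp [pairConfig, h1, h2]
  · have h1 := congrFun hp u
    have h2 := congrFun hp v
    simp only [pairConfig, Function.update_self, Function.update_of_ne h.symm] at h1 h2
    exact Prod.ext h1 h2
  · simp only [Finset.mem_filter, Finset.mem_univ, true_and, Finset.mem_sdiff, Finset.mem_insert,
      Finset.mem_singleton, not_or] at hx
    refine ⟨(x u, x v), Finset.mem_univ _, funext fun i => ?_⟩
    by_cases h1 : i = v
    · subst h1; simp [pairConfig]
    · by_cases h2 : i = u
      · subst h2; simp [pairConfig, h1]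
      · simp [pairConfig, h1, h2, hx i ⟨h2, h1⟩]

/-- Gains decrease in S, so the worst S consists of all nodes except u and v. With these fixed to
+1, only four weights remain, indexed by the values at u and v. The factor 2 leaves room for
sampling errors around the threshold η. -/
theorem two_mul_etaOf_le_gain {α β : ℝ} (hα : 0 < α) (hR : R.Ferromagnetic)
    (hN : R.NonDegenerate α β) {u v : Fin n} (hv : v ∈ R.commonNbhd u) {S : Finset (Fin n)}
    (huS : u ∉ S) (hvS : v ∉ S) :
    2 * etaOf α β ≤ R.influence u (insert v S) - R.influence u S := by
  obtain ⟨hvu, k, huk, hvk⟩ := mem_commonNbhd.1 hv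
  have hST : S ⊆ Finset.univ \ {u, v} := by
    intro i hi
    simp only [Finset.mem_sdiff, Finset.mem_univ, true_and, Finset.mem_insert,
      Finset.mem_singleton, not_or]
    exact ⟨fun h => huS (h ▸ hi), fun h => hvS (h ▸ hi)⟩
  refine le_trans ?_ (influence_gain_antitone hR u v hST)
  have hz := sum_ones_pair hvu R.visWeight
  have hs := sum_ones_pair hvu fun x => spin (x u) * R.visWeight x
  have hz' := sum_ones_pair hvu fun x => (if x v = true then 1 else 0) * R.visWeight x
  have hs' := sum_ones_pair hvu fun x =>
    (if x v = true then 1 else 0) * spin (x u) * R.visWeight x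
  have eu : ∀ a b, pairConfig u v a b u = a := fun a b => by simp [pairConfig, hvu.symm]
  have ev : ∀ a b, pairConfig u v a b v = b := fun a b => by simp [pairConfig]
  simp only [Fintype.sum_bool, eu, ev, spin, ← mul_assoc] at hz hs hz' hs'
  rw [influence_eq_visWeight, influence_eq_visWeight]
  simp only [ones_insert, hz', hs', hz, spin, hs]
  have hvflip : ∀ a b b', R.visWeight (pairConfig u v a b)
      ≤ Real.exp (2 * β) * R.visWeight (pairConfig u v a b') := fun a b b' =>
    visWeight_update_le hN _ v b b'
  have huflip : ∀ a a' b, R.visWeight (pairConfig u v a b)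
      ≤ Real.exp (2 * β) * R.visWeight (pairConfig u v a' b) := fun a a' b => by
    simp only [pairConfig, Function.update_comm hvu.symm]
    exact visWeight_update_le hN _ u a a'
  -- It remains to compare the equal with the opposite spin pairs. The exponentials of the external
  -- fields coincide in both products, and the rest factorizes over latent nodes.
  have hJ := hR.1
  have hcross : 2 * α ^ 2 * (R.visWeight (pairConfig u v true true) *
        R.visWeight (pairConfig u v false false)
        + R.visWeight (pairConfig u v true false) * R.visWeight (pairConfig u v false true))
      ≤ Real.exp (2 * β) * (R.visWeight (pairConfig u v true true) *
        R.visWeight (pairConfig u v false false)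
        - R.visWeight (pairConfig u v true false) * R.visWeight (pairConfig u v false true)) := by
    let r : Fin m → ℝ := fun k => R.g k + ∑ i ∈ (Finset.univ.erase v).erase u, R.J i k
    have hr : ∀ k, 0 ≤ r k := fun k =>
      add_nonneg (hR.2.2 k) (Finset.sum_nonneg fun i _ => hJ i k)
    have hfield : ∀ a b k, R.latentField (pairConfig u v a b) k
        = r k + R.J u k * spin a + R.J v k * spin b := by
      intro a b k
      rw [pairConfig, latentField_update, ← Finset.add_sum_erase (Finset.univ.erase v) _
        (Finset.mem_erase.2 ⟨hvu.symm, Finset.mem_univ u⟩)]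
      rw [Finset.sum_congr rfl fun i hi => by
        rw [Function.update_of_ne (Finset.ne_of_mem_erase hi)]]
      simp [r, spin]
      ring
    have hext : ∀ a b, ∑ i, R.f i * spin (pairConfig u v a b i)
        = R.f u * spin a + R.f v * spin b + ∑ i ∈ (Finset.univ.erase v).erase u, R.f i := by
      intro a b
      rw [← Finset.add_sum_erase _ _ (Finset.mem_univ v),
        ← Finset.add_sum_erase (Finset.univ.erase v) _
        (Finset.mem_erase.2 ⟨hvu.symm, Finset.mem_univ u⟩), eu, ev]
      rw [Finset.sum_congr rfl fun i hi => by
        rw [pairConfig, Function.update_of_ne (Finset.ne_of_mem_erase (Finset.mem_of_mem_erase hi)),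
          Function.update_of_ne (Finset.ne_of_mem_erase hi)]]
      simp [spin]
      ring
    let P : Fin m → ℝ := fun k => Real.cosh (r k + R.J u k + R.J v k) *
      Real.cosh (r k - R.J u k - R.J v k)
    let Q : Fin m → ℝ := fun k => Real.cosh (r k + R.J u k - R.J v k) *
      Real.cosh (r k - R.J u k + R.J v k)
    have hP : R.visWeight (pairConfig u v true true) * R.visWeight (pairConfig u v false false)
        = Real.exp (2 * ∑ i ∈ (Finset.univ.erase v).erase u, R.f i) * ∏ k, (4 * P k) := by
      rw [visWeight_eq, visWeight_eq, mul_mul_mul_comm, ← Real.exp_add, ← Finset.prod_mul_distrib,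
        hext, hext]
      simp only [hfield, spin, P]
      congr 1
      · congr 1; norm_num; ring
      · exact Finset.prod_congr rfl fun k _ => by norm_num; ring_nf
    have hQ : R.visWeight (pairConfig u v true false) * R.visWeight (pairConfig u v false true)
        = Real.exp (2 * ∑ i ∈ (Finset.univ.erase v).erase u, R.f i) * ∏ k, (4 * Q k) := by
      rw [visWeight_eq, visWeight_eq, mul_mul_mul_comm, ← Real.exp_add, ← Finset.prod_mul_distrib,
        hext, hext]
      simp only [hfield, spin, Q]
      congr 1
      · congr 1; norm_num; ring
      · exact Finset.prod_congr rfl fun k _ => by norm_num; ring_nf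
    have hQpos : ∀ k, 0 < Q k := fun k => mul_pos (Real.cosh_pos _) (Real.cosh_pos _)
    -- Every latent node favors equal spins. A common neighbor k does so quantitatively, by `hk`,
    -- and the other factors cannot spoil this.
    have hPQ : ∀ k, Q k ≤ P k := by
      intro k
      simp only [P, Q]
      have e : Real.cosh (r k + R.J u k + R.J v k) * Real.cosh (r k - R.J u k - R.J v k)
          - Real.cosh (r k + R.J u k - R.J v k) * Real.cosh (r k - R.J u k + R.J v k)
          = Real.sinh (2 * R.J u k) * Real.sinh (2 * R.J v k) := by
        have h1 := two_mul_cosh_mul_cosh (r k) (R.J u k + R.J v k)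
        have h2 := two_mul_cosh_mul_cosh (r k) (R.J u k - R.J v k)
        have h3 := cosh_two_mul_add_sub (R.J u k) (R.J v k)
        rw [← add_assoc, ← sub_sub] at h1
        rw [← add_sub_assoc, ← sub_add] at h2
        linarith
      have := mul_nonneg (Real.sinh_nonneg_iff.2 (mul_nonneg zero_le_two (hJ u k)))
        (Real.sinh_nonneg_iff.2 (mul_nonneg zero_le_two (hJ v k)))
      linarith
    have hk : 2 * α ^ 2 * (P k + Q k) ≤ Real.exp (2 * β) * (P k - Q k) := by
      refine cosh_sq_le hα ?_ ?_ (hr k) ?_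
      · have := hN.1 u k (abs_ne_zero.2 huk)
        rwa [abs_of_nonneg (hJ u k)] at this
      · have := hN.1 v k (abs_ne_zero.2 hvk)
        rwa [abs_of_nonneg (hJ v k)] at this
      · have := hN.2.2 k
        simp only [abs_of_nonneg (hJ _ k), abs_of_nonneg (hR.2.2 k)] at this
        rw [← Finset.add_sum_erase _ _ (Finset.mem_univ v),
          ← Finset.add_sum_erase (Finset.univ.erase v) _
          (Finset.mem_erase.2 ⟨hvu.symm, Finset.mem_univ u⟩)] at this
        simp only [r]
        linarith
    rw [hP, hQ, ← Finset.mul_prod_erase _ _ (Finset.mem_univ k),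
      ← Finset.mul_prod_erase _ (fun k => 4 * Q k) (Finset.mem_univ k)]
    set e := Real.exp (2 * ∑ i ∈ (Finset.univ.erase v).erase u, R.f i)
    set p := ∏ x ∈ Finset.univ.erase k, (4 * P x)
    set q := ∏ x ∈ Finset.univ.erase k, (4 * Q x)
    have he : 0 < e := Real.exp_pos _
    have hq : 0 < q := Finset.prod_pos fun k _ => by linarith [hQpos k]
    have hqp : q ≤ p := Finset.prod_le_prod (fun k _ => by linarith [hQpos k])
      fun k _ => by linarith [hPQ k]
    have hE := Real.exp_pos (2 * β)
    have hα2 : 0 ≤ 2 * α ^ 2 := by positivity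
    have hPk : 0 < P k := (hQpos k).trans_le (hPQ k)
    -- Otherwise `hk` would contradict P k - Q k ≤ P k + Q k. This makes the coefficient of P k
    -- nonnegative, so q may be replaced by the larger p there.
    have hle : 2 * α ^ 2 ≤ Real.exp (2 * β) := by
      by_contra hlt
      nlinarith [hQpos k]
    have h1 : 0 ≤ (Real.exp (2 * β) - 2 * α ^ 2) * P k * (p - q) :=
      mul_nonneg (mul_nonneg (sub_nonneg.2 hle) hPk.le) (sub_nonneg.2 hqp)
    have h2 := mul_le_mul_of_nonneg_right hk hq.le
    have h3 : 2 * α ^ 2 * (P k * p + Q k * q) ≤ Real.exp (2 * β) * (P k * p - Q k * q) := by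
      linarith
    have h4 := mul_le_mul_of_nonneg_left h3 (by positivity : 0 ≤ 4 * e)
    linarith
  have h := two_spin_gain (a := α ^ 2) (R.visWeight_pos (pairConfig u v true true))
    (R.visWeight_pos (pairConfig u v true false)) (R.visWeight_pos (pairConfig u v false true))
    (R.visWeight_pos (pairConfig u v false false)) (Real.exp_pos (2 * β)) (sq_nonneg α)
    (huflip _ _ _) (huflip _ _ _) (huflip _ _ _) (huflip _ _ _) (hvflip _ _ _) (hvflip _ _ _)
    hcross
  rw [etaOf_eq]
  refine h.trans_eq ?_
  simp only [if_true, Bool.false_eq_true, if_false]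
  ring

/-- Conditional independence, evaluated at the all-ones configuration, says that adding v to S
leaves the influence unchanged. A node of `commonNbhd` outside S has a positive gain. -/
lemma commonNbhd_subset_of_separates {α β : ℝ} (hα : 0 < α) (hR : R.Ferromagnetic)
    (hN : R.NonDegenerate α β) {u : Fin n} {S : Finset (Fin n)} (hS : R.Separates u S) :
    R.commonNbhd u ⊆ S := by
  intro v hv
  by_contra hvS
  have hgain := two_mul_etaOf_le_gain hα hR hN hv hS.1 hvS
  have hpos := etaOf_pos (β := β) hα
  have h := hS.2 v hvS (mem_commonNbhd.1 hv).1 fun _ => true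
  simp only [marginal_eq_probOnes] at h
  have h1 := R.probOnes_pos S
  have h2 := R.probOnes_pos (insert v S)
  have e : R.probOnes (insert u (insert v S)) / R.probOnes (insert v S)
      = R.probOnes (insert u S) / R.probOnes S := by
    rw [div_eq_div_iff h2.ne' h1.ne', h]
  rw [influence_eq, influence_eq, e] at hgain
  linarith

theorem twoHopNbhd_eq {α β : ℝ} (hα : 0 < α) (hR : R.Ferromagnetic)
    (hN : R.NonDegenerate α β) (u : Fin n) : R.twoHopNbhd u = R.commonNbhd u := by
  have hu : u ∉ R.commonNbhd u := fun h => (mem_commonNbhd.1 h).1 rfl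
  ext v
  simp only [twoHopNbhd, Finset.mem_filter, Finset.mem_univ, true_and]
  refine ⟨fun h => h _ ⟨hu, fun j _ hj => condIndep_of_commonNbhd_subset hu subset_rfl hj⟩,
    fun h S hS => commonNbhd_subset_of_separates hα hR hN hS h⟩

/-- Two couplings at one latent node force 2α ≤ β. The resulting bound on η serves to give log (4/η)
≥ 5, hence k ≥ 5. -/
lemma etaOf_le {α β : ℝ} (hα : 0 < α) (hN : R.NonDegenerate α β) {u v : Fin n}
    (hv : v ∈ R.commonNbhd u) : etaOf α β ≤ 1 / 72 := by
  obtain ⟨hvu, k, huk, hvk⟩ := mem_commonNbhd.1 hv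
  have h1 := hN.1 u k (abs_ne_zero.2 huk)
  have h2 := hN.1 v k (abs_ne_zero.2 hvk)
  have h3 := hN.2.2 k
  rw [← Finset.add_sum_erase _ _ (Finset.mem_univ v), ← Finset.add_sum_erase (Finset.univ.erase v) _
    (Finset.mem_erase.2 ⟨hvu.symm, Finset.mem_univ u⟩)] at h3
  have h4 : 0 ≤ ∑ i ∈ (Finset.univ.erase v).erase u, |R.J i k| :=
    Finset.sum_nonneg fun _ _ => abs_nonneg _
  have hβ : 2 * α ≤ β := by linarith [abs_nonneg (R.g k)]
  have hexp : 1 + 2 * β + 2 * β ^ 2 ≤ Real.exp (2 * β) := by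
    have := Real.quadratic_le_exp_of_nonneg (x := 2 * β) (by linarith)
    linarith
  rw [etaOf_eq, div_le_div_iff₀ (by positivity) (by norm_num)]
  -- The quadratic lower bound for the exponential leaves 2(β - 1)² ≥ 0.
  have h5 : 6 * β ≤ 1 + Real.exp (2 * β) := by nlinarith [sq_nonneg (β - 1)]
  have h6 : (6 * β) ^ 2 ≤ (1 + Real.exp (2 * β)) ^ 2 := by gcongr; linarith
  have h7 : 2 ≤ 1 + Real.exp (2 * β) := by nlinarith
  have h8 : (2 * α) ^ 2 ≤ β ^ 2 := by gcongr
  calc 4 * α ^ 2 * 72 ≤ (6 * β) ^ 2 * 2 := by linarith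
    _ ≤ (1 + Real.exp (2 * β)) ^ 2 * (1 + Real.exp (2 * β)) := by gcongr
    _ = _ := by ring

end RBM

/-! ## Concentration of the empirical influences -/

/-- The number of samples with `x_S = 1`. -/
def empCount {n M : ℕ} (x : Fin M → Config n) (S : Finset (Fin n)) : ℕ :=
  (Finset.univ.filter fun i => ∀ v ∈ S, x i v = true).card

/-- The empirical influence of `S` on `u`. -/
noncomputable def empiricalInfluence {n M : ℕ} (x : Fin M → Config n) (u : Fin n)
    (S : Finset (Fin n)) : ℝ :=
  2 * (((empCount x (insert u S) : ℝ) / M) / ((empCount x S : ℝ) / M)) - 1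

namespace RBM

variable {n m M : ℕ} {R : RBM n m}

lemma empCount_eq_sum (x : Fin M → Config n) (S : Finset (Fin n)) :
    (empCount x S : ℝ) = ∑ i, ones S (x i) := by
  simp [empCount, ones]

lemma empiricalInfluence_eq (hM : M ≠ 0) (x : Fin M → Config n) (u : Fin n)
    (S : Finset (Fin n)) : empiricalInfluence x u S
      = 2 * ((empCount x (insert u S) : ℝ) / (empCount x S : ℝ)) - 1 := by
  have : (M : ℝ) ≠ 0 := by exact_mod_cast hM
  rw [empiricalInfluence, div_div_div_cancel_right₀ this]

lemma sum_prod_samples (h : Config n → ℝ) :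
    ∑ x : Fin M → Config n, (∏ i, R.visibleProb (x i)) * ∏ i, h (x i)
      = (∑ z, R.visibleProb z * h z) ^ M := by
  simp only [← Finset.prod_mul_distrib]
  rw [← Fintype.prod_sum (f := fun (_ : Fin M) z => R.visibleProb z * h z)]
  simp

lemma sum_samples : ∑ x : Fin M → Config n, ∏ i, R.visibleProb (x i) = 1 := by
  have := sum_prod_samples (M := M) (R := R) fun _ => 1
  simpa [sum_visibleProb] using this

lemma prod_visibleProb_nonneg (x : Fin M → Config n) : 0 ≤ ∏ i, R.visibleProb (x i) :=
  Finset.prod_nonneg fun i _ => (R.visibleProb_pos (x i)).le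

lemma exp_le_one_add_add_sq {y : ℝ} (h : |y| ≤ 1) : Real.exp y ≤ 1 + y + y ^ 2 := by
  have := abs_le.1 (Real.abs_exp_sub_one_sub_id_le h)
  linarith [this.2]

/-- Bound on the exponential moment of a signed deviation. -/
lemma sum_tilted_le {u : Fin n} {S : Finset (Fin n)} {ε s : ℝ} (hε : 0 < ε) (hε1 : ε ≤ 1)
    (hs : s = 1 ∨ s = -1) :
    ∑ z, R.visibleProb z * (if ∀ v ∈ S, z v = true then
        Real.exp (ε / 2 * (s * (spin (z u) - R.influence u S) - ε)) else 1)
      ≤ Real.exp (-(R.probOnes S * ε ^ 2 / 8)) := by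
  set I := R.influence u S with hI
  set p := R.probOnes S with hp
  have hp0 : 0 < p := R.probOnes_pos S
  have hI' : ∑ z, ones S z * spin (z u) * R.visibleProb z = I * p := by
    rw [hI, influence, div_mul_cancel₀ _ (R.probOnes_pos S).ne']
  have habs : |I| ≤ 1 := by
    rw [abs_le]
    refine ⟨?_, influence_le_one u S⟩
    rw [hI, influence_eq]
    have := div_pos (R.probOnes_pos (insert u S)) (R.probOnes_pos S)
    linarith
  have hss : s ^ 2 = 1 := by rcases hs with h | h <;> rw [h] <;> norm_num
  have hsabs : |s| = 1 := by rcases hs with h | h <;> rw [h] <;> norm_num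
  -- The exponential is bounded by 1 + y + y². As the square of a spin is 1, this is affine in the
  -- spin, so its mean involves only p and I.
  have hterm : ∀ z : Config n, R.visibleProb z * (if ∀ v ∈ S, z v = true then
        Real.exp (ε / 2 * (s * (spin (z u) - I) - ε)) else 1)
      ≤ R.visibleProb z - ones S z * R.visibleProb z + Real.exp (-(ε ^ 2 / 2)) *
        (ones S z * R.visibleProb z * (1 + ε ^ 2 / 4 * (1 + I ^ 2) - ε / 2 * s * I) +
          ones S z * spin (z u) * R.visibleProb z * (ε / 2 * s - ε ^ 2 / 2 * I)) := by
    intro z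
    have hP := (R.visibleProb_pos z).le
    unfold ones
    split_ifs with h
    · have h1 : |ε / 2 * (s * (spin (z u) - I))| ≤ 1 := by
        rw [abs_mul, abs_mul, hsabs, one_mul, abs_of_pos (by positivity)]
        have : |spin (z u) - I| ≤ 2 := by
          have := abs_sub (spin (z u)) I
          rw [abs_spin] at this
          linarith
        nlinarith [abs_nonneg (spin (z u) - I)]
      have h2 := exp_le_one_add_add_sq h1
      have h3 : spin (z u) ^ 2 = 1 := by rw [← sq_abs, abs_spin, one_pow]
      have e : Real.exp (ε / 2 * (s * (spin (z u) - I) - ε))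
          = Real.exp (-(ε ^ 2 / 2)) * Real.exp (ε / 2 * (s * (spin (z u) - I))) := by
        rw [← Real.exp_add]; congr 1; ring
      have h4 : 1 + ε / 2 * (s * (spin (z u) - I)) + (ε / 2 * (s * (spin (z u) - I))) ^ 2
          = (1 + ε ^ 2 / 4 * (1 + I ^ 2) - ε / 2 * s * I) +
            spin (z u) * (ε / 2 * s - ε ^ 2 / 2 * I) := by
        rw [mul_pow, mul_pow, hss, sub_sq, h3]
        ring
      rw [e]
      rw [h4] at h2
      have h5 := mul_le_mul_of_nonneg_left h2 (mul_nonneg hP (Real.exp_pos (-(ε ^ 2 / 2))).le)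
      linarith
    · simp
  refine (Finset.sum_le_sum fun z _ => hterm z).trans ?_
  rw [Finset.sum_add_distrib, Finset.sum_sub_distrib, ← Finset.mul_sum, Finset.sum_add_distrib,
    ← Finset.sum_mul, ← Finset.sum_mul, hI', sum_visibleProb]
  change 1 - p + Real.exp (-(ε ^ 2 / 2)) * (p * (1 + ε ^ 2 / 4 * (1 + I ^ 2) - ε / 2 * s * I) +
    I * p * (ε / 2 * s - ε ^ 2 / 2 * I)) ≤ _
  -- The linear terms cancel because I is the conditional mean. What remains is p times 1 plus ε²/4
  -- times the conditional variance 1 - I².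
  have h1 : p * (1 + ε ^ 2 / 4 * (1 + I ^ 2) - ε / 2 * s * I) +
      I * p * (ε / 2 * s - ε ^ 2 / 2 * I) ≤ p * Real.exp (ε ^ 2 / 4) := by
    have h2 := Real.add_one_le_exp (ε ^ 2 / 4)
    have h3 : 0 ≤ ε ^ 2 * I ^ 2 := by positivity
    calc _ = p * (1 + ε ^ 2 / 4 - ε ^ 2 * I ^ 2 / 4) := by ring
      _ ≤ _ := by gcongr; linarith
  have h2 : Real.exp (-(ε ^ 2 / 2)) * (p * Real.exp (ε ^ 2 / 4)) = p * Real.exp (-(ε ^ 2 / 4)) := by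
    rw [mul_left_comm, ← Real.exp_add]; congr 2; ring
  have h3 := mul_le_mul_of_nonneg_left h1 (Real.exp_pos (-(ε ^ 2 / 2))).le
  rw [h2] at h3
  have h4 : Real.exp (-(ε ^ 2 / 4)) ≤ 1 - ε ^ 2 / 8 := by
    have := exp_le_one_add_add_sq (y := -(ε ^ 2 / 4)) (by
      rw [abs_neg, abs_of_nonneg (by positivity)]; nlinarith)
    have h5 : ε ^ 2 ≤ 1 := pow_le_one₀ hε.le hε1
    have h6 := mul_le_mul_of_nonneg_left h5 (sq_nonneg ε)
    linarith [sq_nonneg ε]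
  have h5 := mul_le_mul_of_nonneg_left h4 hp0.le
  have h6 := Real.add_one_le_exp (-(p * ε ^ 2 / 8))
  linarith

/-- One deviation of an empirical influence is improbable. -/
lemma sum_deviation_le (hM : M ≠ 0) (u : Fin n) (S : Finset (Fin n)) {ε : ℝ} (hε : 0 < ε)
    (hε1 : ε ≤ 1) :
    ∑ x : Fin M → Config n, (∏ i, R.visibleProb (x i)) *
        (if ε ≤ |empiricalInfluence x u S - R.influence u S| then 1 else 0)
      ≤ 2 * Real.exp (-(M * R.probOnes S * ε ^ 2 / 8)) := by
  let h : ℝ → Config n → ℝ := fun s z => if ∀ v ∈ S, z v = true then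
    Real.exp (ε / 2 * (s * (spin (z u) - R.influence u S) - ε)) else 1
  have hh : ∀ s z, 0 ≤ h s z := fun s z => by
    simp only [h]; split_ifs
    · exact (Real.exp_pos _).le
    · norm_num
  -- Samples outside x_S = 1 contribute the factor 1, so the exponent is ε/2 times the count of x_S
  -- = 1 times (s · deviation - ε). Thus the random denominator of the empirical influence needs no
  -- separate control.
  have hone : ∀ (x : Fin M → Config n) (s : ℝ),
      ε ≤ s * (empiricalInfluence x u S - R.influence u S) → 1 ≤ ∏ i, h s (x i) := by
    intro x s hs
    have e : ∀ i, h s (x i) = Real.exp (ones S (x i) *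
        (ε / 2 * (s * (spin (x i u) - R.influence u S) - ε))) := by
      intro i
      simp only [h, ones]
      split_ifs <;> simp
    rw [Finset.prod_congr rfl fun i _ => e i, ← Real.exp_sum, Real.one_le_exp_iff]
    have hc : ∑ i, ones S (x i) * spin (x i u)
        = empiricalInfluence x u S * empCount x S := by
      have h1 : ∑ i, ones S (x i) * spin (x i u)
          = 2 * (empCount x (insert u S) : ℝ) - empCount x S := by
        simp only [empCount_eq_sum, ones_insert, Finset.mul_sum, ← Finset.sum_sub_distrib,
          spin_eq_ite]
        exact Finset.sum_congr rfl fun i _ => by ring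
      rw [h1, empiricalInfluence_eq hM]
      -- Here the empirical influence is -1 by the convention 0/0 = 0, and it is multiplied by the
      -- count 0.
      by_cases h0 : (empCount x S : ℝ) = 0
      · have hle : empCount x (insert u S) ≤ empCount x S :=
          Finset.card_le_card fun i hi => by
            simp only [Finset.mem_filter, Finset.mem_univ, true_and] at hi ⊢
            exact fun v hv => hi v (Finset.mem_insert_of_mem hv)
        have h0' : empCount x S = 0 := by exact_mod_cast h0
        have : empCount x (insert u S) = 0 := by omega
        simp [this, h0']
      · field_simp
    have e2 : ∑ i, ones S (x i) * (ε / 2 * (s * (spin (x i u) - R.influence u S) - ε))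
        = ε / 2 * (empCount x S *
          (s * (empiricalInfluence x u S - R.influence u S) - ε)) := by
      have : ∀ i, ones S (x i) * (ε / 2 * (s * (spin (x i u) - R.influence u S) - ε))
          = ε / 2 * s * (ones S (x i) * spin (x i u))
            - ε / 2 * (s * R.influence u S + ε) * ones S (x i) := fun i => by ring
      simp only [this, Finset.sum_sub_distrib, ← Finset.mul_sum, hc, ← empCount_eq_sum]
      ring
    rw [e2]
    exact mul_nonneg (by positivity) (mul_nonneg (Nat.cast_nonneg _) (by linarith))
  have hpt : ∀ x : Fin M → Config n,
      (if ε ≤ |empiricalInfluence x u S - R.influence u S| then (1 : ℝ) else 0)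
        ≤ ∏ i, h 1 (x i) + ∏ i, h (-1) (x i) := by
    intro x
    have p1 := Finset.prod_nonneg fun (i : Fin M) (_ : i ∈ Finset.univ) => hh 1 (x i)
    have p2 := Finset.prod_nonneg fun (i : Fin M) (_ : i ∈ Finset.univ) => hh (-1) (x i)
    split_ifs with hb
    · rcases le_abs.1 hb with hb | hb
      · linarith [hone x 1 (by linarith)]
      · linarith [hone x (-1) (by linarith)]
    · linarith
  refine (Finset.sum_le_sum fun x _ =>
    mul_le_mul_of_nonneg_left (hpt x) (prod_visibleProb_nonneg x)).trans ?_
  simp only [mul_add, Finset.sum_add_distrib, sum_prod_samples]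
  have hb : ∀ s : ℝ, s = 1 ∨ s = -1 → (∑ z, R.visibleProb z * h s z) ^ M
      ≤ Real.exp (-(M * R.probOnes S * ε ^ 2 / 8)) := by
    intro s hs
    have h1 := pow_le_pow_left₀ (Finset.sum_nonneg fun z _ =>
      mul_nonneg (R.visibleProb_pos z).le (hh s z))
      (sum_tilted_le (R := R) (u := u) (S := S) hε hε1 hs) M
    rw [← Real.exp_nat_mul] at h1
    refine h1.trans_eq ?_
    congr 1; ring
  linarith [hb 1 (Or.inl rfl), hb (-1) (Or.inr rfl)]

/-- The number of small subsets. -/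
lemma card_small_subsets_le {k : ℝ} (hk : 1 ≤ k) (hkn : k ≤ n) :
    ((Finset.univ.filter fun S : Finset (Fin n) => S.card ≤ ⌈k⌉₊).card : ℝ)
      ≤ Real.exp (Real.log n + k * Real.log (Real.exp 1 * n / k)) := by
  have hk0 : 0 < k := by linarith
  have hn0 : (0 : ℝ) < n := by linarith
  set t : ℝ := n / k with ht
  have ht1 : 1 ≤ t := by rw [ht, one_le_div hk0]; exact hkn
  have ht0 : 0 < t := by linarith
  -- Each small set is counted with the weight t^(⌈k⌉ - |S|) ≥ 1, where t = n/k. The binomial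
  -- theorem then gives t^⌈k⌉ (1 + 1/t)^n.
  have h1 : ((Finset.univ.filter fun S : Finset (Fin n) => S.card ≤ ⌈k⌉₊).card : ℝ)
      ≤ ∑ S : Finset (Fin n), t ^ ⌈k⌉₊ * ((1 / t) ^ S.card * 1 ^ (Fintype.card (Fin n) - S.card)) := by
    rw [Finset.card_filter, Nat.cast_sum]
    refine Finset.sum_le_sum fun S _ => ?_
    split_ifs with h
    · rw [one_pow, mul_one, one_div, inv_pow, ← div_eq_mul_inv, Nat.cast_one,
        one_le_div (by positivity)]
      exact pow_le_pow_right₀ ht1 h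
    · simp; positivity
  rw [← Finset.mul_sum, Fintype.sum_pow_mul_eq_add_pow, Fintype.card_fin] at h1
  refine h1.trans ?_
  have h2 : (1 / t + 1) ^ n ≤ Real.exp k := by
    have h3 := pow_le_pow_left₀ (by positivity) (Real.add_one_le_exp (1 / t)) n
    rw [← Real.exp_nat_mul] at h3
    refine h3.trans_eq ?_
    congr 1
    rw [ht]; field_simp
  have h3 : t ^ ⌈k⌉₊ ≤ Real.exp ((k + 1) * Real.log t) := by
    rw [← Real.rpow_natCast, Real.rpow_def_of_pos ht0, Real.exp_le_exp, mul_comm]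
    exact mul_le_mul_of_nonneg_right (Nat.ceil_lt_add_one hk0.le).le (Real.log_nonneg ht1)
  refine (mul_le_mul h3 h2 (by positivity) (Real.exp_pos _).le).trans ?_
  rw [← Real.exp_add, Real.exp_le_exp]
  have e1 : Real.log (Real.exp 1 * n / k) = 1 + Real.log t := by
    rw [mul_div_assoc, Real.log_mul (Real.exp_pos 1).ne' ht0.ne', Real.log_exp]
  -- The term log n of the exponent pays for the additional factor t due to rounding up k.
  have e2 : Real.log t ≤ Real.log n :=
    Real.log_le_log ht0 (div_le_self hn0.le hk)
  rw [e1]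
  linarith

/-- The event that all empirical influences of small sets are accurate. -/
def Accurate (R : RBM n m) (x : Fin M → Config n) (u : Fin n) (K : ℕ) (ε : ℝ) : Prop :=
  ∀ S : Finset (Fin n), S.card ≤ K → |empiricalInfluence x u S - R.influence u S| < ε

-- With L and D the two logarithmic factors in the assumption on M, each set deviates with
-- probability at most 2 exp(-LD), and at most exp L sets matter. Since L ≥ 5 and D ≥ 2, one has L -
-- LD ≤ -D, and the union bound gives δ/4.
open Classical in
lemma one_sub_le_sum_accurate (hR : R.Ferromagnetic) {k η δ : ℝ} {d : ℕ} (hd : 1 ≤ d)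
    (hη : 0 < η) (hη1 : η ≤ 1) (hδ : 0 < δ) (hδ1 : δ < 1) (hk : 5 ≤ k) (hkn : k ≤ n)
    (hM : (2 : ℝ) ^ (2 * k + 3) * (d / η) ^ 2 *
      (Real.log n + k * Real.log (Real.exp 1 * n / k)) * Real.log (8 / δ) ≤ M) (u : Fin n) :
    1 - δ / 2 ≤ ∑ x : Fin M → Config n, (∏ i, R.visibleProb (x i)) *
      (if R.Accurate x u ⌈k⌉₊ (η / (4 * d)) then 1 else 0) := by
  set L := Real.log n + k * Real.log (Real.exp 1 * n / k) with hL
  set D := Real.log (8 / δ) with hD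
  have hd0 : (1 : ℝ) ≤ d := by exact_mod_cast hd
  have hdpos : (0 : ℝ) < d := by linarith
  have hk0 : 0 < k := by linarith
  have hn0 : (0 : ℝ) < n := by linarith
  have hL5 : 5 ≤ L := by
    have h1 : 0 ≤ Real.log n := Real.log_nonneg (by linarith)
    have h2 : 1 ≤ Real.log (Real.exp 1 * n / k) := by
      rw [Real.le_log_iff_exp_le (by positivity), mul_div_assoc]
      exact le_mul_of_one_le_right (Real.exp_pos 1).le ((one_le_div hk0).2 hkn)
    nlinarith
  have hD2 : 2 ≤ D := by
    rw [hD, Real.le_log_iff_exp_le (by positivity), le_div_iff₀ hδ]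
    have h1 : Real.exp 2 = Real.exp 1 * Real.exp 1 := by rw [← Real.exp_add]; norm_num
    have h2 := Real.exp_one_lt_d9
    have h3 := Real.exp_pos 1
    rw [h1]
    nlinarith
  have hε : 0 < η / (4 * d) := by positivity
  have hε1 : η / (4 * d) ≤ 1 := by
    rw [div_le_one (by positivity)]; linarith
  have hM0 : (0 : ℝ) < M := lt_of_lt_of_le (by positivity) hM
  have hMne : M ≠ 0 := by rintro rfl; simp at hM0
  have hLD : ∀ S : Finset (Fin n), S.card ≤ ⌈k⌉₊ →
      L * D ≤ M * R.probOnes S * (η / (4 * d)) ^ 2 / 8 := by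
    intro S hS
    have h1 : (2 : ℝ) ^ (-(k + 1)) ≤ R.probOnes S := by
      refine le_trans ?_ (half_pow_card_le_probOnes hR S)
      rw [Real.rpow_neg zero_le_two, one_div, inv_pow, ← Real.rpow_natCast]
      gcongr
      · norm_num
      · exact le_trans (by exact_mod_cast hS) (Nat.ceil_lt_add_one hk0.le).le
    have h2 : (1 : ℝ) ≤ 2 ^ (k - 5) := Real.one_le_rpow one_le_two (by linarith)
    calc L * D = 1 * (L * D) := (one_mul _).symm
      _ ≤ 2 ^ (k - 5) * (L * D) := by gcongr
      _ = (2 ^ (2 * k + 3) * (d / η) ^ 2 * L * D) * 2 ^ (-(k + 1)) * (η / (4 * d)) ^ 2 / 8 := by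
          -- 128 is 8 from the exponent of the deviation bound times 4² from ε = η/(4d). The factor
          -- 2^(k - 5) ≥ 1 is then discarded, which needs k ≥ 5.
          have e : (2 : ℝ) ^ (k - 5) = 2 ^ (2 * k + 3) * 2 ^ (-(k + 1)) / 128 := by
            rw [← Real.rpow_add two_pos, eq_div_iff (by norm_num),
              show (128 : ℝ) = 2 ^ (7 : ℝ) by norm_num, ← Real.rpow_add two_pos]
            congr 1; ring
          rw [e]; field_simp; ring
      _ ≤ M * R.probOnes S * (η / (4 * d)) ^ 2 / 8 := by gcongr
  have hunion : ∀ x : Fin M → Config n,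
      1 - ∑ S ∈ Finset.univ.filter (fun S : Finset (Fin n) => S.card ≤ ⌈k⌉₊),
        (if η / (4 * d) ≤ |empiricalInfluence x u S - R.influence u S| then (1 : ℝ) else 0)
        ≤ if R.Accurate x u ⌈k⌉₊ (η / (4 * d)) then 1 else 0 := by
    intro x
    have hnn : ∀ S ∈ Finset.univ.filter (fun S : Finset (Fin n) => S.card ≤ ⌈k⌉₊), (0 : ℝ) ≤
        if η / (4 * d) ≤ |empiricalInfluence x u S - R.influence u S| then (1 : ℝ) else 0 :=
      fun S _ => by split_ifs <;> norm_num
    split_ifs with h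
    · linarith [Finset.sum_nonneg hnn]
    · simp only [Accurate, not_forall, not_lt] at h
      obtain ⟨S, hS, hb⟩ := h
      have := Finset.single_le_sum hnn (Finset.mem_filter.2 ⟨Finset.mem_univ S, hS⟩)
      rw [if_pos hb] at this
      linarith
  refine le_trans ?_ (Finset.sum_le_sum fun x _ =>
    mul_le_mul_of_nonneg_left (hunion x) (prod_visibleProb_nonneg x))
  simp only [mul_sub, Finset.sum_sub_distrib, mul_one, sum_samples, Finset.mul_sum]
  rw [Finset.sum_comm]
  have hbound : ∑ S ∈ Finset.univ.filter (fun S : Finset (Fin n) => S.card ≤ ⌈k⌉₊),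
      ∑ x : Fin M → Config n, (∏ i, R.visibleProb (x i)) *
        (if η / (4 * d) ≤ |empiricalInfluence x u S - R.influence u S| then 1 else 0)
      ≤ Real.exp L * (2 * Real.exp (-(L * D))) := by
    refine (Finset.sum_le_card_nsmul _ _ (2 * Real.exp (-(L * D))) fun S hS => ?_).trans ?_
    · refine (sum_deviation_le hMne u S hε hε1).trans ?_
      have := hLD S (Finset.mem_filter.1 hS).2
      gcongr
    · rw [nsmul_eq_mul]
      gcongr
      exact card_small_subsets_le (by linarith) hkn
  have hfin : Real.exp L * (2 * Real.exp (-(L * D))) ≤ δ / 2 := by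
    have h1 : Real.exp (-D) = δ / 8 := by
      rw [Real.exp_neg, hD, Real.exp_log (by positivity), inv_div]
    have h2 : Real.exp (L + -(L * D)) ≤ Real.exp (-D) := by
      rw [Real.exp_le_exp]; nlinarith
    rw [Real.exp_add, h1] at h2
    linarith
  linarith

end RBM

/-! ## The greedy selection with accurate empirical influences -/

namespace RBM

variable {n m M : ℕ} {R : RBM n m}

/-- `S'` arises from `S` by a greedy step for the empirical influence on `u`. -/
structure GreedyStep (x : Fin M → Config n) (u : Fin n) (S S' : Finset (Fin n)) : Prop where
  subset : S ⊆ S'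
  notMem : u ∉ S'
  card_le : S'.card ≤ S.card + 1
  le_influence : ∀ j, j ∉ S → j ≠ u →
    empiricalInfluence x u (insert j S) ≤ empiricalInfluence x u S'

/-- The state of the greedy selection after `t` steps. -/
structure GreedyInvariant (R : RBM n m) (u : Fin n) (d : ℕ) (ε : ℝ) (t : ℕ)
    (S : Finset (Fin n)) : Prop where
  notMem : u ∉ S
  card_le : S.card ≤ t
  subset_or_gap_le : R.commonNbhd u ⊆ S ∨
    R.influence u (R.commonNbhd u) - R.influence u S ≤ (1 - 1 / (d : ℝ)) ^ t + 2 * ε * d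

lemma notMem_commonNbhd (u : Fin n) : u ∉ R.commonNbhd u := fun h => (mem_commonNbhd.1 h).1 rfl

lemma greedyInvariant_zero (hR : R.Ferromagnetic) (u : Fin n) (d : ℕ) {ε : ℝ} (hε : 0 ≤ ε) :
    R.GreedyInvariant u d ε 0 ∅ := by
  refine ⟨by simp, by simp, Or.inr ?_⟩
  have h1 := influence_nonneg hR u ∅
  have h2 := influence_le_one (R := R) u (R.commonNbhd u)
  have h3 : 0 ≤ 2 * ε * d := by positivity
  simp only [pow_zero]
  linarith

/-- By submodularity the gains of the at most d missing neighbors add up to at least the gap g. So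
some gain is at least g/d, and the greedy choice loses at most 2ε against it. The recursion g ↦ (1 -
1/d) g + 2ε has the fixed point 2εd. -/
lemma GreedyInvariant.step (hR : R.Ferromagnetic) {u : Fin n} {d K t : ℕ} {ε : ℝ}
    {x : Fin M → Config n} {S S' : Finset (Fin n)} (hd : 1 ≤ d)
    (hdN : (R.commonNbhd u).card ≤ d)
    (hx : R.Accurate x u K ε) (hS : R.GreedyInvariant u d ε t S) (hSS' : GreedyStep x u S S')
    (ht : t + 1 ≤ K) : R.GreedyInvariant u d ε (t + 1) S' := by
  have hcard : S'.card ≤ t + 1 := hSS'.card_le.trans (by have := hS.card_le; omega)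
  refine ⟨hSS'.notMem, hcard, ?_⟩
  by_cases hN : R.commonNbhd u ⊆ S
  · exact Or.inl (hN.trans hSS'.subset)
  right
  have hgap := hS.subset_or_gap_le.resolve_left hN
  obtain ⟨j₀, hj₀, hj₀S⟩ := Finset.not_subset.1 hN
  set N := R.commonNbhd u
  have hstep : ∀ j ∈ N \ S, R.influence u (insert j S) - R.influence u S
      ≤ R.influence u S' - R.influence u S + 2 * ε := by
    intro j hj
    rw [Finset.mem_sdiff] at hj
    have h1 := hSS'.le_influence j hj.2 (mem_commonNbhd.1 hj.1).1
    have h2 := abs_lt.1 (hx (insert j S) (by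
      rw [Finset.card_insert_of_notMem hj.2]; have := hS.card_le; omega))
    have h3 := abs_lt.1 (hx S' (hcard.trans ht))
    linarith [h2.1, h3.2]
  -- The sign is needed to replace the number of missing neighbors by its bound d. It comes from a
  -- missing neighbor, whose gain is nonnegative.
  have hnn : 0 ≤ R.influence u S' - R.influence u S + 2 * ε :=
    le_trans (by linarith [influence_le_insert hR u j₀ S])
      (hstep j₀ (Finset.mem_sdiff.2 ⟨hj₀, hj₀S⟩))
  have h1 := influence_union_sub_le hR u S (N \ S)
  rw [Finset.union_sdiff_self_eq_union] at h1
  have h2 := Finset.sum_le_card_nsmul _ _ _ hstep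
  rw [nsmul_eq_mul] at h2
  have h3 : ((N \ S).card : ℝ) ≤ d := by
    exact_mod_cast (Finset.card_le_card Finset.sdiff_subset).trans hdN
  have h4 := mul_le_mul_of_nonneg_right h3 hnn
  have h5 := influence_mono hR u (Finset.subset_union_right : N ⊆ S ∪ N)
  have hd0 : (0 : ℝ) < d := by exact_mod_cast hd
  set g := R.influence u N - R.influence u S
  have h6 : g / d ≤ R.influence u S' - R.influence u S + 2 * ε := by
    rw [div_le_iff₀ hd0]
    linarith
  have h7 : 0 ≤ 1 - 1 / (d : ℝ) := by
    rw [sub_nonneg, div_le_one hd0]; exact_mod_cast hd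
  have h8 := mul_le_mul_of_nonneg_left hgap h7
  have h9 : (1 - 1 / (d : ℝ)) * ((1 - 1 / (d : ℝ)) ^ t + 2 * ε * d)
      = (1 - 1 / (d : ℝ)) ^ (t + 1) + 2 * ε * d - 2 * ε := by
    have : (d : ℝ)⁻¹ * d = 1 := inv_mul_cancel₀ hd0.ne'
    rw [pow_succ, one_div]
    linear_combination (-(2 * ε)) * this
  have h10 : (1 - 1 / (d : ℝ)) * g = g - g / d := by ring
  linarith

/-- The gap is at most η/4 from the contraction plus η/2 from the sampling errors. A missing
neighbor would force it to be at least 2η, since adding S to the full neighborhood does not change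
the influence. -/
lemma GreedyInvariant.commonNbhd_subset {α β η : ℝ} (hα : 0 < α) (hR : R.Ferromagnetic)
    (hN : R.NonDegenerate α β) (hη : η = etaOf α β) {u : Fin n} {d : ℕ} (hd : 1 ≤ d)
    {S : Finset (Fin n)}
    (hS : R.GreedyInvariant u d (η / (4 * d)) ⌈d * Real.log (4 / η)⌉₊ S) :
    R.commonNbhd u ⊆ S := by
  have hη0 : 0 < η := hη ▸ etaOf_pos hα
  rcases hS.subset_or_gap_le with h | h
  · exact h
  by_contra hsub
  obtain ⟨j, hj, hjS⟩ := Finset.not_subset.1 hsub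
  have hd0 : (0 : ℝ) < d := by exact_mod_cast hd
  have h1 := two_mul_etaOf_le_gain hα hR hN hj hS.notMem hjS
  rw [← hη] at h1
  have h2 : R.influence u (insert j S) ≤ R.influence u (R.commonNbhd u ∪ S) :=
    influence_mono hR u (Finset.insert_subset (Finset.mem_union_left _ hj)
      Finset.subset_union_right)
  rw [influence_eq_of_commonNbhd_subset (R := R) (S := R.commonNbhd u ∪ S) (T := R.commonNbhd u)
    (by simp [notMem_commonNbhd, hS.notMem]) (notMem_commonNbhd u) Finset.subset_union_left
    subset_rfl] at h2
  have h3 : 2 * (η / (4 * d)) * d = η / 2 := by field_simp; ring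
  have h4 : (1 - 1 / (d : ℝ)) ^ ⌈d * Real.log (4 / η)⌉₊ ≤ η / 4 := by
    have h5 : 1 - 1 / (d : ℝ) ≤ Real.exp (-(1 / d)) := by
      have := Real.add_one_le_exp (-(1 / (d : ℝ))); linarith
    have h6 : 0 ≤ 1 - 1 / (d : ℝ) := by
      rw [sub_nonneg, div_le_one hd0]; exact_mod_cast hd
    refine (pow_le_pow_left₀ h6 h5 _).trans ?_
    rw [← Real.exp_nat_mul, ← Real.le_log_iff_exp_le (by positivity)]
    have h7 := Nat.le_ceil (d * Real.log (4 / η))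
    have h8 : Real.log (η / 4) = -Real.log (4 / η) := by rw [← Real.log_inv, inv_div]
    rw [h8, mul_neg, neg_le_neg_iff, mul_one_div, le_div_iff₀ hd0]
    linarith
  linarith

/-- The true difference is 0 for a non-neighbor and at least 2η for a neighbor, and the empirical
one is off by less than η/2. -/
lemma prune_iff {α β η : ℝ} (hα : 0 < α) (hR : R.Ferromagnetic) (hN : R.NonDegenerate α β)
    (hη : η = etaOf α β) {u : Fin n} {d K : ℕ} (hd : 1 ≤ d) {x : Fin M → Config n}
    (hx : R.Accurate x u K (η / (4 * d))) {S : Finset (Fin n)} (huS : u ∉ S) (hS : S.card ≤ K)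
    (hNS : R.commonNbhd u ⊆ S) {j : Fin n} (hj : j ∈ S) :
    η ≤ empiricalInfluence x u S - empiricalInfluence x u (S.erase j) ↔ j ∈ R.commonNbhd u := by
  have hη0 : 0 < η := hη ▸ etaOf_pos hα
  have hd1 : (1 : ℝ) ≤ d := by exact_mod_cast hd
  have hε : η / (4 * d) ≤ η / 4 := by
    apply div_le_div_of_nonneg_left hη0.le (by norm_num); linarith
  have h1 := abs_lt.1 (hx S hS)
  have h2 := abs_lt.1 (hx (S.erase j) ((Finset.card_le_card (Finset.erase_subset j S)).trans hS))
  constructor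
  · intro h
    by_contra hjN
    have h3 := influence_eq_of_commonNbhd_subset (R := R) (u := u) (S := S) (T := S.erase j) huS
      (fun h => huS (Finset.mem_of_mem_erase h)) hNS
      fun i hi => Finset.mem_erase.2 ⟨fun h => hjN (h ▸ hi), hNS hi⟩
    linarith [h1.2, h2.1]
  · intro h
    have h3 := two_mul_etaOf_le_gain hα hR hN h (S := S.erase j)
      (fun h => huS (Finset.mem_of_mem_erase h)) (Finset.notMem_erase j S)
    rw [Finset.insert_erase hj, ← hη] at h3
    linarith [h1.1, h2.2]

end RBM

/-! ## Expectations and specifications of programs -/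

namespace Prog

variable {n M q : ℕ} {A B : Type}

/-- The expectation of `g` of the output, if the samples are `x`. -/
noncomputable def expect (x : Fin M → Config n) (g : A → ℝ) : Prog n M q A → ℝ
  | .ret a => g a
  | .step p => p.expect x g
  | .query i j p => (p (x i j)).expect x g
  | .coin L p => (∑ l ∈ Finset.range L, (p l).expect x g) / L
  | .circuit c p => (c.apply x (zeroState q)).sum fun b a => ‖a‖ ^ 2 * (p b).expect x g

open Classical in
lemma prob_eq_expect (x : Fin M → Config n) (E : Set A) (p : Prog n M q A) :
    p.prob x E = p.expect x fun a => if a ∈ E then 1 else 0 := by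
  induction p with
  | ret a => rfl
  | step p ih => exact ih
  | query i j p ih => exact ih _
  | coin L p ih => simp only [prob, expect, ih]
  | circuit c p ih => simp only [prob, expect, ih]

variable (x : Fin M → Config n)

@[simp] lemma expect_pure (g : A → ℝ) (a : A) :
    (pure a : Prog n M q A).expect x g = g a := rfl

-- The law of total expectation. Programs are analyzed backwards with it: the rest of the program
-- becomes the test function of the current part.
@[simp] lemma expect_bind (g : B → ℝ) (p : Prog n M q A) (f : A → Prog n M q B) :
    (p >>= f).expect x g = p.expect x fun a => (f a).expect x g := by
  change (p.bind f).expect x g = _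
  induction p with
  | ret a => rfl
  | step p ih => exact ih
  | query i j p ih => exact ih _
  | coin L p ih => simp only [bind, expect, ih]
  | circuit c p ih => simp only [bind, expect, ih]

variable {x}

lemma expect_mono {g h : A → ℝ} (H : ∀ a, g a ≤ h a) (p : Prog n M q A) :
    p.expect x g ≤ p.expect x h := by
  induction p with
  | ret a => exact H a
  | step p ih => exact ih
  | query i j p ih => exact ih _
  | coin L p ih =>
    exact div_le_div_of_nonneg_right (Finset.sum_le_sum fun l _ => ih l) (Nat.cast_nonneg _)
  | circuit c p ih =>
    exact Finset.sum_le_sum fun b _ => mul_le_mul_of_nonneg_left (ih b) (by positivity)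

lemma expect_const_mul (c : ℝ) (g : A → ℝ) (p : Prog n M q A) :
    (p.expect x fun a => c * g a) = c * p.expect x g := by
  induction p with
  | ret a => rfl
  | step p ih => exact ih
  | query i j p ih => exact ih _
  | coin L p ih => simp only [expect, ih, ← Finset.mul_sum, mul_div_assoc]
  | circuit c' p ih =>
    simp only [expect, ih, Finsupp.sum, Finset.mul_sum]
    exact Finset.sum_congr rfl fun b _ => by ring

@[simp] lemma expect_tick (g : Unit → ℝ) (c : ℕ) : (tick c : Prog n M q Unit).expect x g = g () := by
  induction c with
  | zero => rfl
  | succ c ih => exact ih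

/-- The running time is at most `t` and every possible output satisfies `Q`. -/
def Spec (Q : A → Prop) : Prog n M q A → ℝ → Prop
  | .ret a, t => 0 ≤ t ∧ Q a
  | .step p, t => p.Spec Q (t - 1)
  | .query _ _ p, t => ∀ b, (p b).Spec Q (t - 1)
  | .coin _ p, t => ∀ l, (p l).Spec Q (t - 1)
  | .circuit c p, t => ∀ b, (p b).Spec Q (t - (c.length + q + 8))

lemma Spec.timeLE {Q : A → Prop} {p : Prog n M q A} {t : ℝ} (h : p.Spec Q t) : p.TimeLE t := by
  induction p generalizing t with
  | ret a => exact h.1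
  | step p ih => exact ih h
  | query i j p ih => exact fun b => ih b (h b)
  | coin L p ih => exact fun l => ih l (h l)
  | circuit c p ih => exact fun b => ih b (h b)

lemma Spec.mono {Q Q' : A → Prop} {p : Prog n M q A} {t t' : ℝ} (h : p.Spec Q t)
    (hQ : ∀ a, Q a → Q' a) (ht : t ≤ t') : p.Spec Q' t' := by
  induction p generalizing t t' with
  | ret a => exact ⟨h.1.trans ht, hQ a h.2⟩
  | step p ih => exact ih h (by linarith)
  | query i j p ih => exact fun b => ih b (h b) (by linarith)
  | coin L p ih => exact fun l => ih l (h l) (by linarith)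
  | circuit c p ih => exact fun b => ih b (h b) (by linarith)

lemma Spec.le {Q : A → Prop} {p : Prog n M q A} {t t' : ℝ} (h : p.Spec Q t) (ht : t ≤ t') :
    p.Spec Q t' := h.mono (fun _ => id) ht

lemma Spec.pure {Q : A → Prop} {a : A} (h : Q a) : (pure a : Prog n M q A).Spec Q 0 :=
  ⟨le_rfl, h⟩

/-- The postcondition is carried along because the time of the continuation depends on the lengths
of the lists computed before. -/
lemma Spec.bind {Q : A → Prop} {Q' : B → Prop} {p : Prog n M q A} {f : A → Prog n M q B}
    {s t : ℝ} (hp : p.Spec Q s) (hf : ∀ a, Q a → (f a).Spec Q' t) :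
    (p >>= f).Spec Q' (s + t) := by
  change (p.bind f).Spec Q' (s + t)
  induction p generalizing s with
  | ret a => exact (hf a hp.2).le (by linarith [hp.1])
  | step p ih => exact (ih hp).le (by linarith)
  | query i j p ih => exact fun b => (ih b (hp b)).le (by linarith)
  | coin L p ih => exact fun l => (ih l (hp l)).le (by linarith)
  | circuit c p ih => exact fun b => (ih b (hp b)).le (by linarith)

lemma Spec.tick (c : ℕ) : (tick c : Prog n M q Unit).Spec (fun _ => True) c := by
  induction c with
  | zero => exact ⟨by simp, trivial⟩
  | succ c ih => exact ih.le (by push_cast; linarith)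

/-! ### Computing index sets -/

@[simp] lemma expect_select (v : Fin n) (L : List (Fin M)) (g : List (Fin M) → ℝ) :
    (select v L : Prog n M q _).expect x g = g (L.filter fun i => x i v) := by
  induction L generalizing g with
  | nil => rfl
  | cons i L ih =>
    simp only [select, expect_bind, expect_tick, ih, expect_pure, expect, List.filter_cons]

lemma Spec.select (v : Fin n) (L : List (Fin M)) :
    (select v L : Prog n M q _).Spec (fun L' => L'.length ≤ L.length) (2 * L.length) := by
  induction L with
  | nil => exact (Spec.pure (by simp)).le (by simp)
  | cons i L ih =>
    have h : (Prog.query i v .ret : Prog n M q Bool).Spec (fun _ => True) 1 :=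
      fun b => ⟨by norm_num, trivial⟩
    refine (h.bind fun b _ => (Spec.tick 1).bind fun _ _ => ih.bind fun L' hL' =>
      Spec.pure (Q := fun L' : List (Fin M) => L'.length ≤ (i :: L).length) ?_).le ?_
    · split_ifs <;> simp <;> omega
    · push_cast [List.length_cons]; linarith

@[simp] lemma expect_selectAll (S : List (Fin n)) (L : List (Fin M)) (g : List (Fin M) → ℝ) :
    (selectAll S L : Prog n M q _).expect x g
      = g (L.filter fun i => decide (∀ v ∈ S, x i v = true)) := by
  induction S generalizing L with
  | nil => simp [selectAll]
  | cons v S ih =>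
    simp only [selectAll, expect_bind, ih, expect_select, List.filter_filter]
    congr 2
    ext i
    simp [Bool.and_comm]

lemma Spec.selectAll (S : List (Fin n)) (L : List (Fin M)) :
    (selectAll S L : Prog n M q _).Spec (fun L' => L'.length ≤ L.length)
      (2 * L.length * S.length) := by
  induction S generalizing L with
  | nil => exact (Spec.pure (Q := fun L' : List (Fin M) => L'.length ≤ L.length) le_rfl).le (by simp)
  | cons v S ih =>
    refine ((Spec.select v L).bind (t := 2 * L.length * S.length) fun L' hL' => (ih L').mono
      (fun _ h => h.trans hL') ?_).le ?_
    · gcongr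
    · push_cast [List.length_cons]; linarith

/-- The list of the samples with `x_S = 1`. -/
def sampleList (x : Fin M → Config n) (S : List (Fin n)) : List (Fin M) :=
  (List.finRange M).filter fun i => decide (∀ v ∈ S, x i v = true)

lemma length_filter_finRange (p : Fin M → Prop) [DecidablePred p] :
    ((List.finRange M).filter fun i => decide (p i)).length = (Finset.univ.filter p).card := by
  rw [← List.toFinset_card_of_nodup ((List.nodup_finRange M).filter _)]
  congr 1
  ext i
  simp

lemma length_sampleList (S : List (Fin n)) :
    (sampleList x S).length = empCount x S.toFinset := by
  rw [sampleList, length_filter_finRange, empCount]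
  simp

lemma length_filter_sampleList (u : Fin n) (S : List (Fin n)) :
    ((sampleList x S).filter fun i => x i u).length = empCount x (insert u S.toFinset) := by
  rw [empCount, ← length_filter_finRange, sampleList, List.filter_filter]
  congr 2
  ext i
  simp

@[simp] lemma expect_indexSet (S : List (Fin n)) (g : List (Fin M) → ℝ) :
    (indexSet S : Prog n M q _).expect x g = g (sampleList x S) := by
  simp [indexSet, sampleList]

lemma Spec.indexSet (S : List (Fin n)) :
    (indexSet S : Prog n M q _).Spec (fun L => L.length ≤ M) (M + 2 * M * S.length) := by
  refine (Spec.tick M).bind fun _ _ => ?_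
  simpa using Spec.selectAll (q := q) S (List.finRange M)

@[simp] lemma expect_empInfluence (u : Fin n) (S : List (Fin n)) (g : ℝ → ℝ) :
    (empInfluence u S : Prog n M q _).expect x g = g (empiricalInfluence x u S.toFinset) := by
  simp [empInfluence, empiricalInfluence, length_sampleList, length_filter_sampleList]

lemma Spec.empInfluence (u : Fin n) (S : List (Fin n)) :
    (empInfluence u S : Prog n M q _).Spec (fun _ => True) (5 * M + 2 * M * S.length + 5) := by
  refine ((Spec.indexSet S).bind (t := 4 * M + 5) fun L hL => ?_).le (by linarith)
  have hL' : (L.length : ℝ) ≤ M := by exact_mod_cast hL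
  refine ((Spec.select u L).bind (t := 2 * M + 5) fun Lu hLu => ?_).le (by linarith)
  have hLu' : (Lu.length : ℝ) ≤ L.length := by exact_mod_cast hLu
  refine ((Spec.tick _).bind fun _ _ => Spec.pure trivial).le ?_
  push_cast
  linarith

@[simp] lemma expect_prune (u : Fin n) (η : ℝ) (S : List (Fin n)) (v : ℝ) (L : List (Fin n))
    (g : List (Fin n) → ℝ) : (prune u η S v L : Prog n M q _).expect x g
      = g (L.filter fun j => decide (η ≤ v - empiricalInfluence x u (S.erase j).toFinset)) := by
  induction L generalizing g with
  | nil => rfl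
  | cons j L ih =>
    simp only [prune, expect_bind, expect_tick, ih, expect_pure, expect_empInfluence,
      List.filter_cons, decide_eq_true_eq]

lemma Spec.prune (u : Fin n) (η : ℝ) (S : List (Fin n)) (v : ℝ) (L : List (Fin n)) :
    (prune u η S v L : Prog n M q _).Spec (fun _ => True)
      (L.length * (S.length + (5 * M + 2 * M * S.length + 5) + 3)) := by
  induction L with
  | nil => exact (Spec.pure trivial).le (by simp)
  | cons j L ih =>
    have h1 : (Prog.empInfluence u (S.erase j) : Prog n M q _).Spec (fun _ => True)
        (5 * M + 2 * M * S.length + 5) := (Spec.empInfluence u (S.erase j)).le (by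
      have : ((S.erase j).length : ℝ) ≤ S.length := by exact_mod_cast List.length_erase_le
      gcongr)
    refine ((Spec.tick S.length).bind fun _ _ => h1.bind fun w _ => (Spec.tick 3).bind fun _ _ =>
      ih.bind fun L' _ => Spec.pure trivial).le ?_
    push_cast [List.length_cons]
    linarith

end Prog

/-! ## Action of circuits on superpositions of indices -/

section CircuitAction

variable {n M q : ℕ} (x : Fin M → Config n)

/-- The state `∑ j, α j |j, w j⟩`. -/
noncomputable def superposition (w : (Fin q → Bool) → Reg → ℝ) (α : (Fin q → Bool) → ℂ) :
    QState q :=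
  ∑ j, Finsupp.single (j, w j) (α j)

/-- In a `superposition` the words are a function of the index. Register gates and sign flips
preserve this form. Hadamard gates are applied only when the words do not depend on the index, that
is, after uncomputation. -/
lemma Gate.apply_superposition (g : Gate M q) (w : (Fin q → Bool) → Reg → ℝ)
    (α : (Fin q → Bool) → ℂ) :
    g.apply x (superposition w α) = ∑ j, α j • g.onBasis x (j, w j) := by
  change Finsupp.linearCombination ℂ (fun s => g.onBasis x s) (superposition w α) = _
  simp [superposition]

lemma sum_superposition (w : (Fin q → Bool) → Reg → ℝ) (α : (Fin q → Bool) → ℂ)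
    (F : Basis q → ℝ) :
    ((superposition w α).sum fun b a => ‖a‖ ^ 2 * F b) = ∑ j, ‖α j‖ ^ 2 * F (j, w j) := by
  have hinj : Function.Injective fun j : Fin q → Bool => ((j, w j) : Basis q) :=
    fun a b h => congrArg Prod.fst h
  have h : superposition w α = Finsupp.mapDomain (fun j => ((j, w j) : Basis q))
      (Finsupp.equivFunOnFinite.symm α) := by
    rw [Finsupp.mapDomain, Finsupp.sum_fintype _ _ (by simp), superposition]
    rfl
  rw [h, Finsupp.sum_mapDomain_index_inj hinj, Finsupp.sum_fintype _ _ (by simp)]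
  rfl

lemma Circuit.apply_append (c d : Circuit M q) (ψ : QState q) :
    Circuit.apply x (c ++ d) ψ = Circuit.apply x d (Circuit.apply x c ψ) :=
  List.foldl_append

lemma Circuit.apply_cons (g : Gate M q) (c : Circuit M q) (ψ : QState q) :
    Circuit.apply x (g :: c) ψ = Circuit.apply x c (g.apply x ψ) := rfl

/-! ### Register gates -/

/-- The gates that change the content of a word register. -/
def Gate.IsReg : Gate M q → Prop
  | .had _ => False
  | .sign _ => False
  | _ => True

/-- The word registers after a gate. -/
noncomputable def Gate.regs (s : Basis q) : Gate M q → Reg → ℝ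
  | .had _ => s.2
  | .sign _ => s.2
  | .query i r => Function.update s.2 r (s.2 r + sampleEntry x i (idx s.1))
  | .unquery i r => Function.update s.2 r (s.2 r - sampleEntry x i (idx s.1))
  | .acc r o a b => Function.update s.2 r (s.2 r + accValue s r o a b)
  | .unacc r o a b => Function.update s.2 r (s.2 r - accValue s r o a b)

/-- The word registers after a circuit, for the index `j`. -/
noncomputable def Circuit.regs (c : Circuit M q) (j : Fin q → Bool) (w : Reg → ℝ) : Reg → ℝ :=
  c.foldl (fun w g => g.regs x (j, w)) w

lemma Circuit.regs_append (c d : Circuit M q) (j : Fin q → Bool) (w : Reg → ℝ) :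
    Circuit.regs x (c ++ d) j w = Circuit.regs x d j (Circuit.regs x c j w) :=
  List.foldl_append

lemma Circuit.regs_cons (g : Gate M q) (c : Circuit M q) (j : Fin q → Bool) (w : Reg → ℝ) :
    Circuit.regs x (g :: c) j w = Circuit.regs x c j (g.regs x (j, w)) := rfl

lemma Circuit.regs_nil (j : Fin q → Bool) (w : Reg → ℝ) :
    Circuit.regs (M := M) x [] j w = w := rfl

lemma Gate.onBasis_of_isReg {g : Gate M q} (hg : g.IsReg) (s : Basis q) :
    g.onBasis x s = Finsupp.single (s.1, g.regs x s) 1 := by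
  cases g <;> first | exact hg.elim | rfl

lemma Circuit.apply_superposition {c : Circuit M q} (hc : ∀ g ∈ c, Gate.IsReg g)
    (w : (Fin q → Bool) → Reg → ℝ) (α : (Fin q → Bool) → ℂ) :
    Circuit.apply x c (superposition w α) = superposition (fun j => Circuit.regs x c j (w j)) α := by
  induction c generalizing w with
  | nil => rfl
  | cons g c ih =>
    rw [Circuit.apply_cons, Gate.apply_superposition]
    simp only [Gate.onBasis_of_isReg x (hc g List.mem_cons_self), Finsupp.smul_single,
      smul_eq_mul, mul_one]
    exact ih (fun g hg => hc g (List.mem_cons_of_mem _ hg)) fun j => g.regs x (j, w j)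

/-- The added value does not depend on the target register, which is read as 0. Hence `unacc`
inverts `acc`. -/
lemma accValue_update (j : Fin q → Bool) (w : Reg → ℝ) (r : Reg) (v : ℝ) (o : WordOp)
    (a b : Operand) :
    accValue (j, Function.update w r v) r o a b = accValue (j, w) r o a b := by
  simp [accValue]

lemma Gate.regs_inv (g : Gate M q) (j : Fin q → Bool) (w : Reg → ℝ) :
    g.inv.regs x (j, g.regs x (j, w)) = w := by
  cases g <;> simp [Gate.inv, Gate.regs, accValue_update]

lemma Gate.isReg_inv {g : Gate M q} (hg : g.IsReg) : g.inv.IsReg := by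
  cases g <;> first | exact hg.elim | trivial

lemma Circuit.regs_inv (c : Circuit M q) (j : Fin q → Bool) (w : Reg → ℝ) :
    Circuit.regs x c.inv j (Circuit.regs x c j w) = w := by
  induction c generalizing w with
  | nil => rfl
  | cons g c ih =>
    have e : Circuit.inv (g :: c) = Circuit.inv c ++ [g.inv] := by simp [Circuit.inv]
    rw [e, Circuit.regs_append]
    change g.inv.regs x (j, Circuit.regs x (Circuit.inv c) j
      (Circuit.regs x c j (g.regs x (j, w)))) = w
    rw [ih, Gate.regs_inv]

lemma Circuit.isReg_inv {c : Circuit M q} (hc : ∀ g ∈ c, Gate.IsReg g) :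
    ∀ g ∈ Circuit.inv c, Gate.IsReg g := by
  intro g hg
  simp only [Circuit.inv, List.mem_reverse, List.mem_map] at hg
  obtain ⟨g', hg', rfl⟩ := hg
  exact Gate.isReg_inv (hc g' hg')

/-! ### Conditional sign flips -/

lemma sign_apply_superposition (r : Reg) (w : (Fin q → Bool) → Reg → ℝ)
    (α : (Fin q → Bool) → ℂ) :
    (Gate.sign r : Gate M q).apply x (superposition w α)
      = superposition w fun j => if w j r = 0 then α j else -α j := by
  rw [Gate.apply_superposition, superposition]
  refine Finset.sum_congr rfl fun j _ => ?_
  simp only [Gate.onBasis, Finsupp.smul_single, smul_eq_mul]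
  split_ifs <;> simp

lemma signIf_apply_superposition (o : WordOp) (a b : Operand)
    (w : (Fin q → Bool) → Reg → ℝ) (hw : ∀ j, w j .flag = 0) (α : (Fin q → Bool) → ℂ) :
    Circuit.apply x (signIf o a b : Circuit M q) (superposition w α)
      = superposition w fun j => if accValue (j, w j) .flag o a b = 0 then α j else -α j := by
  have h1 : ∀ g ∈ ([.acc .flag o a b] : Circuit M q), Gate.IsReg g := by
    simp [Gate.IsReg]
  have h2 : ∀ g ∈ ([.unacc .flag o a b] : Circuit M q), Gate.IsReg g := by
    simp [Gate.IsReg]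
  have e : (signIf o a b : Circuit M q)
      = [.acc .flag o a b] ++ ([.sign .flag] ++ [.unacc .flag o a b]) := rfl
  have e' : Circuit.apply x ([.sign .flag] : Circuit M q) = (Gate.sign .flag : Gate M q).apply x :=
    rfl
  rw [e, Circuit.apply_append, Circuit.apply_append, Circuit.apply_superposition x h1,
    e', sign_apply_superposition, Circuit.apply_superposition x h2]
  congr 1
  · funext j
    exact Gate.regs_inv x (.acc .flag o a b) j (w j)
  · funext j
    simp [Circuit.regs, Gate.regs, hw]

/-! ### Hadamard gates -/

/-- The action of a Hadamard gate on amplitudes. -/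
noncomputable def hadamardAmp (t : Fin q) (α : (Fin q → Bool) → ℂ) : (Fin q → Bool) → ℂ :=
  fun y => ((√2 : ℝ) : ℂ)⁻¹ * (α (Function.update y t false) +
    (if y t then -1 else 1) * α (Function.update y t true))

/-- Exchanging bit t of the index with the separate bit is an involution. It passes from a sum over
inputs of a Hadamard gate to a sum over outputs. -/
lemma sum_update_swap {A : Type*} [AddCommMonoid A] (t : Fin q) (f : (Fin q → Bool) → Bool → A) :
    ∑ j, ∑ c, f j c = ∑ j, ∑ c, f (Function.update j t c) (j t) := by
  rw [← Fintype.sum_prod_type', ← Fintype.sum_prod_type'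
    (f := fun j c => f (Function.update j t c) (j t))]
  have hinv : Function.Involutive fun p : (Fin q → Bool) × Bool =>
      (Function.update p.1 t p.2, p.1 t) := fun p => by simp
  exact (Equiv.sum_comp hinv.toPerm fun p : (Fin q → Bool) × Bool => f p.1 p.2).symm

lemma had_apply_superposition (t : Fin q) (w : Reg → ℝ) (α : (Fin q → Bool) → ℂ) :
    (Gate.had t : Gate M q).apply x (superposition (fun _ => w) α)
      = superposition (fun _ => w) (hadamardAmp t α) := by
  have h := sum_update_swap t fun (j : Fin q → Bool) (c : Bool) =>
    (Finsupp.single ((Function.update j t c, w) : Basis q)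
      (((√2 : ℝ) : ℂ)⁻¹ * ((if j t && c then -1 else 1) * α j)) : QState q)
  simp only [Fintype.sum_bool, Function.update_idem, Function.update_eq_self,
    Function.update_self] at h
  rw [Gate.apply_superposition, superposition]
  convert h using 1
  · refine Finset.sum_congr rfl fun j _ => ?_
    simp only [Gate.onBasis, smul_add, Finsupp.smul_single, smul_eq_mul]
    rw [add_comm]
    congr 2
    · rcases Bool.eq_false_or_eq_true (j t) with hj | hj <;> simp [hj] <;> ring
    · rcases Bool.eq_false_or_eq_true (j t) with hj | hj <;> simp [hj] <;> ring
  · refine Finset.sum_congr rfl fun j _ => ?_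
    rw [← Finsupp.single_add, hadamardAmp]
    congr 1
    rcases Bool.eq_false_or_eq_true (j t) with hj | hj <;> simp [hj] <;> ring

lemma sqrt_two_inv_sq : ((√2 : ℝ) : ℂ)⁻¹ * ((√2 : ℝ) : ℂ)⁻¹ = 1 / 2 := by
  rw [← mul_inv, ← Complex.ofReal_mul, Real.mul_self_sqrt zero_le_two]
  norm_num

lemma hadamardAmp_hadamardAmp (t : Fin q) (α : (Fin q → Bool) → ℂ) :
    hadamardAmp t (hadamardAmp t α) = α := by
  funext y
  simp only [hadamardAmp, Function.update_idem, Function.update_self]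
  obtain ⟨c, hc⟩ : ∃ c, y t = c := ⟨_, rfl⟩
  have h : Function.update y t c = y := by rw [← hc, Function.update_eq_self]
  cases c <;> simp [hc, h] <;> linear_combination (2 * α y) * sqrt_two_inv_sq

lemma hadamardAmp_comm (s t : Fin q) (α : (Fin q → Bool) → ℂ) :
    hadamardAmp s (hadamardAmp t α) = hadamardAmp t (hadamardAmp s α) := by
  by_cases h : s = t
  · rw [h]
  funext y
  simp only [hadamardAmp, Function.update_of_ne h, Function.update_of_ne (Ne.symm h),
    Function.update_comm h]
  ring

/-- The action of Hadamard gates on the qubits in a list. -/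
noncomputable def hadamardAmps (l : List (Fin q)) (α : (Fin q → Bool) → ℂ) :
    (Fin q → Bool) → ℂ :=
  l.foldl (fun α t => hadamardAmp t α) α

lemma hadamardAmp_hadamardAmps (t : Fin q) (l : List (Fin q)) (α : (Fin q → Bool) → ℂ) :
    hadamardAmp t (hadamardAmps l α) = hadamardAmps l (hadamardAmp t α) := by
  induction l generalizing α with
  | nil => rfl
  | cons s l ih =>
    change hadamardAmp t (hadamardAmps l (hadamardAmp s α))
      = hadamardAmps l (hadamardAmp s (hadamardAmp t α))
    rw [ih, hadamardAmp_comm]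

lemma hadamardAmps_hadamardAmps (l : List (Fin q)) (α : (Fin q → Bool) → ℂ) :
    hadamardAmps l (hadamardAmps l α) = α := by
  induction l generalizing α with
  | nil => rfl
  | cons s l ih =>
    change hadamardAmps l (hadamardAmp s (hadamardAmps l (hadamardAmp s α))) = α
    rw [← hadamardAmp_hadamardAmps, ih, hadamardAmp_hadamardAmp]

lemma sum_mul_hadamardAmp (t : Fin q) (α β : (Fin q → Bool) → ℂ) :
    ∑ y, β y * hadamardAmp t α y = ∑ y, hadamardAmp t β y * α y := by
  have h := sum_update_swap t fun (j : Fin q → Bool) (c : Bool) =>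
    ((√2 : ℝ) : ℂ)⁻¹ * (β j * ((if j t && c then -1 else 1) * α (Function.update j t c)))
  simp only [Fintype.sum_bool, Function.update_idem, Function.update_eq_self,
    Function.update_self] at h
  convert h using 1
  · refine Finset.sum_congr rfl fun j _ => ?_
    simp only [hadamardAmp]
    rcases Bool.eq_false_or_eq_true (j t) with hj | hj <;> simp [hj] <;> ring
  · refine Finset.sum_congr rfl fun j _ => ?_
    simp only [hadamardAmp]
    rcases Bool.eq_false_or_eq_true (j t) with hj | hj <;> simp [hj] <;> ring

lemma sum_mul_hadamardAmps (l : List (Fin q)) (α β : (Fin q → Bool) → ℂ) :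
    ∑ y, β y * hadamardAmps l α y = ∑ y, hadamardAmps l β y * α y := by
  induction l generalizing α β with
  | nil => rfl
  | cons s l ih =>
    change ∑ y, β y * hadamardAmps l (hadamardAmp s α) y
      = ∑ y, hadamardAmps l (hadamardAmp s β) y * α y
    rw [ih, sum_mul_hadamardAmp, hadamardAmp_hadamardAmps]

lemma hadamardAmps_sub_mul (l : List (Fin q)) (α β : (Fin q → Bool) → ℂ) (c : ℂ) :
    hadamardAmps l (fun j => α j - c * β j)
      = fun j => hadamardAmps l α j - c * hadamardAmps l β j := by
  induction l generalizing α β with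
  | nil => rfl
  | cons s l ih =>
    change hadamardAmps l (hadamardAmp s fun j => α j - c * β j)
      = fun j => hadamardAmps l (hadamardAmp s α) j - c * hadamardAmps l (hadamardAmp s β) j
    rw [← ih]
    congr 1
    funext j
    simp only [hadamardAmp]
    ring

lemma hadamardAmps_indicator {l : List (Fin q)} (hl : l.Nodup) :
    hadamardAmps l (fun j => if ∀ t ∈ l, j t = false then 1 else 0)
      = fun _ => ((√2 : ℝ) : ℂ)⁻¹ ^ l.length := by
  induction l with
  | nil => simp [hadamardAmps]
  | cons s l ih =>
    rw [List.nodup_cons] at hl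
    change hadamardAmps l (hadamardAmp s _) = _
    have e : hadamardAmp s (fun j => if ∀ t ∈ s :: l, j t = false then 1 else 0)
        = fun j => 0 - (-((√2 : ℝ) : ℂ)⁻¹) * (if ∀ t ∈ l, j t = false then 1 else 0) := by
      funext j
      have h1 : ∀ c, (∀ t ∈ l, Function.update j s c t = false) ↔ ∀ t ∈ l, j t = false :=
        fun c => forall₂_congr fun t ht => by
          rw [Function.update_of_ne fun h : t = s => hl.1 (h ▸ ht)]
      simp only [hadamardAmp, List.forall_mem_cons, Function.update_self, h1]
      split_ifs <;> simp_all
    rw [e, hadamardAmps_sub_mul l (fun _ => 0), ih hl.2]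
    have e0 : hadamardAmps l (fun _ : Fin q → Bool => (0 : ℂ)) = fun _ => 0 := by
      have := hadamardAmps_sub_mul l (fun _ => (0 : ℂ)) (fun _ => 0) 1
      simpa using this
    simp only [e0, List.length_cons, pow_succ]
    funext j
    ring

lemma hadamards_apply (w : Reg → ℝ) (α : (Fin q → Bool) → ℂ) :
    Circuit.apply x (hadamards : Circuit M q) (superposition (fun _ => w) α)
      = superposition (fun _ => w) (hadamardAmps (List.finRange q) α) := by
  unfold hadamards
  generalize List.finRange q = l
  induction l generalizing α with
  | nil => rfl
  | cons s l ih =>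
    rw [List.map_cons, Circuit.apply_cons, had_apply_superposition, ih]
    rfl

/-- The indicator of the index `0`. -/
noncomputable def zeroAmp (q : ℕ) : (Fin q → Bool) → ℂ :=
  fun j => if ∀ t, j t = false then 1 else 0

lemma hadamardAmps_zeroAmp :
    hadamardAmps (List.finRange q) (zeroAmp q) = fun _ => ((√2 : ℝ) : ℂ)⁻¹ ^ q := by
  have e : zeroAmp q = fun j => if ∀ t ∈ List.finRange q, j t = false then 1 else 0 := by
    funext j
    simp [zeroAmp]
  rw [e, hadamardAmps_indicator (List.nodup_finRange q), List.length_finRange]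

lemma zeroState_eq : zeroState q = superposition (fun _ _ => 0) (zeroAmp q) := by
  rw [superposition, Finset.sum_eq_single_of_mem (fun _ => false) (Finset.mem_univ _), zeroState]
  · simp [zeroAmp]
  · intro j _ hj
    rw [zeroAmp, if_neg fun h => hj (funext h), Finsupp.single_zero]

lemma idx_eq_zero_iff (j : Fin q → Bool) : idx j = 0 ↔ ∀ t, j t = false := by
  simp [idx]

/-- The reflection about the uniform superposition, up to the sign. -/
lemma diffusion_apply (α : (Fin q → Bool) → ℂ) :
    Circuit.apply x (hadamards ++ signIf .eq .index (.const 0) ++ hadamards : Circuit M q)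
        (superposition (fun _ _ => 0) α)
      = superposition (fun _ _ => 0) fun j => α j - 2 * ((∑ y, α y) / 2 ^ q) := by
  rw [Circuit.apply_append, Circuit.apply_append, hadamards_apply,
    signIf_apply_superposition x _ _ _ _ (fun _ => rfl), hadamards_apply]
  congr 1
  set W := hadamardAmps (List.finRange q) with hW
  -- W is symmetric, so the amplitude at index 0 is the pairing of α with the image of that index,
  -- which is uniform.
  have hzero : W α (fun _ => false) = ((√2 : ℝ) : ℂ)⁻¹ ^ q * ∑ y, α y := by
    have h := sum_mul_hadamardAmps (List.finRange q) α (zeroAmp q)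
    rw [hadamardAmps_zeroAmp, ← Finset.mul_sum] at h
    rw [← h, Finset.sum_eq_single_of_mem (fun _ => false) (Finset.mem_univ _)]
    · simp [zeroAmp, hW]
    · intro j _ hj
      rw [zeroAmp, if_neg fun h => hj (funext h), zero_mul]
  have e : (fun j => if accValue (j, fun _ => 0) .flag .eq .index (.const 0) = 0 then W α j
      else -W α j) = fun j => W α j - 2 * W α (fun _ => false) * zeroAmp q j := by
    funext j
    have hj : accValue (j, fun _ => 0) .flag .eq .index (.const 0)
        = if ∀ t, j t = false then 1 else 0 := by
      simp only [accValue, WordOp.eval, Operand.eval, Nat.cast_eq_zero, idx_eq_zero_iff]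
    simp only [hj, zeroAmp]
    split_ifs with h1 h2 h2
    · simp at h2
    · have : j = fun _ => false := funext h1
      rw [this]; ring
    · ring
    · exact absurd rfl h2
  rw [e, hzero, hW, hadamardAmps_sub_mul, hadamardAmps_hadamardAmps, hadamardAmps_zeroAmp]
  funext j
  have h2 : ((√2 : ℝ) : ℂ)⁻¹ ^ q * ((√2 : ℝ) : ℂ)⁻¹ ^ q = 1 / 2 ^ q := by
    rw [← mul_pow, sqrt_two_inv_sq, one_div, inv_pow, one_div]
  linear_combination (-2 * ∑ y, α y) * h2

end CircuitAction

/-! ## Grover iterations -/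

section Grover

variable {n M q : ℕ} (x : Fin M → Config n)

/-- A circuit of register gates that leaves the register `flag` clean. -/
structure IsValueCircuit (U : Circuit M q) : Prop where
  isReg : ∀ g ∈ U, Gate.IsReg g
  flag : ∀ j, Circuit.regs x U j (fun _ => 0) .flag = 0

/-- The basis state that a value circuit computes from the index `j`. -/
noncomputable def valueState (U : Circuit M q) (j : Fin q → Bool) : Basis q :=
  (j, Circuit.regs x U j fun _ => 0)

/-- The value that a value circuit computes from the index `j`. -/
noncomputable def indexValue (U : Circuit M q) (j : Fin q → Bool) : ℝ :=
  (valueState x U j).2 .val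

/-- The indices with value larger than `y`. -/
noncomputable def marked (U : Circuit M q) (y : ℝ) : Finset (Fin q → Bool) :=
  Finset.univ.filter fun j => y < indexValue x U j

lemma mem_marked {U : Circuit M q} {y : ℝ} {j : Fin q → Bool} :
    j ∈ marked x U y ↔ y < indexValue x U j := by
  simp [marked]

/-- The rotation angle of a Grover iteration for `s` solutions among `N` indices. -/
noncomputable def groverAngle (N s : ℝ) : ℝ := Real.arcsin √(s / N)

lemma sin_groverAngle {N s : ℝ} (hs : s ≤ N) (hN : 0 < N) :
    Real.sin (groverAngle N s) = √s / √N := by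
  rw [groverAngle, Real.sin_arcsin, Real.sqrt_div' _ hN.le]
  · linarith [Real.sqrt_nonneg (s / N)]
  · exact Real.sqrt_le_one.2 ((div_le_one hN).2 hs)

lemma cos_groverAngle {N s : ℝ} (hs0 : 0 ≤ s) (hN : 0 < N) :
    Real.cos (groverAngle N s) = √(N - s) / √N := by
  rw [groverAngle, Real.cos_arcsin, Real.sq_sqrt (by positivity), ← Real.sqrt_div' _ hN.le]
  congr 1
  field_simp

/-- The amplitude after Grover iterations with total angle `φ`. -/
noncomputable def groverAmp (T : Finset (Fin q → Bool)) (φ : ℝ) (j : Fin q → Bool) : ℝ :=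
  open Classical in
  if j ∈ T then Real.sin φ / √T.card else Real.cos φ / √((2 : ℝ) ^ q - T.card)

lemma card_index : Fintype.card (Fin q → Bool) = 2 ^ q := by simp

lemma card_le_two_pow (T : Finset (Fin q → Bool)) : (T.card : ℝ) ≤ 2 ^ q := by
  have := Finset.card_le_univ T
  rw [card_index] at this
  exact_mod_cast this

open Classical in
lemma card_compl_index (T : Finset (Fin q → Bool)) : (Tᶜ.card : ℝ) = 2 ^ q - T.card := by
  rw [Finset.card_compl, card_index, Nat.cast_sub (by rw [← card_index]; exact Finset.card_le_univ T)]
  simp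

/-- The phase oracle replaces φ by -φ, the amplitudes then sum to √N cos(φ + θ), and subtracting
twice their mean gives the angle φ + 2θ with a global sign. Empty and full T are included, because s
/ √s = √s also holds for s = 0. -/
lemma groverAmp_step (T : Finset (Fin q → Bool)) (φ : ℝ) (j : Fin q → Bool) :
    (open Classical in if j ∈ T then -groverAmp T φ j else groverAmp T φ j)
      - 2 * ((∑ y, (open Classical in if y ∈ T then -groverAmp T φ y else groverAmp T φ y)) / 2 ^ q)
      = -groverAmp T (φ + 2 * groverAngle (2 ^ q) T.card) j := by
  classical
  set N : ℝ := 2 ^ q with hN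
  have hN0 : 0 < N := by positivity
  set θ := groverAngle N T.card with hθ
  have hsin : Real.sin θ = √T.card / √N := sin_groverAngle (card_le_two_pow T) hN0
  have hcos : Real.cos θ = √(N - T.card) / √N := cos_groverAngle (Nat.cast_nonneg _) hN0
  have hNs : 0 ≤ N - T.card := sub_nonneg.2 (card_le_two_pow T)
  have hsN : 0 < √N := Real.sqrt_pos.2 hN0
  have hsum : (∑ y, if y ∈ T then -groverAmp T φ y else groverAmp T φ y)
      = √N * Real.cos (φ + θ) := by
    rw [Finset.sum_ite]
    have h1 : (Finset.univ.filter fun y => y ∈ T) = T := by simp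
    have h2 : (Finset.univ.filter fun y => y ∉ T) = Tᶜ := by ext; simp
    rw [h1, h2, Finset.sum_congr rfl fun y hy => by rw [groverAmp, if_pos hy],
      Finset.sum_congr (s₁ := Tᶜ) rfl fun y hy => by rw [groverAmp, if_neg (Finset.mem_compl.1 hy)],
      Finset.sum_const, Finset.sum_const, nsmul_eq_mul, nsmul_eq_mul, card_compl_index, ← hN,
      Real.cos_add, hsin, hcos]
    have e1 : (T.card : ℝ) / √T.card = √T.card := Real.div_sqrt
    have e2 : (N - T.card) / √(N - T.card) = √(N - T.card) := Real.div_sqrt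
    have e3 : √N * (Real.cos φ * (√(N - T.card) / √N) - Real.sin φ * (√T.card / √N))
        = Real.cos φ * √(N - T.card) - Real.sin φ * √T.card := by
      field_simp
    rw [e3]
    linear_combination (-Real.sin φ) * e1 + Real.cos φ * e2
  rw [hsum]
  have e4 : √N * Real.cos (φ + θ) / N = Real.cos (φ + θ) / √N := by
    nth_rewrite 2 [← Real.mul_self_sqrt hN0.le]
    field_simp
  rw [e4]
  have hφ : Real.sin φ = Real.sin (φ + θ) * Real.cos θ - Real.cos (φ + θ) * Real.sin θ := by
    rw [← Real.sin_sub]; congr 1; ring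
  have hφc : Real.cos φ = Real.cos (φ + θ) * Real.cos θ + Real.sin (φ + θ) * Real.sin θ := by
    rw [← Real.cos_sub]; congr 1; ring
  have hφ2 : Real.sin (φ + 2 * θ) = Real.sin (φ + θ) * Real.cos θ + Real.cos (φ + θ) * Real.sin θ := by
    rw [← Real.sin_add]; congr 1; ring
  have hφ2c : Real.cos (φ + 2 * θ)
      = Real.cos (φ + θ) * Real.cos θ - Real.sin (φ + θ) * Real.sin θ := by
    rw [← Real.cos_add]; congr 1; ring
  by_cases hj : j ∈ T
  · have hT : 0 < √(T.card : ℝ) := Real.sqrt_pos.2 (by exact_mod_cast Finset.card_pos.2 ⟨j, hj⟩)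
    simp only [groverAmp, if_pos hj]
    rw [hφ2, hφ, hsin]
    field_simp
    ring
  · have hT : 0 < √(N - T.card) := by
      rw [Real.sqrt_pos, ← card_compl_index]
      exact_mod_cast Finset.card_pos.2 ⟨j, Finset.mem_compl.2 hj⟩
    simp only [groverAmp, if_neg hj, ← hN]
    rw [hφ2c, hφc, hcos]
    field_simp
    ring

variable {x}

lemma markCircuit_apply {U : Circuit M q} (hU : IsValueCircuit x U) (y : ℝ)
    (α : (Fin q → Bool) → ℂ) :
    Circuit.apply x (markCircuit U y) (superposition (fun _ _ => 0) α)
      = superposition (fun _ _ => 0) fun j =>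
        (open Classical in if j ∈ marked x U y then -α j else α j) := by
  rw [markCircuit, Circuit.apply_append, Circuit.apply_append,
    Circuit.apply_superposition x hU.isReg, signIf_apply_superposition x _ _ _ _ hU.flag,
    Circuit.apply_superposition x (Circuit.isReg_inv hU.isReg)]
  congr 1
  · funext j
    exact Circuit.regs_inv x U j _
  · funext j
    have hj : accValue (j, Circuit.regs x U j fun _ => 0) .flag .lt (.const y) (.reg .val)
        = if y < indexValue x U j then 1 else 0 := by
      change WordOp.eval .lt y (Function.update (Circuit.regs x U j fun _ => 0) Reg.flag 0 .val) = _
      rw [Function.update_of_ne (by decide)]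
      rfl
    simp only [hj, mem_marked]
    split_ifs with h1 h2 h2
    · simp at h2
    · rfl
    · rfl
    · exact absurd rfl h2

lemma groverIter_apply {U : Circuit M q} (hU : IsValueCircuit x U) (y φ : ℝ) (c : ℝ) :
    Circuit.apply x (groverIter U y) (superposition (fun _ _ => 0) fun j =>
        ((c * groverAmp (marked x U y) φ j : ℝ) : ℂ))
      = superposition (fun _ _ => 0) fun j =>
        ((-c * groverAmp (marked x U y) (φ + 2 * groverAngle (2 ^ q) (marked x U y).card) j : ℝ)
          : ℂ) := by
  rw [groverIter, List.append_assoc, List.append_assoc, Circuit.apply_append,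
    markCircuit_apply hU, ← List.append_assoc, diffusion_apply]
  congr 1
  funext j
  classical
  have e : ∀ i, (if i ∈ marked x U y then -((c * groverAmp (marked x U y) φ i : ℝ) : ℂ)
        else ((c * groverAmp (marked x U y) φ i : ℝ) : ℂ))
      = ((c * (if i ∈ marked x U y then -groverAmp (marked x U y) φ i
          else groverAmp (marked x U y) φ i) : ℝ) : ℂ) := by
    intro i
    split_ifs
    · push_cast; ring
    · rfl
  simp only [e]
  rw [← Complex.ofReal_sum, ← Finset.mul_sum, neg_mul, ← mul_neg, ← groverAmp_step]
  generalize (∑ i, if i ∈ marked x U y then -groverAmp (marked x U y) φ i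
    else groverAmp (marked x U y) φ i) = t
  generalize (if j ∈ marked x U y then -groverAmp (marked x U y) φ j
    else groverAmp (marked x U y) φ j) = r
  push_cast
  ring

lemma groverIters_apply {U : Circuit M q} (hU : IsValueCircuit x U) (y φ : ℝ) (l : ℕ) (c : ℝ) :
    Circuit.apply x (List.replicate l (groverIter U y)).flatten
        (superposition (fun _ _ => 0) fun j => ((c * groverAmp (marked x U y) φ j : ℝ) : ℂ))
      = superposition (fun _ _ => 0) fun j => (((-1) ^ l * c * groverAmp (marked x U y)
          (φ + 2 * l * groverAngle (2 ^ q) (marked x U y).card) j : ℝ) : ℂ) := by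
  induction l generalizing φ c with
  | zero => simp [Circuit.apply]
  | succ l ih =>
    rw [List.replicate_succ, List.flatten_cons, Circuit.apply_append, groverIter_apply hU, ih]
    congr 1
    funext j
    congr 2
    · ring
    · push_cast; congr 1; ring

/-- The rotation starts at the angle θ itself, whence the odd multiples (2l + 1)θ after l
iterations. -/
lemma uniform_eq_groverAmp (T : Finset (Fin q → Bool)) (j : Fin q → Bool) :
    groverAmp T (groverAngle (2 ^ q) T.card) j = 1 / √(2 ^ q) := by
  have hN0 : (0 : ℝ) < 2 ^ q := by positivity
  unfold groverAmp
  split_ifs with hj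
  · have hT : 0 < √(T.card : ℝ) := Real.sqrt_pos.2 (by exact_mod_cast Finset.card_pos.2 ⟨j, hj⟩)
    rw [sin_groverAngle (card_le_two_pow T) hN0]
    field_simp
  · classical
    have hT : 0 < √((2 : ℝ) ^ q - T.card) := by
      rw [Real.sqrt_pos, ← card_compl_index]
      exact_mod_cast Finset.card_pos.2 ⟨j, Finset.mem_compl.2 hj⟩
    rw [cos_groverAngle (Nat.cast_nonneg _) hN0]
    field_simp

lemma groverCircuit_apply {U : Circuit M q} (hU : IsValueCircuit x U) (y : ℝ) (l : ℕ) :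
    Circuit.apply x (groverCircuit U y l) (zeroState q)
      = superposition (fun j => Circuit.regs x U j fun _ => 0) fun j =>
        (((-1) ^ l * groverAmp (marked x U y)
          ((2 * l + 1) * groverAngle (2 ^ q) (marked x U y).card) j : ℝ) : ℂ) := by
  have h0 : Circuit.apply x (hadamards : Circuit M q) (zeroState q)
      = superposition (fun _ _ => 0) fun j => ((1 * groverAmp (marked x U y)
          (groverAngle (2 ^ q) (marked x U y).card) j : ℝ) : ℂ) := by
    rw [zeroState_eq, hadamards_apply, hadamardAmps_zeroAmp]
    congr 1
    funext j
    rw [uniform_eq_groverAmp]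
    push_cast
    rw [one_mul, one_div, inv_pow]
    have : √((2 : ℝ) ^ q) = √2 ^ q := by
      rw [Real.sqrt_eq_iff_mul_self_eq (by positivity) (by positivity), ← mul_pow,
        Real.mul_self_sqrt zero_le_two]
    rw [this]
    push_cast
    rfl
  rw [groverCircuit, Circuit.apply_append, Circuit.apply_append, h0, groverIters_apply hU,
    Circuit.apply_superposition x hU.isReg]
  congr 1
  funext j
  congr 2
  · ring
  · congr 1; ring

/-- The distribution of the outcome of a Grover search. -/
lemma expect_groverCircuit {U : Circuit M q} (hU : IsValueCircuit x U) (y : ℝ) (l : ℕ)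
    (F : Basis q → ℝ) :
    (Prog.circuit (groverCircuit U y l) .ret : Prog n M q _).expect x F
      = Real.sin ((2 * l + 1) * groverAngle (2 ^ q) (marked x U y).card) ^ 2 *
          ((∑ j ∈ marked x U y, F (valueState x U j)) / (marked x U y).card)
        + Real.cos ((2 * l + 1) * groverAngle (2 ^ q) (marked x U y).card) ^ 2 *
          ((∑ j ∈ (marked x U y)ᶜ, F (valueState x U j)) / (2 ^ q - (marked x U y).card)) := by
  classical
  change ((groverCircuit U y l).apply x (zeroState q)).sum (fun b a => ‖a‖ ^ 2 * F b) = _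
  rw [groverCircuit_apply hU, sum_superposition, ← Finset.sum_add_sum_compl (marked x U y)]
  have hn : ∀ r : ℝ, ‖(((-1) ^ l * r : ℝ) : ℂ)‖ ^ 2 = r ^ 2 := by
    intro r
    rw [Complex.norm_real, Real.norm_eq_abs, sq_abs, mul_pow, ← pow_mul, mul_comm l 2, pow_mul]
    norm_num
  simp only [hn]
  have hT : (0 : ℝ) ≤ 2 ^ q - (marked x U y).card := sub_nonneg.2 (card_le_two_pow _)
  congr 1
  · rw [Finset.sum_div, Finset.mul_sum]
    refine Finset.sum_congr rfl fun j hj => ?_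
    rw [groverAmp, if_pos hj, div_pow, Real.sq_sqrt (Nat.cast_nonneg _), valueState]
    ring
  · rw [Finset.sum_div, Finset.mul_sum]
    refine Finset.sum_congr rfl fun j hj => ?_
    rw [groverAmp, if_neg (Finset.mem_compl.1 hj), div_pow, Real.sq_sqrt hT, valueState]
    ring

end Grover

/-! ## The circuit for the empirical influence -/

section InfluenceCircuit

variable {n M q : ℕ} (x : Fin M → Config n)

/-- The number of samples `i` in `L` with `x^i_j = 1`, for the index `j`. -/
noncomputable def countValue (L : List (Fin M)) (j : Fin q → Bool) : ℝ :=
  (L.map fun i => if sampleEntry x i (idx j) = 1 then (1 : ℝ) else 0).sum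

lemma regs_countCircuit {r : Reg} (hr : r ≠ .bit) (L : List (Fin M)) (j : Fin q → Bool)
    {w : Reg → ℝ} (hw : w .bit = 0) :
    Circuit.regs x (countCircuit r L) j w = Function.update w r (w r + countValue x L j) := by
  induction L generalizing w with
  | nil => simp [countCircuit, Circuit.regs, countValue]
  | cons i L ih =>
    have e : (countCircuit r (i :: L) : Circuit M q)
        = [.query i .bit, .acc r .eq (.reg .bit) (.const 1), .unquery i .bit] ++ countCircuit r L :=
      rfl
    have h3 : Circuit.regs x ([.query i .bit, .acc r .eq (.reg .bit) (.const 1),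
        .unquery i .bit] : Circuit M q) j w
        = Function.update w r (w r + if sampleEntry x i (idx j) = 1 then 1 else 0) := by
      simp only [Circuit.regs_cons, Circuit.regs_nil, Gate.regs, accValue, WordOp.eval,
        Operand.eval, Function.update_self, hw, zero_add, Function.update_of_ne hr,
        Function.update_of_ne hr.symm, sub_self]
      rw [Function.update_comm hr, Function.update_idem, ← hw, Function.update_eq_self]
    rw [e, Circuit.regs_append, h3, ih (by rw [Function.update_of_ne hr.symm, hw]),
      Function.update_idem, Function.update_self, add_assoc]
    rfl

lemma regs_badCircuit (L : List (Fin n)) (j : Fin q → Bool) (w : Reg → ℝ) :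
    Circuit.regs x (L.map (fun v : Fin n => .acc .bad .eq .index (.const ((v : ℕ) : ℝ))) : Circuit M q) j w
      = Function.update w .bad
        (w .bad + (L.map fun v : Fin n => if (idx j : ℝ) = ((v : ℕ) : ℝ) then (1 : ℝ) else 0).sum) := by
  induction L generalizing w with
  | nil => simp [Circuit.regs]
  | cons v L ih =>
    rw [List.map_cons, Circuit.regs_cons, ih]
    simp only [Gate.regs, Function.update_idem, Function.update_self, accValue, WordOp.eval,
      Operand.eval, List.map_cons, List.sum_cons, add_assoc]
    congr!

/-- The number of reasons for which the index `j` is not a candidate. -/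
noncomputable def badValue (u : Fin n) (S : List (Fin n)) (j : Fin q → Bool) : ℝ :=
  ((u :: S).map fun v : Fin n => if (idx j : ℝ) = ((v : ℕ) : ℝ) then (1 : ℝ) else 0).sum +
    if (n : ℝ) ≤ (idx j : ℝ) then 1 else 0

/-- The ratio is accumulated twice, which makes the factor 2. The clean `flag` is what conditional
sign flips need later. -/
lemma regs_influenceCircuit (u : Fin n) (S : List (Fin n)) (MS MSu : List (Fin M))
    (j : Fin q → Bool) :
    Circuit.regs x (influenceCircuit n u S MS MSu) j (fun _ => 0) .val
        = 2 * ((countValue x MSu j / M) / (countValue x MS j / M)) - 1 - 4 * badValue u S j ∧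
      Circuit.regs x (influenceCircuit n u S MS MSu) j (fun _ => 0) .flag = 0 := by
  simp only [influenceCircuit, Circuit.regs_append]
  rw [regs_countCircuit x (by decide) MS j rfl, regs_countCircuit x (by decide) MSu j (by simp)]
  have h5 : ∀ w : Reg → ℝ, Circuit.regs x ([.acc .probS .div (.reg .cntS) (.const M),
      .acc .probSu .div (.reg .cntSu) (.const M),
      .acc .val .div (.reg .probSu) (.reg .probS),
      .acc .val .div (.reg .probSu) (.reg .probS),
      .acc .val .mul (.const (-1)) (.const 1)] : Circuit M q) j w
      = Function.update (Function.update (Function.update w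
        .probS (w .probS + w .cntS / M)) .probSu (w .probSu + w .cntSu / M))
        .val (w .val + 2 * ((w .probSu + w .cntSu / M) / (w .probS + w .cntS / M)) - 1) := by
    intro w
    simp [Circuit.regs_cons, Circuit.regs_nil, Gate.regs, accValue, WordOp.eval, Operand.eval]
    ring_nf
  rw [h5, regs_badCircuit]
  have h2 : ∀ w : Reg → ℝ, Circuit.regs x ([.acc .bad .le (.const n) .index,
      .acc .val .mul (.const (-4)) (.reg .bad)] : Circuit M q) j w
      = Function.update (Function.update w
        .bad (w .bad + if (n : ℝ) ≤ (idx j : ℝ) then 1 else 0))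
        .val (w .val - 4 * (w .bad + if (n : ℝ) ≤ (idx j : ℝ) then 1 else 0)) := by
    intro w
    simp [Circuit.regs_cons, Circuit.regs_nil, Gate.regs, accValue, WordOp.eval, Operand.eval]
    ring_nf
  rw [h2]
  constructor
  · rw [badValue]
    simp
  · simp

lemma isValueCircuit_influenceCircuit (u : Fin n) (S : List (Fin n)) (MS MSu : List (Fin M)) :
    IsValueCircuit x (influenceCircuit n u S MS MSu : Circuit M q) := by
  refine ⟨?_, fun j => (regs_influenceCircuit x u S MS MSu j).2⟩
  have hc : ∀ (r : Reg) (L : List (Fin M)), ∀ g ∈ (countCircuit r L : Circuit M q), g.IsReg := by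
    intro r L g hg
    simp only [countCircuit, List.mem_flatMap, List.mem_cons, List.not_mem_nil, or_false] at hg
    obtain ⟨i, -, rfl | rfl | rfl⟩ := hg <;> trivial
  intro g hg
  simp only [influenceCircuit, List.mem_append, List.mem_cons, List.mem_map, List.not_mem_nil,
    or_false] at hg
  rcases hg with ((((hg | hg) | hg) | hg) | hg)
  · exact hc _ _ g hg
  · exact hc _ _ g hg
  · rcases hg with rfl | rfl | rfl | rfl | rfl <;> trivial
  · obtain ⟨v, -, rfl⟩ := hg
    trivial
  · rcases hg with rfl | rfl <;> trivial

lemma length_influenceCircuit (u : Fin n) (S : List (Fin n)) (MS MSu : List (Fin M)) :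
    (influenceCircuit n u S MS MSu : Circuit M q).length
      = 3 * MS.length + 3 * MSu.length + S.length + 8 := by
  have hc : ∀ (r : Reg) (L : List (Fin M)), (countCircuit r L : Circuit M q).length
      = 3 * L.length := by
    intro r L
    induction L with
    | nil => rfl
    | cons i L ih =>
      have e : (countCircuit r (i :: L) : Circuit M q) = [.query i .bit,
          .acc r .eq (.reg .bit) (.const 1), .unquery i .bit] ++ countCircuit r L := rfl
      rw [e, List.length_append, ih]
      simp
      omega
  simp only [influenceCircuit, List.length_append, hc, List.length_map, List.length_cons,
    List.length_nil]
  omega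

variable {x}

lemma countValue_nonneg (L : List (Fin M)) (j : Fin q → Bool) : 0 ≤ countValue x L j := by
  refine List.sum_nonneg fun r hr => ?_
  obtain ⟨i, -, rfl⟩ := List.mem_map.1 hr
  split_ifs <;> norm_num

lemma countValue_filter_le (p : Fin M → Bool) (L : List (Fin M)) (j : Fin q → Bool) :
    countValue x (L.filter p) j ≤ countValue x L j := by
  induction L with
  | nil => rfl
  | cons i L ih =>
    have h1 : countValue x (i :: L) j
        = (if sampleEntry x i (idx j) = 1 then 1 else 0) + countValue x L j := rfl
    rw [List.filter_cons]
    split_ifs with h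
    · have h2 : countValue x (i :: L.filter p) j
        = (if sampleEntry x i (idx j) = 1 then 1 else 0) + countValue x (L.filter p) j := rfl
      rw [h1, h2]
      linarith
    · rw [h1]
      have : (0 : ℝ) ≤ if sampleEntry x i (idx j) = 1 then 1 else 0 := by
        split_ifs <;> norm_num
      linarith

lemma countValue_eq (L : List (Fin M)) {j : Fin q → Bool} (h : idx j < n) :
    countValue x L j = (L.filter fun i => x i ⟨idx j, h⟩).length := by
  induction L with
  | nil => simp [countValue]
  | cons i L ih =>
    have h1 : countValue x (i :: L) j
        = (if sampleEntry x i (idx j) = 1 then 1 else 0) + countValue x L j := rfl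
    have h2 : sampleEntry x i (idx j) = 1 ↔ x i ⟨idx j, h⟩ = true := by
      rw [sampleEntry, dif_pos h]
      cases x i ⟨idx j, h⟩ <;> norm_num [spin]
    simp only [h1, h2, ih, List.filter_cons]
    split_ifs
    · push_cast [List.length_cons]; ring
    · simp

/-- The index `j` is a node outside `S ∪ {u}`. -/
def IsCandidate (u : Fin n) (S : List (Fin n)) (j : Fin q → Bool) : Prop :=
  ∃ h : idx j < n, (⟨idx j, h⟩ : Fin n) ∉ u :: S

/-- The circuit of a greedy round. -/
noncomputable def roundCircuit (q : ℕ) (x : Fin M → Config n) (u : Fin n) (S : List (Fin n)) :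
    Circuit M q :=
  influenceCircuit n u S (Prog.sampleList x S) ((Prog.sampleList x S).filter fun i => x i u)

lemma indexValue_of_isCandidate {u : Fin n} {S : List (Fin n)} {j : Fin q → Bool}
    (h : idx j < n) (hj : (⟨idx j, h⟩ : Fin n) ∉ u :: S) :
    indexValue x (roundCircuit q x u S) j
      = empiricalInfluence x u (insert ⟨idx j, h⟩ S.toFinset) := by
  have hbad : badValue u S j = 0 := by
    have h1 : ¬ (n : ℝ) ≤ (idx j : ℝ) := by exact_mod_cast h.not_ge
    rw [badValue, if_neg h1, add_zero]
    refine List.sum_eq_zero fun r hr => ?_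
    obtain ⟨v, hv, rfl⟩ := List.mem_map.1 hr
    rw [if_neg]
    intro hv'
    have : idx j = v := by exact_mod_cast hv'
    exact hj (by convert hv)
  rw [indexValue, valueState, roundCircuit]
  simp only []
  rw [(regs_influenceCircuit x u S _ _ j).1, hbad,
    countValue_eq _ h, countValue_eq _ h, Prog.length_filter_sampleList, empiricalInfluence]
  have e : (((Prog.sampleList x S).filter fun i => x i u).filter fun i => x i ⟨idx j, h⟩).length
      = empCount x (insert u (insert ⟨idx j, h⟩ S.toFinset)) := by
    rw [empCount, ← Prog.length_filter_finRange, Prog.sampleList, List.filter_filter,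
      List.filter_filter]
    congr 2
    ext i
    simp [Bool.and_comm, Bool.and_assoc]
  rw [e]
  ring

/-- Even here the ratio of the counts is at most 1, so a single reason for rejection leaves at most
2 - 1 - 4. Empirical influences are at least -1. -/
lemma indexValue_le_of_not_isCandidate {u : Fin n} {S : List (Fin n)} {j : Fin q → Bool}
    (hj : ¬ IsCandidate u S j) : indexValue x (roundCircuit q x u S) j ≤ -3 := by
  have hnn : ∀ r ∈ (u :: S).map fun v : Fin n => if (idx j : ℝ) = ((v : ℕ) : ℝ) then (1 : ℝ) else 0,
      0 ≤ r := by
    intro r hr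
    obtain ⟨v, -, rfl⟩ := List.mem_map.1 hr
    split_ifs <;> norm_num
  have hbad : 1 ≤ badValue u S j := by
    rw [badValue]
    by_cases h : idx j < n
    · have hmem : (⟨idx j, h⟩ : Fin n) ∈ u :: S := by
        by_contra hm
        exact hj ⟨h, hm⟩
      have h1 := List.single_le_sum hnn 1 (List.mem_map.2 ⟨_, hmem, if_pos rfl⟩)
      have h2 : (0 : ℝ) ≤ if (n : ℝ) ≤ (idx j : ℝ) then 1 else 0 := by split_ifs <;> norm_num
      linarith
    · have h1 : (n : ℝ) ≤ (idx j : ℝ) := by exact_mod_cast not_lt.1 h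
      rw [if_pos h1]
      linarith [List.sum_nonneg hnn]
  rw [indexValue, valueState, roundCircuit]
  simp only []
  rw [(regs_influenceCircuit x u S _ _ j).1]
  have hratio : (countValue x ((Prog.sampleList x S).filter fun i => x i u) j / M)
      / (countValue x (Prog.sampleList x S) j / M) ≤ 1 :=
    div_le_one_of_le₀ (div_le_div_of_nonneg_right (countValue_filter_le _ _ _) (Nat.cast_nonneg _))
      (div_nonneg (countValue_nonneg _ _) (Nat.cast_nonneg _))
  linarith

lemma neg_one_le_empiricalInfluence (u : Fin n) (S : Finset (Fin n)) :
    -1 ≤ empiricalInfluence x u S := by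
  rw [empiricalInfluence]
  have : (0 : ℝ) ≤ ((empCount x (insert u S) : ℝ) / M) / ((empCount x S : ℝ) / M) := by positivity
  linarith

/-- The index register holds every number below `2 ^ q`. -/
lemma exists_idx_eq {q k : ℕ} (hk : k < 2 ^ q) : ∃ j : Fin q → Bool, idx j = k := by
  induction q generalizing k with
  | zero => exact ⟨fun _ => false, by simp [idx]; omega⟩
  | succ q ih =>
    obtain ⟨j, hj⟩ := ih (k := k / 2) (by rw [pow_succ] at hk; omega)
    refine ⟨Fin.cons (decide (k % 2 = 1)) j, ?_⟩
    have h : idx (Fin.cons (decide (k % 2 = 1)) j : Fin (q + 1) → Bool)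
        = (if k % 2 = 1 then 1 else 0) + 2 * idx j := by
      simp [idx, Fin.sum_univ_succ, Finset.mul_sum, pow_succ', mul_ite]
    rw [h, hj]
    split_ifs <;> omega

end InfluenceCircuit

/-! ## Exponential search with an unknown number of solutions -/

section ExponentialSearch

/-- The sum telescopes: each term is 2 sin 2θ minus the difference of consecutive values of sin 4lθ.
-/
lemma four_mul_sin_two_mul_sum (θ : ℝ) (L : ℕ) :
    4 * Real.sin (2 * θ) * ∑ l ∈ Finset.range L, Real.sin ((2 * l + 1) * θ) ^ 2
      = 2 * L * Real.sin (2 * θ) - Real.sin (4 * L * θ) := by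
  induction L with
  | zero => simp
  | succ L ih =>
    have h1 : Real.sin (4 * ((L + 1 : ℕ) : ℝ) * θ)
        = Real.sin (2 * ((2 * L + 1) * θ) + 2 * θ) := by congr 1; push_cast; ring
    have h2 : Real.sin (4 * L * θ) = Real.sin (2 * ((2 * L + 1) * θ) - 2 * θ) := by
      congr 1; ring
    rw [Finset.sum_range_succ, mul_add, ih, h1, h2, Real.sin_add, Real.sin_sub,
      Real.cos_two_mul' ((2 * L + 1) * θ), Real.cos_sq']
    push_cast
    ring

/-- If the number of Grover iterations is uniform among the non-negative integers below
`L ≥ 1 / sin θ`, then the search succeeds with probability at least `1 / 4`. -/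
lemma quarter_le_sum_sin_sq {θ : ℝ} (h0 : 0 < θ) (h1 : θ ≤ Real.pi / 2) {L : ℕ}
    (hL : 1 ≤ L * Real.sin θ) :
    (L : ℝ) / 4 ≤ ∑ l ∈ Finset.range L, Real.sin ((2 * l + 1) * θ) ^ 2 := by
  have hpi := Real.pi_pos
  have hsum := four_mul_sin_two_mul_sum θ L
  have hL0 : (0 : ℝ) ≤ L := Nat.cast_nonneg L
  -- For θ = π/2 the closed formula degenerates to 0 = 0, but every term of the sum is 1.
  rcases h1.eq_or_lt with rfl | h1
  · have : ∀ l ∈ Finset.range L, Real.sin ((2 * l + 1) * (Real.pi / 2)) ^ 2 = 1 := by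
      intro l _
      have e : (2 * (l : ℝ) + 1) * (Real.pi / 2) = l * Real.pi + Real.pi / 2 := by ring
      have hc := Real.sin_sq_add_cos_sq (l * Real.pi)
      rw [e, Real.sin_add_pi_div_two]
      rw [Real.sin_nat_mul_pi] at hc
      linarith
    rw [Finset.sum_congr rfl this]
    simp
    linarith
  have hs2 : 0 < Real.sin (2 * θ) := Real.sin_pos_of_pos_of_lt_pi (by linarith) (by linarith)
  suffices h : Real.sin (4 * L * θ) ≤ L * Real.sin (2 * θ) by
    refine le_of_mul_le_mul_left ?_ (by positivity : 0 < 4 * Real.sin (2 * θ))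
    rw [hsum]
    linarith
  -- If cos θ ≥ 1/2, then L sin 2θ = 2 L sin θ cos θ ≥ 1. Otherwise reflect to φ = π/2 - θ: either
  -- the sine on the left is nonpositive, or 4Lφ > π and Jordan's inequality gives L sin 2φ ≥ 1.
  rcases le_or_gt (1 / 2) (Real.cos θ) with hc | hc
  · rw [Real.sin_two_mul]
    have := Real.sin_le_one (4 * L * θ)
    nlinarith
  · set φ := Real.pi / 2 - θ with hφ
    have hφ0 : 0 < φ := by linarith
    have hφ1 : φ ≤ Real.pi / 4 := by
      by_contra hlt
      have h3 := Real.cos_le_cos_of_nonneg_of_le_pi h0.le (by linarith)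
        (by linarith : θ ≤ Real.pi / 4)
      rw [Real.cos_pi_div_four] at h3
      have : (1 : ℝ) ≤ √2 := Real.one_le_sqrt.2 (by norm_num)
      linarith
    have e1 : Real.sin (2 * θ) = Real.sin (2 * φ) := by
      rw [← Real.sin_pi_sub]; congr 1; rw [hφ]; ring
    have e2 : Real.sin (4 * L * θ) = -Real.sin (4 * L * φ) := by
      have : 4 * L * θ = L * (2 * Real.pi) - 4 * L * φ := by rw [hφ]; ring
      rw [this, Real.sin_nat_mul_two_pi_sub]
    rw [e1, e2]
    have h2 := Real.mul_le_sin (x := 2 * φ) (by linarith) (by linarith)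
    rcases le_or_gt (4 * L * φ) Real.pi with h | h
    · have := Real.sin_nonneg_of_nonneg_of_le_pi (by positivity) h
      have : 0 ≤ (L : ℝ) * Real.sin (2 * φ) := mul_nonneg hL0 (e1 ▸ hs2.le)
      linarith
    · have h3 := Real.neg_one_le_sin (4 * L * φ)
      have h4 : 1 ≤ 2 / Real.pi * (2 * φ) * L := by
        rw [div_mul_eq_mul_div, div_mul_eq_mul_div, le_div_iff₀ hpi]
        linarith
      nlinarith

/-- The expected cost of the search for an element of larger value if the Grover success
probability is at least `1 / 4` from `m = D` on. -/
noncomputable def searchCost (D m : ℝ) : ℝ :=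
  if m < D then 15 * D + 4 - 15 / 2 * m else 5 * m + 4

lemma searchCost_nonneg {D m : ℝ} (hm : 0 ≤ m) : 0 ≤ searchCost D m := by
  rw [searchCost]
  split_ifs <;> linarith

/-- A round costs at most m/2 + 1 on average and fails with probability 1 - P. From D on, the slope
5 balances exactly: m/2 + 1 + (3/4)(5 · (6/5) m + 4) = 5m + 4. Below D no success is assumed, and
the slope -15/2 pays (3/2) m for the growth of m by m/5. At the crossing, 14m + 1 ≤ 15D is enough.
-/
lemma searchCost_step {D m m₁ P : ℝ} (hm : 1 ≤ m) (hD : 1 ≤ D) (hD₁ : D ≤ m₁)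
    (hP0 : 0 ≤ P) (hP1 : P ≤ 1) (hP : D ≤ m → 1 / 4 ≤ P) :
    m / 2 + 1 + (1 - P) * searchCost D (min (6 / 5 * m) m₁) ≤ searchCost D m := by
  have h0 : 0 ≤ searchCost D (min (6 / 5 * m) m₁) :=
    searchCost_nonneg (le_min (by linarith) (by linarith))
  have hle : min (6 / 5 * m) m₁ ≤ 6 / 5 * m := min_le_left _ _
  rcases lt_or_ge m D with h | h
  · have h2 : m / 2 + 1 + searchCost D (min (6 / 5 * m) m₁) ≤ searchCost D m := by
      rw [searchCost, searchCost, if_pos h]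
      split_ifs with h3
      · have : min (6 / 5 * m) m₁ = 6 / 5 * m := by
          rcases min_choice (6 / 5 * m) m₁ with h4 | h4
          · exact h4
          · linarith
        rw [this]
        linarith
      · linarith
    nlinarith
  · have h3 : ¬ min (6 / 5 * m) m₁ < D := not_lt.2 (le_min (by linarith) hD₁)
    rw [searchCost, searchCost, if_neg h3, if_neg h.not_gt]
    rw [searchCost, if_neg h3] at h0
    nlinarith [hP h]

/-- A bound for the sum of the expected costs of all searches from rank `s` on (`√N (2 - 1/√s)` up
to a constant). -/
noncomputable def climbCost (N : ℝ) (s : ℕ) : ℝ :=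
  if s = 0 then 0 else 15 * √N * (2 - 1 / √s)

lemma monotone_climbCost (N : ℝ) : Monotone (climbCost N) := by
  have hN := Real.sqrt_nonneg N
  intro s t hst
  rw [climbCost, climbCost]
  rcases Nat.eq_zero_or_pos s with rfl | hs
  · rw [if_pos rfl]
    split_ifs with ht
    · exact le_rfl
    · have : 1 / √(t : ℝ) ≤ 1 := by
        rw [one_div]
        exact inv_le_one_of_one_le₀ (Real.one_le_sqrt.2
          (by exact_mod_cast Nat.one_le_iff_ne_zero.2 ht))
      exact mul_nonneg (by positivity) (by linarith)
  · rw [if_neg hs.ne', if_neg (hs.trans_le hst).ne']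
    have : 1 / √(t : ℝ) ≤ 1 / √(s : ℝ) := one_div_le_one_div_of_le
      (Real.sqrt_pos.2 (by exact_mod_cast hs)) (Real.sqrt_le_sqrt (by exact_mod_cast hst))
    exact mul_le_mul_of_nonneg_left (by linarith) (by positivity)

/-- After a success at rank s the new index is uniform among the marked ones, with ranks dominated
by 0, …, s - 1. Their average climbing cost is thus at most 15√N (2 - 2/√s). -/
lemma sum_climbCost_le (N : ℝ) (s : ℕ) :
    ∑ i ∈ Finset.range s, climbCost N i ≤ 15 * √N * (2 * s - 2 * √s) := by
  have hN := Real.sqrt_nonneg N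
  induction s with
  | zero => simp
  | succ s ih =>
    rw [Finset.sum_range_succ]
    refine (add_le_add_left ih _).trans ?_
    rcases Nat.eq_zero_or_pos s with rfl | hs
    · simp [climbCost]
    rw [climbCost, if_neg hs.ne', ← mul_add]
    refine mul_le_mul_of_nonneg_left ?_ (by positivity)
    have hs0 : 0 < √(s : ℝ) := Real.sqrt_pos.2 (by exact_mod_cast hs)
    have h1 := Real.sq_sqrt (Nat.cast_nonneg (α := ℝ) s)
    have h2 := Real.sq_sqrt (Nat.cast_nonneg (α := ℝ) (s + 1))
    have h3 : 2 * (√((s + 1 : ℕ) : ℝ) - √s) ≤ 1 / √s := by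
      rw [le_div_iff₀ hs0]
      push_cast at h2 ⊢
      nlinarith [sq_nonneg (√((s : ℝ) + 1) - √s)]
    push_cast at h3 ⊢
    linarith

/-- The ranks of the elements of a set, counted from the largest value on, are dominated by
`0, 1, 2, …`. -/
lemma sum_rank_le {ι : Type*} (v : ι → ℝ) {g : ℕ → ℝ} (hg : Monotone g) (T : Finset ι) :
    ∑ j ∈ T, g (T.filter fun i => v j < v i).card ≤ ∑ i ∈ Finset.range T.card, g i := by
  classical
  induction T using Finset.induction_on_min_value v with
  | empty => simp
  | insert a T ha hmin ih =>
    rw [Finset.sum_insert ha, Finset.card_insert_of_notMem ha, Finset.sum_range_succ, add_comm]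
    refine add_le_add ((Finset.sum_le_sum fun j hj => le_of_eq ?_).trans ih) (hg ?_)
    · rw [Finset.filter_insert, if_neg (hmin j hj).not_gt]
    · rw [Finset.filter_insert, if_neg (lt_irrefl _)]
      exact Finset.card_filter_le _ _

/-- The search at rank s costs at most 15√N/√s, which is exactly the gap between the average later
cost and `climbCost`. So the potential closes up under recursion. -/
lemma searchCost_one_add_le {N : ℝ} {s : ℕ} (hs : 1 ≤ s) (hsN : s ≤ N) :
    searchCost (√N / √s) 1 + 15 * √N * (2 - 2 / √s) ≤ climbCost N s := by
  have hs0 : 0 < √(s : ℝ) := Real.sqrt_pos.2 (by exact_mod_cast hs)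
  have hD : 1 ≤ √N / √s := (one_le_div hs0).2 (Real.sqrt_le_sqrt hsN)
  have h1 : searchCost (√N / √s) 1 ≤ 15 * (√N / √s) := by
    rw [searchCost]
    split_ifs <;> linarith
  rw [climbCost, if_neg (by omega)]
  have e : 15 * √N * (2 - 1 / √(s : ℝ)) = 15 * √N * (2 - 2 / √s) + 15 * (√N / √s) := by ring
  linarith

end ExponentialSearch

/-! ## Maximum finding -/

section MaxIndex

variable {n M q : ℕ} {x : Fin M → Config n} {U : Circuit M q}

/-- The index `j` has the largest value. -/
def IsMaxIndex (x : Fin M → Config n) (U : Circuit M q) (j : Fin q → Bool) : Prop :=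
  ∀ i, indexValue x U i ≤ indexValue x U j

lemma marked_eq_empty_iff {j : Fin q → Bool} :
    marked x U (indexValue x U j) = ∅ ↔ IsMaxIndex x U j := by
  simp [marked, IsMaxIndex, Finset.filter_eq_empty_iff]

end MaxIndex

namespace Prog

variable {n M q : ℕ} {x : Fin M → Config n} {U : Circuit M q}

lemma expect_maxLoop_succ (F : Basis q → ℝ) (r t : ℕ) (m : ℝ) (best : Basis q) :
    (maxLoop U (r + 1) t m best : Prog n M q _).expect x F
      = (∑ l ∈ Finset.range ⌈m⌉₊, if t < l + 1 then F best else
          (circuit (groverCircuit U (best.2 .val) l) .ret : Prog n M q _).expect x fun b =>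
            if best.2 .val < b.2 .val then (maxLoop U r (t - (l + 1)) 1 b : Prog n M q _).expect x F
            else (maxLoop U r (t - (l + 1)) (min (6 / 5 * m) √(2 ^ q)) best
              : Prog n M q _).expect x F) / ⌈m⌉₊ := by
  rw [maxLoop, expect_bind]
  change (∑ l ∈ Finset.range ⌈m⌉₊, _) / (⌈m⌉₊ : ℝ) = _
  congr 1
  refine Finset.sum_congr rfl fun l _ => ?_
  change ((tick 8 : Prog n M q _) >>= _).expect x F = _
  rw [expect_bind, expect_tick]
  split_ifs with ht
  · rfl
  · rw [expect_bind]
    congr 1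
    ext b
    split_ifs <;> rfl

/-- The state of the main loop does not change any more at a maximum. -/
lemma expect_maxLoop_of_isMaxIndex (hU : IsValueCircuit x U) {j : Fin q → Bool}
    (hj : IsMaxIndex x U j) (F : Basis q → ℝ) (r t : ℕ) {m : ℝ} (hm : 0 < m) :
    (maxLoop U r t m (valueState x U j)).expect x F = F (valueState x U j) := by
  induction r generalizing t m with
  | zero => rfl
  | succ r ih =>
    have hL : (⌈m⌉₊ : ℝ) ≠ 0 := by
      have := Nat.ceil_pos.2 hm
      positivity
    have hm' : 0 < min (6 / 5 * m) √(2 ^ q) := lt_min (by positivity) (by positivity)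
    have hval : (valueState x U j).2 .val = indexValue x U j := rfl
    rw [expect_maxLoop_succ, div_eq_iff hL,
      Finset.sum_eq_card_nsmul (b := F (valueState x U j)), Finset.card_range, nsmul_eq_mul,
      mul_comm]
    intro l _
    split_ifs with ht
    · rfl
    · rw [hval, expect_groverCircuit hU, marked_eq_empty_iff.2 hj]
      have h0 : groverAngle (2 ^ q) ((∅ : Finset (Fin q → Bool)).card : ℝ) = 0 := by
        simp [groverAngle]
      rw [h0]
      have h1 : ∀ i, ¬ indexValue x U j < (valueState x U i).2 .val := fun i => (hj i).not_gt
      simp only [h1, if_false, ih _ hm']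
      simp

/-- A bound for the expected cost until the maximum is found from an index of rank `s`, for the
parameter `m` of the exponential search. -/
noncomputable def maxCost (N : ℝ) (s : ℕ) (m : ℝ) : ℝ :=
  if s = 0 then 0 else searchCost (√N / √s) m + 15 * √N * (2 - 2 / √s)

lemma maxCost_one_le {N : ℝ} {s : ℕ} (hsN : s ≤ N) : maxCost N s 1 ≤ climbCost N s := by
  rw [maxCost]
  split_ifs with hs
  · rw [climbCost, if_pos hs]
  · exact searchCost_one_add_le (Nat.one_le_iff_ne_zero.2 hs) hsN

lemma maxCost_nonneg {N : ℝ} {s : ℕ} {m : ℝ} (hm : 0 ≤ m) : 0 ≤ maxCost N s m := by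
  rw [maxCost]
  split_ifs with hs
  · exact le_rfl
  · have h1 : 1 ≤ √(s : ℝ) :=
      Real.one_le_sqrt.2 (by exact_mod_cast Nat.one_le_iff_ne_zero.2 hs)
    have h2 : 2 / √(s : ℝ) ≤ 2 := (div_le_iff₀ (by linarith)).2 (by linarith)
    exact add_nonneg (searchCost_nonneg hm) (mul_nonneg (by positivity) (by linarith))

/-- A round of the main loop with `l` Grover iterations that the budget allows. -/
lemma le_expect_round (hU : IsValueCircuit x U) {F₁ F₂ : Basis q → ℝ} {j : Fin q → Bool}
    {A a c : ℝ} (ha : 0 ≤ a) {s : ℕ} (hs : s = (marked x U (indexValue x U j)).card) (hs0 : s ≠ 0)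
    (h₁ : ∀ i, A - a * climbCost (2 ^ q) (marked x U (indexValue x U i)).card
      ≤ F₁ (valueState x U i))
    (h₂ : ∀ i, A - a * (15 * √(2 ^ q) * (2 - 2 / √s) + c) ≤ F₂ i) (l : ℕ) :
    A - a * (15 * √(2 ^ q) * (2 - 2 / √s)
        + (1 - Real.sin ((2 * l + 1) * groverAngle (2 ^ q) s) ^ 2) * c)
      ≤ (circuit (groverCircuit U (indexValue x U j) l) .ret : Prog n M q _).expect x fun b =>
          if indexValue x U j < b.2 .val then F₁ b else F₂ b := by
  classical
  set N : ℝ := 2 ^ q with hN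
  set T := marked x U (indexValue x U j) with hT
  have hs1 : (0 : ℝ) < s := by exact_mod_cast Nat.pos_of_ne_zero hs0
  have hjT : j ∉ T := by simp [hT, mem_marked]
  have hTc : (0 : ℝ) < N - s := by
    rw [hs, hN, ← card_compl_index]
    exact_mod_cast Finset.card_pos.2 ⟨j, Finset.mem_compl.2 hjT⟩
  rw [expect_groverCircuit hU, ← hT, ← hs, ← hN,
    ← sub_eq_of_eq_add' (Real.sin_sq_add_cos_sq _).symm]
  set p := Real.sin ((2 * l + 1) * groverAngle N s) ^ 2 with hp
  have hp0 : 0 ≤ p := sq_nonneg _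
  have hp1 : p ≤ 1 := Real.sin_sq_le_one _
  have hgood : A - a * (15 * √N * (2 - 2 / √s))
      ≤ (∑ i ∈ T, if indexValue x U j < (valueState x U i).2 .val then F₁ (valueState x U i)
          else F₂ (valueState x U i)) / s := by
    rw [le_div_iff₀ hs1]
    -- The marked sets are nested: everything above a marked index is itself marked, so ranks may be
    -- counted within T.
    have hrank : ∑ i ∈ T, climbCost N (marked x U (indexValue x U i)).card
        ≤ ∑ i ∈ Finset.range T.card, climbCost N i := by
      refine le_trans (Finset.sum_le_sum fun i hi => le_of_eq ?_)
        (sum_rank_le (indexValue x U) (monotone_climbCost N) T)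
      congr 2
      ext i'
      simp only [Finset.mem_filter, mem_marked, hT]
      exact ⟨fun h => ⟨((mem_marked x).1 (hT ▸ hi)).trans h, h⟩, fun h => h.2⟩
    have hclimb := hrank.trans (sum_climbCost_le N T.card)
    rw [← hs] at hclimb
    have e : 15 * √N * (2 * s - 2 * √(s : ℝ)) = 15 * √N * (2 - 2 / √s) * s := by
      have : √(s : ℝ) * √s = s := Real.mul_self_sqrt hs1.le
      have h0 : √(s : ℝ) ≠ 0 := (Real.sqrt_pos.2 hs1).ne'
      field_simp
      linear_combination -√N * this
    rw [e] at hclimb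
    calc (A - a * (15 * √N * (2 - 2 / √s))) * s
        ≤ ∑ i ∈ T, (A - a * climbCost N (marked x U (indexValue x U i)).card) := by
          rw [Finset.sum_sub_distrib, Finset.sum_const, nsmul_eq_mul, ← hs, ← Finset.mul_sum]
          nlinarith [mul_le_mul_of_nonneg_left hclimb ha]
      _ ≤ _ := Finset.sum_le_sum fun i hi => by
          have hi' : indexValue x U j < (valueState x U i).2 .val := (mem_marked x).1 (hT ▸ hi)
          rw [if_pos hi']
          exact h₁ i
  have hbad : A - a * (15 * √N * (2 - 2 / √s) + c)
      ≤ (∑ i ∈ Tᶜ, if indexValue x U j < (valueState x U i).2 .val then F₁ (valueState x U i)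
          else F₂ (valueState x U i)) / (N - s) := by
    rw [le_div_iff₀ hTc]
    have hcard : (Tᶜ.card : ℝ) = N - s := by rw [card_compl_index, hs]
    rw [← hcard, mul_comm, ← nsmul_eq_mul, ← Finset.sum_const]
    refine Finset.sum_le_sum fun i hi => ?_
    have hi' : ¬ indexValue x U j < (valueState x U i).2 .val :=
      fun h => Finset.mem_compl.1 hi ((mem_marked x).2 h)
    rw [if_neg hi']
    exact h₂ _
  nlinarith [mul_le_mul_of_nonneg_left hgood hp0,
    mul_le_mul_of_nonneg_left hbad (sub_nonneg.2 hp1)]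

/-- Markov's inequality in inductive form: for a₀ = 0, a = 1 and F the indicator of a maximum, the
loop ends at a maximum with probability at least (t - expected cost)/B. A general F lets the rest of
the program take its place. The scale B stays fixed while the budget t shrinks. As each round uses
at least one unit, t ≤ r ensures that the bound on the rounds never interferes. -/
lemma le_expect_maxLoop (hU : IsValueCircuit x U) {F : Basis q → ℝ} {a₀ a : ℝ} {B : ℝ}
    (ha : 0 ≤ a) (h₀ : ∀ j, a₀ ≤ F (valueState x U j))
    (h₁ : ∀ j, IsMaxIndex x U j → a₀ + a ≤ F (valueState x U j)) (r : ℕ) {t : ℕ} (htr : t ≤ r)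
    (htB : t ≤ B) {m : ℝ} (hm : 1 ≤ m) (hmN : m ≤ √(2 ^ q)) (j : Fin q → Bool) :
    B * a₀ + a * (t - maxCost (2 ^ q) (marked x U (indexValue x U j)).card m)
      ≤ B * (maxLoop U r t m (valueState x U j)).expect x F := by
  induction r generalizing t m j with
  | zero =>
    obtain rfl : t = 0 := by omega
    have hB : (0 : ℝ) ≤ B := by simpa using htB
    have h2 := maxCost_nonneg (N := 2 ^ q) (s := (marked x U (indexValue x U j)).card)
      (zero_le_one.trans hm)
    have h3 := mul_le_mul_of_nonneg_left (h₀ j) hB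
    have h4 := mul_nonneg ha h2
    change _ ≤ B * F (valueState x U j)
    push_cast
    linarith
  | succ r ih =>
    have hB : (0 : ℝ) ≤ B := (Nat.cast_nonneg t).trans htB
    set N : ℝ := 2 ^ q with hN
    obtain ⟨s, hs⟩ : ∃ s, s = (marked x U (indexValue x U j)).card := ⟨_, rfl⟩
    rw [← hs]
    rcases eq_or_ne s 0 with hs0 | hs0
    · have hj : IsMaxIndex x U j :=
        marked_eq_empty_iff.1 (Finset.card_eq_zero.1 (hs ▸ hs0))
      rw [expect_maxLoop_of_isMaxIndex hU hj F _ _ (zero_lt_one.trans_le hm), maxCost, if_pos hs0]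
      nlinarith [mul_le_mul_of_nonneg_left (h₁ j hj) hB, mul_le_mul_of_nonneg_left htB ha]
    have hs1 : (1 : ℝ) ≤ s := by exact_mod_cast Nat.one_le_iff_ne_zero.2 hs0
    have hsN : (s : ℝ) ≤ N := hs ▸ card_le_two_pow _
    have hrs : 1 ≤ √(s : ℝ) := Real.one_le_sqrt.2 hs1
    have hrsN : √(s : ℝ) ≤ √N := Real.sqrt_le_sqrt hsN
    set D := √N / √s with hD
    have hD1 : 1 ≤ D := (one_le_div (by linarith)).2 hrsN
    have hDN : D ≤ √N := div_le_self (by positivity) hrs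
    set m' := min (6 / 5 * m) √N with hm'
    have hm1 : 1 ≤ m' := le_min (by linarith) (hm.trans hmN)
    set L := ⌈m⌉₊ with hL
    have hL1 : (L : ℝ) ≤ m + 1 := (Nat.ceil_lt_add_one (by linarith)).le
    have hL2 : m ≤ L := Nat.le_ceil m
    have hL0 : (0 : ℝ) < L := by linarith
    set θ := groverAngle N s with hθ
    set H := 15 * √N * (2 - 2 / √(s : ℝ)) with hH
    have hH0 : 0 ≤ H := by
      have h2 : 2 / √(s : ℝ) ≤ 2 := (div_le_iff₀ (by linarith)).2 (by linarith)
      exact mul_nonneg (by positivity) (by linarith)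
    have hc0 : 0 ≤ searchCost D m' := searchCost_nonneg (by linarith)
    have hcost : ∀ m, maxCost N s m = H + searchCost D m := fun m => by
      rw [maxCost, if_neg hs0]; ring
    have hround : ∀ l ∈ Finset.range L,
        B * a₀ + a * (t - ((l + 1) + (H + (1 - Real.sin ((2 * l + 1) * θ) ^ 2) * searchCost D m')))
        ≤ B * (if t < l + 1 then F (valueState x U j) else
          (circuit (groverCircuit U (indexValue x U j) l) .ret : Prog n M q _).expect x fun b =>
            if indexValue x U j < b.2 .val then
              (maxLoop U r (t - (l + 1)) 1 b : Prog n M q _).expect x F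
            else (maxLoop U r (t - (l + 1)) m' (valueState x U j) : Prog n M q _).expect x F) := by
      intro l _
      have hp1 : Real.sin ((2 * l + 1) * θ) ^ 2 ≤ 1 := Real.sin_sq_le_one _
      split_ifs with ht
      · have h2 : (t : ℝ) ≤ l + 1 := by exact_mod_cast ht.le
        have h3 := mul_le_mul_of_nonneg_left (h₀ j) hB
        have h4 : (t : ℝ) - ((l + 1) + (H + (1 - Real.sin ((2 * l + 1) * θ) ^ 2)
            * searchCost D m')) ≤ 0 := by
          have := mul_nonneg (sub_nonneg.2 hp1) hc0
          linarith
        nlinarith [mul_nonneg ha (neg_nonneg.2 h4)]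
      · have htl : ((t - (l + 1) : ℕ) : ℝ) = t - (l + 1) := by
          rw [Nat.cast_sub (by omega)]
          push_cast
          ring
        have hle : ((t - (l + 1) : ℕ) : ℝ) ≤ B := by rw [htl]; linarith
        rw [← expect_const_mul]
        simp only [mul_ite]
        refine le_trans (le_of_eq ?_) (le_expect_round hU (A := B * a₀ + a * (t - (l + 1)))
          (c := searchCost D m') ha hs hs0 (fun i => ?_) (fun i => ?_) l)
        · rw [← hN, ← hH, ← hθ]
          ring
        · refine le_trans ?_ (ih (by omega) hle le_rfl (hm.trans hmN) i)
          rw [htl, ← hN]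
          nlinarith [mul_le_mul_of_nonneg_left (maxCost_one_le
            (card_le_two_pow (marked x U (indexValue x U i)))) ha]
        · refine le_trans (le_of_eq ?_) (ih (by omega) hle hm1 (min_le_right _ _) j)
          rw [htl, ← hN, ← hs, hcost, ← hH]
          ring
    rw [expect_maxLoop_succ, hcost, ← mul_div_assoc, le_div_iff₀ hL0, Finset.mul_sum]
    refine le_trans ?_ (Finset.sum_le_sum hround)
    set P := (∑ l ∈ Finset.range L, Real.sin ((2 * l + 1) * θ) ^ 2) / L with hP
    have hP0 : 0 ≤ P := by positivity
    have hP1 : P ≤ 1 := by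
      rw [hP, div_le_one hL0]
      calc _ ≤ ∑ l ∈ Finset.range L, (1 : ℝ) := Finset.sum_le_sum fun l _ => Real.sin_sq_le_one _
        _ = L := by simp
    -- D = √N/√s is 1 / sin θ, the threshold from which random iteration numbers succeed.
    have hP4 : D ≤ m → 1 / 4 ≤ P := by
      intro hDm
      have hsin : Real.sin θ = √s / √N := sin_groverAngle hsN (by positivity)
      have hsN0 : 0 < √N := by linarith
      have hθ0 : 0 < θ := by
        rw [hθ, groverAngle, Real.arcsin_pos, Real.sqrt_pos]
        have : 0 < N := by positivity
        positivity
      rw [hP, le_div_iff₀ hL0]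
      have := quarter_le_sum_sin_sq hθ0 (Real.arcsin_le_pi_div_two _) (L := L) (by
        rw [hsin, mul_div_assoc', one_le_div hsN0]
        rw [hD, div_le_iff₀ (by linarith)] at hDm
        nlinarith)
      linarith
    have hstep := searchCost_step hm hD1 hDN hP0 hP1 hP4
    have hsum : ∑ l ∈ Finset.range L, (B * a₀ + a * (t - ((l + 1) + (H
        + (1 - Real.sin ((2 * l + 1) * θ) ^ 2) * searchCost D m'))))
        = L * (B * a₀ + a * (t - ((L + 1) / 2 + (H + (1 - P) * searchCost D m')))) := by
      have hPL : ∑ l ∈ Finset.range L, Real.sin ((2 * l + 1) * θ) ^ 2 = P * L := by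
        rw [hP, div_mul_cancel₀ _ hL0.ne']
      have hl : ∑ l ∈ Finset.range L, (l : ℝ) = L * (L - 1) / 2 := by
        have h := Finset.sum_range_id_mul_two L
        rw [← Nat.cast_inj (R := ℝ)] at h
        push_cast [Nat.cast_sub (Nat.one_le_iff_ne_zero.2 (Nat.cast_ne_zero.1 hL0.ne'))] at h
        linarith
      simp only [Finset.sum_add_distrib, ← Finset.mul_sum, Finset.sum_sub_distrib, Finset.sum_const,
        Finset.card_range, nsmul_eq_mul, ← Finset.sum_mul, hPL, hl, mul_one]
      ring
    rw [hsum, mul_comm]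
    refine mul_le_mul_of_nonneg_left ?_ hL0.le
    have : (L + 1 : ℝ) / 2 + (H + (1 - P) * searchCost D m') ≤ H + searchCost D m := by
      linarith
    nlinarith [mul_le_mul_of_nonneg_left this ha]

end Prog

/-! ## Success probability of the quantum greedy algorithm -/

namespace Prog

variable {n M q : ℕ} {A : Type} {x : Fin M → Config n} {U : Circuit M q}

lemma expect_nonneg {g : A → ℝ} (hg : ∀ a, 0 ≤ g a) (p : Prog n M q A) : 0 ≤ p.expect x g := by
  have h := expect_const_mul (x := x) 0 g p
  have h' := expect_mono (x := x) (g := fun a => 0 * g a) (h := g) (fun a => by simpa using hg a) p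
  linarith

/-- Without iterations the two classes are measured in proportion to their sizes, so the threshold
drops out. An empty class contributes 0 on both sides. -/
lemma expect_groverCircuit_zero (hU : IsValueCircuit x U) (y : ℝ) (F : Basis q → ℝ) :
    (circuit (groverCircuit U y 0) .ret : Prog n M q _).expect x F
      = (∑ j, F (valueState x U j)) / 2 ^ q := by
  classical
  have hN : (0 : ℝ) < 2 ^ q := by positivity
  rw [expect_groverCircuit hU, ← Finset.sum_add_sum_compl (marked x U y)]
  set s : ℝ := ((marked x U y).card : ℝ) with hs
  have hsN : s ≤ 2 ^ q := card_le_two_pow _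
  have hs0 : 0 ≤ s := Nat.cast_nonneg _
  simp only [Nat.cast_zero, mul_zero, zero_add, one_mul]
  rw [sin_groverAngle hsN hN, cos_groverAngle hs0 hN, div_pow, div_pow, Real.sq_sqrt hs0,
    Real.sq_sqrt (sub_nonneg.2 hsN), Real.sq_sqrt hN.le, add_div]
  congr 1
  · rcases eq_or_ne s 0 with h | h
    · have : marked x U y = ∅ := by
        rw [hs] at h
        exact Finset.card_eq_zero.1 (by exact_mod_cast h)
      simp [this]
    · field_simp
  · rcases eq_or_ne (2 ^ q - s) 0 with h | h
    · have : (marked x U y)ᶜ = ∅ := by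
        rw [hs, ← card_compl_index] at h
        exact Finset.card_eq_zero.1 (by exact_mod_cast h)
      simp [this]
    · field_simp

/-- From every starting index the expected cost is at most 30√N, which is less than half of the
budget. -/
lemma le_expect_maxRun (hU : IsValueCircuit x U) {F : Basis q → ℝ} {a₀ a : ℝ} (ha : 0 ≤ a)
    (h₀ : ∀ j, a₀ ≤ F (valueState x U j))
    (h₁ : ∀ j, IsMaxIndex x U j → a₀ + a ≤ F (valueState x U j)) :
    a₀ + a / 2 ≤ (maxRun U : Prog n M q _).expect x F := by
  simp only [maxRun, expect_bind, expect_tick]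
  have hN : (0 : ℝ) < 2 ^ q := by positivity
  rw [expect_groverCircuit_zero hU, le_div_iff₀ hN]
  have hsum : (a₀ + a / 2) * 2 ^ q = ∑ _j : Fin q → Bool, (a₀ + a / 2) := by
    rw [Finset.sum_const, nsmul_eq_mul, Finset.card_univ, card_index, mul_comm]
    push_cast
    rfl
  rw [hsum]
  refine Finset.sum_le_sum fun j _ => ?_
  have h1 : (1 : ℝ) ≤ √(2 ^ q) := Real.one_le_sqrt.2 (one_le_pow₀ (by norm_num))
  set b : ℕ := 100 * ⌈√(2 ^ q : ℝ)⌉₊ with hb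
  have hb1 : 100 * √(2 ^ q) ≤ (b : ℝ) := by
    rw [hb]
    push_cast
    linarith [Nat.le_ceil √(2 ^ q : ℝ)]
  have h2 := le_expect_maxLoop hU (B := b) ha h₀ h₁ b le_rfl le_rfl le_rfl h1 j
  have h3 := (maxCost_one_le (card_le_two_pow (marked x U (indexValue x U j))))
  have h4 : climbCost (2 ^ q) (marked x U (indexValue x U j)).card ≤ 30 * √(2 ^ q) := by
    rw [climbCost]
    split_ifs
    · positivity
    · have : (0 : ℝ) ≤ 1 / √((marked x U (indexValue x U j)).card : ℝ) := by positivity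
      nlinarith
  refine le_of_mul_le_mul_left (le_trans ?_ h2) (by linarith : (0 : ℝ) < b)
  have h5 : (b : ℝ) / 2 ≤ b - maxCost (2 ^ q) (marked x U (indexValue x U j)).card 1 := by
    linarith
  nlinarith [mul_le_mul_of_nonneg_left h5 ha]

/-- The second part records that a maximum, once found, is never lost. For a further run, a(1 -
2^(-r)) is then the value granted after any outcome and a the value after a maximum, and the failure
probability is halved. -/
lemma le_expect_maxRepeat (hU : IsValueCircuit x U) {F : Basis q → ℝ} {a : ℝ} (ha : 0 ≤ a)
    (h₀ : ∀ j, 0 ≤ F (valueState x U j))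
    (h₁ : ∀ j, IsMaxIndex x U j → a ≤ F (valueState x U j)) (r : ℕ) (j : Fin q → Bool) :
    a * (1 - (1 / 2) ^ r) ≤ (maxRepeat U r (valueState x U j) : Prog n M q _).expect x F ∧
      (IsMaxIndex x U j → a ≤ (maxRepeat U r (valueState x U j) : Prog n M q _).expect x F) := by
  induction r generalizing j with
  | zero =>
    simp only [maxRepeat, expect_pure]
    exact ⟨by simpa using h₀ j, h₁ j⟩
  | succ r ih =>
    simp only [maxRepeat, expect_bind, expect_tick]
    have key : ∀ i, ∃ i', (if (valueState x U j).2 .val < (valueState x U i).2 .val then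
        valueState x U i else valueState x U j) = valueState x U i' ∧
        ((IsMaxIndex x U i ∨ IsMaxIndex x U j) → IsMaxIndex x U i') := by
      intro i
      split_ifs with h
      · refine ⟨i, rfl, ?_⟩
        rintro (hm | hm)
        · exact hm
        · exact absurd (hm i) (not_le.2 h)
      · refine ⟨j, rfl, ?_⟩
        rintro (hm | hm)
        · exact fun i' => (hm i').trans (not_lt.1 h)
        · exact hm
    have hp : ((1 : ℝ) / 2) ^ r ≤ 1 := pow_le_one₀ (by norm_num) (by norm_num)
    have hp0 : (0 : ℝ) ≤ a * (1 / 2) ^ r := by positivity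
    constructor
    · refine le_trans (le_of_eq ?_) (le_expect_maxRun hU (a₀ := a * (1 - (1 / 2) ^ r))
        (a := a * (1 / 2) ^ r) hp0 (fun i => ?_) (fun i hi => ?_))
      · rw [pow_succ]; ring
      · obtain ⟨i', e, -⟩ := key i
        rw [e]
        exact (ih i').1
      · obtain ⟨i', e, h⟩ := key i
        rw [e]
        exact le_trans (le_of_eq (by ring)) ((ih i').2 (h (Or.inl hi)))
    · intro hj
      refine le_trans (le_of_eq (by ring)) (le_expect_maxRun hU (a₀ := a) (a := 0) le_rfl
        (fun i => ?_) (fun i _ => ?_))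
      all_goals
        obtain ⟨i', e, h⟩ := key i
        rw [e]
        simpa using (ih i').2 (h (Or.inr hj))

lemma le_expect_maxFind (hU : IsValueCircuit x U) {F : Basis q → ℝ} {a ρ : ℝ} (ha : 0 ≤ a)
    (hρ : 0 < ρ) (h₀ : ∀ j, 0 ≤ F (valueState x U j))
    (h₁ : ∀ j, IsMaxIndex x U j → a ≤ F (valueState x U j)) :
    a * (1 - ρ) ≤ (maxFind U ρ : Prog n M q _).expect x F := by
  simp only [maxFind, expect_bind, expect_tick]
  set r := ⌈Real.logb 2 (1 / ρ)⌉₊ - 1 with hr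
  have hrep := le_expect_maxRepeat hU ha h₀ h₁ r
  refine le_trans ?_ (le_expect_maxRun hU (a₀ := a * (1 - (1 / 2) ^ r))
    (a := a * (1 / 2) ^ r) (by positivity) (fun i => (hrep i).1)
    (fun i hi => le_trans (le_of_eq (by ring)) ((hrep i).2 hi)))
  have h2 : ((1 : ℝ) / 2) ^ (r + 1) ≤ ρ := by
    have h3 : Real.logb 2 (1 / ρ) ≤ ((r + 1 : ℕ) : ℝ) :=
      (Nat.le_ceil _).trans (by exact_mod_cast (by omega))
    rw [Real.logb_le_iff_le_rpow (by norm_num) (by positivity), Real.rpow_natCast,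
      div_le_iff₀ hρ] at h3
    rw [div_pow, one_pow, div_le_iff₀ (by positivity)]
    linarith
  rw [pow_succ] at h2
  nlinarith [mul_le_mul_of_nonneg_left h2 ha]

/-- If the maximizing index is not a candidate, then no candidate exists, because all candidates
have larger values. Keeping S is then a greedy step. -/
lemma greedyStep_of_isMaxIndex (hn : n ≤ 2 ^ q) {u : Fin n} {S : List (Fin n)} (hu : u ∉ S)
    {j : Fin q → Bool} (hj : IsMaxIndex x (roundCircuit q x u S) j) :
    (∀ h : idx j < n, (⟨idx j, h⟩ : Fin n) ∉ u :: S →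
        RBM.GreedyStep x u S.toFinset (⟨idx j, h⟩ :: S : List (Fin n)).toFinset) ∧
      (¬ IsCandidate u S j → RBM.GreedyStep x u S.toFinset S.toFinset) := by
  have hcand : ∀ v : Fin n, v ∉ S → v ≠ u → ∃ i : Fin q → Bool, ∃ h : idx i < n,
      (⟨idx i, h⟩ : Fin n) = v ∧ (⟨idx i, h⟩ : Fin n) ∉ u :: S := by
    intro v hv hvu
    obtain ⟨i, hi⟩ := exists_idx_eq (v.2.trans_le hn)
    have e : (⟨idx i, hi ▸ v.2⟩ : Fin n) = v := Fin.ext hi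
    exact ⟨i, hi ▸ v.2, e, by rw [e]; simp [hv, hvu]⟩
  constructor
  · intro h hm
    have hm' : (⟨idx j, h⟩ : Fin n) ≠ u ∧ (⟨idx j, h⟩ : Fin n) ∉ S := by simpa using hm
    refine ⟨?_, ?_, ?_, fun v hv hvu => ?_⟩
    · rw [List.toFinset_cons]
      exact Finset.subset_insert _ _
    · rw [List.toFinset_cons, Finset.mem_insert, List.mem_toFinset]
      rintro (h' | h')
      · exact hm'.1 h'.symm
      · exact hu h'
    · rw [List.toFinset_cons]
      exact Finset.card_insert_le _ _
    · obtain ⟨i, hi, rfl, him⟩ := hcand v (by simpa using hv) hvu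
      rw [List.toFinset_cons, ← indexValue_of_isCandidate hi him,
        ← indexValue_of_isCandidate h hm]
      exact hj i
  · intro hc
    refine ⟨subset_rfl, by simpa using hu, by omega, fun v hv hvu => ?_⟩
    obtain ⟨i, hi, rfl, him⟩ := hcand v (by simpa using hv) hvu
    have h1 := hj i
    rw [indexValue_of_isCandidate hi him] at h1
    have h2 := indexValue_le_of_not_isCandidate (x := x) hc
    have h3 := neg_one_le_empiricalInfluence (x := x) u (insert ⟨idx i, hi⟩ S.toFinset)
    linarith

lemma le_expect_greedyRound (hn : n ≤ 2 ^ q) {u : Fin n} {S : List (Fin n)} (hS : S.Nodup)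
    (hu : u ∉ S) {g : List (Fin n) → ℝ} {a ρ : ℝ} (ha : 0 ≤ a) (hρ : 0 < ρ) (h₀ : ∀ S', 0 ≤ g S')
    (h₁ : ∀ S' : List (Fin n), S'.Nodup → RBM.GreedyStep x u S.toFinset S'.toFinset → a ≤ g S') :
    a * (1 - ρ) ≤ (greedyRound u ρ S : Prog n M q _).expect x g := by
  simp only [greedyRound, expect_bind, expect_indexSet, expect_select, expect_tick]
  refine le_expect_maxFind (isValueCircuit_influenceCircuit x u S _ _) ha hρ (fun j => ?_)
    (fun j hj => ?_)
  · split_ifs <;> exact h₀ _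
  · have hj' : IsMaxIndex x (roundCircuit q x u S) j := hj
    obtain ⟨hc, hnc⟩ := greedyStep_of_isMaxIndex hn hu hj'
    have hidx : ∀ V : Circuit M q, (valueState x V j).1 = j := fun _ => rfl
    simp only [hidx]
    split_ifs with h hm
    · exact h₁ _ hS (hnc fun ⟨_, hm'⟩ => hm' hm)
    · refine h₁ _ (List.nodup_cons.2 ⟨fun h' => hm (List.mem_cons_of_mem _ h'), hS⟩) (hc h hm)
    · exact h₁ _ hS (hnc fun ⟨h', _⟩ => h h')

end Prog

namespace RBM

variable {n m M q : ℕ} {R : RBM n m} {x : Fin M → Config n}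

lemma le_expect_greedyRounds (hR : R.Ferromagnetic) (hn : n ≤ 2 ^ q) {u : Fin n} {d K : ℕ}
    {ε : ℝ} (hd : 1 ≤ d) (hdN : (R.commonNbhd u).card ≤ d) (hx : R.Accurate x u K ε)
    {g : List (Fin n) → ℝ} {ρ : ℝ} (hρ : 0 < ρ) (hρ1 : ρ ≤ 1) (h₀ : ∀ S, 0 ≤ g S)
    (h₁ : ∀ S : List (Fin n), S.Nodup → R.GreedyInvariant u d ε K S.toFinset → 1 ≤ g S)
    (r t : ℕ) (hrt : t + r = K) {S : List (Fin n)} (hS : S.Nodup)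
    (hSt : R.GreedyInvariant u d ε t S.toFinset) :
    (1 - ρ) ^ r ≤ (Prog.greedyRounds u ρ r S : Prog n M q _).expect x g := by
  induction r generalizing t S with
  | zero =>
    obtain rfl : t = K := by omega
    simpa [Prog.greedyRounds] using h₁ S hS hSt
  | succ r ih =>
    simp only [Prog.greedyRounds, Prog.expect_bind, Prog.expect_tick]
    rw [pow_succ]
    refine Prog.le_expect_greedyRound hn hS (by simpa using hSt.notMem)
      (pow_nonneg (by linarith) r) hρ (fun S' => Prog.expect_nonneg h₀ _) fun S' hS' hstep => ?_
    exact ih (t + 1) (by omega) hS' (hSt.step hR hd hdN hx hstep (by omega))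

lemma le_prob_quantumGreedy {α β η δ : ℝ} (hα : 0 < α) (hR : R.Ferromagnetic)
    (hN : R.NonDegenerate α β) (hη : η = etaOf α β) (hδ : 0 < δ) (hδ1 : δ < 1) (hn : n ≤ 2 ^ q)
    {u : Fin n} {d : ℕ} (hd : 1 ≤ d) (hdN : (R.commonNbhd u).card ≤ d)
    (hK : 1 ≤ ⌈d * Real.log (4 / η)⌉₊)
    (hx : R.Accurate x u ⌈d * Real.log (4 / η)⌉₊ (η / (4 * d))) :
    1 - δ / 2 ≤ (Prog.quantumGreedy M q u η ⌈d * Real.log (4 / η)⌉₊ δ).prob x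
      {R.commonNbhd u} := by
  have hη0 : 0 < η := hη ▸ etaOf_pos hα
  set K := ⌈d * Real.log (4 / η)⌉₊ with hKdef
  have hK1 : (1 : ℝ) ≤ K := by exact_mod_cast hK
  rw [Prog.prob_eq_expect]
  simp only [Prog.quantumGreedy, Prog.expect_bind, Prog.expect_empInfluence, Prog.expect_prune,
    Prog.expect_pure, Set.mem_singleton_iff]
  have hρ : 0 < δ / (2 * K) := by positivity
  have hρ1 : δ / (2 * K) ≤ 1 := (div_le_one (by positivity)).2 (by linarith)
  refine le_trans ?_ (le_expect_greedyRounds hR hn hd hdN hx hρ hρ1 (fun S => ?_)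
    (fun S hS hinv => ?_) K 0 (by omega) List.nodup_nil
    (by simpa using greedyInvariant_zero hR u d (by positivity)))
  -- Bernoulli's inequality: K rounds with failure probability δ/(2K) lose at most δ/2.
  · have h := one_add_mul_le_pow (a := -(δ / (2 * K))) (by linarith) K
    have e : (K : ℝ) * -(δ / (2 * K)) = -(δ / 2) := by field_simp
    rw [e] at h
    simpa only [sub_eq_add_neg] using h
  · split_ifs <;> norm_num
  · have hsub := hinv.commonNbhd_subset hα hR hN hη hd
    rw [if_pos]
    ext j
    rw [List.mem_toFinset, List.mem_filter, decide_eq_true_eq]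
    have he : ∀ j, (S.erase j).toFinset = S.toFinset.erase j := by
      intro j
      ext i
      simp [hS.mem_erase_iff]
    rw [he]
    have hiff := fun hj => prune_iff hα hR hN hη hd hx hinv.notMem hinv.card_le hsub (j := j) hj
    constructor
    · rintro ⟨hj, h⟩
      exact (hiff (by simpa using hj)).1 h
    · intro hj
      exact ⟨by simpa using hsub hj, (hiff (hsub hj)).2 hj⟩

end RBM

/-! ## Running time of the quantum greedy algorithm -/

namespace Prog

variable {n M q : ℕ} {U : Circuit M q}

lemma length_groverCircuit (y : ℝ) (l : ℕ) :
    (groverCircuit U y l).length = q + l * (2 * U.length + 2 * q + 6) + U.length := by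
  simp [groverCircuit, groverIter, markCircuit, signIf, hadamards, Circuit.inv,
    List.length_flatten, List.map_replicate, List.sum_replicate]
  ring

lemma Spec.groverCircuit (y : ℝ) (l : ℕ) :
    (circuit (groverCircuit U y l) .ret : Prog n M q _).Spec (fun _ => True)
      (2 * q + U.length + 8 + l * (2 * U.length + 2 * q + 6)) := by
  intro b
  refine ⟨?_, trivial⟩
  rw [length_groverCircuit]
  push_cast
  linarith

/-- A bound for the time per unit of the budget of maximum finding. -/
noncomputable def unitTime (U : Circuit M q) : ℝ := 2 * U.length + 2 * q + 17

/-- A round with l iterations is paid for by its l + 1 units of the budget; the 17 in `unitTime`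
covers the draw, 8 classical operations and 8 measured words. The extra 9 is the draw and the
operations of the round that finds the budget exhausted. -/
lemma Spec.maxLoop (r t : ℕ) (m : ℝ) (best : Basis q) :
    (maxLoop U r t m best : Prog n M q _).Spec (fun _ => True) (t * unitTime U + 9) := by
  have hU : 0 ≤ unitTime U := by rw [unitTime]; positivity
  induction r generalizing t m best with
  | zero => exact (Spec.pure trivial).le (by positivity)
  | succ r ih =>
    have hcoin : (coin ⌈m⌉₊ .ret : Prog n M q ℕ).Spec (fun _ => True) 1 :=
      fun l => ⟨by norm_num, trivial⟩
    refine (hcoin.bind (t := t * unitTime U + 8) fun l _ => ?_).le (by linarith)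
    refine ((Spec.tick 8).bind (t := t * unitTime U) fun _ _ => ?_).le (by push_cast; linarith)
    split_ifs with ht
    · exact (Spec.pure trivial).le (by positivity)
    · have htl : ((t - (l + 1) : ℕ) : ℝ) = t - (l + 1) := by
        rw [Nat.cast_sub (by omega)]
        push_cast
        ring
      refine ((Spec.groverCircuit _ l).bind (t := (t - (l + 1)) * unitTime U + 9)
        fun b _ => ?_).le ?_
      · rw [← htl]
        split_ifs <;> exact ih _ _ _
      · rw [unitTime]
        nlinarith [Nat.cast_nonneg (α := ℝ) l, Nat.cast_nonneg (α := ℝ) U.length]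

lemma Spec.maxRun :
    (maxRun U : Prog n M q _).Spec (fun _ => True)
      ((100 * ⌈√(2 ^ q : ℝ)⌉₊ + 2) * unitTime U) := by
  refine ((Spec.groverCircuit 0 0).bind (t := 4 + ((100 * ⌈√(2 ^ q : ℝ)⌉₊ : ℕ) * unitTime U + 9))
    fun b _ => (Spec.tick 4).bind fun _ _ => Spec.maxLoop _ _ _ _).le ?_
  have := Nat.cast_nonneg (α := ℝ) U.length
  have := Nat.cast_nonneg (α := ℝ) q
  push_cast
  have : 2 * (q : ℝ) + U.length + 8 + 4 + 9 ≤ 2 * unitTime U := by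
    rw [unitTime]
    linarith
  linarith

lemma Spec.maxRepeat (r : ℕ) (best : Basis q) :
    (maxRepeat U r best : Prog n M q _).Spec (fun _ => True)
      (r * ((100 * ⌈√(2 ^ q : ℝ)⌉₊ + 3) * unitTime U)) := by
  induction r generalizing best with
  | zero => exact (Spec.pure trivial).le (by simp)
  | succ r ih =>
    refine (Spec.maxRun.bind fun b _ => (Spec.tick 2).bind fun _ _ => ih _).le ?_
    have : 2 ≤ unitTime U := by
      rw [unitTime]
      linarith [Nat.cast_nonneg (α := ℝ) U.length, Nat.cast_nonneg (α := ℝ) q]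
    push_cast
    linarith

lemma Spec.maxFind (ρ : ℝ) :
    (maxFind U ρ : Prog n M q _).Spec (fun _ => True)
      (((⌈Real.logb 2 (1 / ρ)⌉₊ - 1 : ℕ) + 1) *
        ((100 * ⌈√(2 ^ q : ℝ)⌉₊ + 3) * unitTime U)) := by
  refine ((Spec.tick 4).bind fun _ _ => Spec.maxRun.bind fun b _ => Spec.maxRepeat _ _).le ?_
  have : 4 ≤ unitTime U := by
    rw [unitTime]
    linarith [Nat.cast_nonneg (α := ℝ) U.length, Nat.cast_nonneg (α := ℝ) q]
  push_cast
  linarith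

/-- A bound for the time of maximum finding in a round with at most `K` selected nodes. -/
noncomputable def findTime (M q K : ℕ) (ρ : ℝ) : ℝ :=
  ((⌈Real.logb 2 (1 / ρ)⌉₊ - 1 : ℕ) + 1) *
    ((100 * ⌈√(2 ^ q : ℝ)⌉₊ + 3) * (12 * M + 2 * K + 2 * q + 33))

lemma Spec.greedyRound (u : Fin n) (ρ : ℝ) {K : ℕ} {S : List (Fin n)} (hS : S.length ≤ K) :
    (greedyRound u ρ S : Prog n M q _).Spec (fun S' => S'.length ≤ S.length + 1)
      (3 * M + 2 * M * K + K + 3 + findTime M q K ρ) := by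
  have hS' : (S.length : ℝ) ≤ K := by exact_mod_cast hS
  refine ((Spec.indexSet S).bind (t := 2 * M + (findTime M q K ρ + (K + 3)))
    fun MS hMS => ?_).le ?_
  swap
  · nlinarith [Nat.cast_nonneg (α := ℝ) M]
  have hMS' : (MS.length : ℝ) ≤ M := by exact_mod_cast hMS
  refine ((Spec.select u MS).bind (t := findTime M q K ρ + (K + 3)) fun MSu hMSu => ?_).le
    (by linarith)
  have hMSu' : (MSu.length : ℝ) ≤ MS.length := by exact_mod_cast hMSu
  refine ((Spec.maxFind ρ).bind (t := K + 3) fun b _ => ?_).le (add_le_add ?_ le_rfl)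
  · refine ((Spec.tick _).bind (t := 0) fun _ _ => ?_).le (by push_cast; linarith)
    split_ifs
    · exact Spec.pure (by simp)
    · exact Spec.pure (by simp)
    · exact Spec.pure (by simp)
  · rw [findTime]
    refine mul_le_mul_of_nonneg_left (mul_le_mul_of_nonneg_left ?_ (by positivity))
      (by positivity)
    rw [unitTime, length_influenceCircuit]
    push_cast
    linarith

lemma Spec.greedyRounds (u : Fin n) (ρ : ℝ) {K : ℕ} (r : ℕ) {S : List (Fin n)}
    (hS : S.length + r ≤ K) :
    (greedyRounds u ρ r S : Prog n M q _).Spec (fun S' => S'.length ≤ S.length + r)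
      (r * (3 * M + 2 * M * K + K + 4 + findTime M q K ρ)) := by
  induction r generalizing S with
  | zero =>
    exact (Spec.pure (Q := fun S' : List (Fin n) => S'.length ≤ S.length + 0) (by simp)).le (by simp)
  | succ r ih =>
    refine ((Spec.tick 1).bind fun _ _ => (Spec.greedyRound u ρ (K := K) (by omega)).bind
      fun S' hS' => (ih (by omega)).mono (fun S'' hS'' => ?_) le_rfl).le ?_
    · omega
    · push_cast
      linarith

lemma Spec.quantumGreedy (u : Fin n) (η : ℝ) (K : ℕ) (δ : ℝ) :
    (quantumGreedy M q u η K δ).Spec (fun _ => True)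
      (K * (3 * M + 2 * M * K + K + 4 + findTime M q K (δ / (2 * K))) + (5 * M + 2 * M * K + 5)
        + K * (K + (5 * M + 2 * M * K + 5) + 3)) := by
  refine ((Spec.greedyRounds u (δ / (2 * K)) (K := K) K (S := []) (by simp)).bind
    (t := (5 * M + 2 * M * K + 5) + K * (K + (5 * M + 2 * M * K + 5) + 3))
    fun S hS => ?_).le (by linarith)
  have hS' : (S.length : ℝ) ≤ K := by exact_mod_cast (by simpa using hS)
  have hM := Nat.cast_nonneg (α := ℝ) M
  have hMS := mul_le_mul_of_nonneg_left hS' hM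
  refine ((Spec.empInfluence u S).bind (t := K * (K + (5 * M + 2 * M * K + 5) + 3))
    fun v _ => ?_).le (by linarith)
  refine ((Spec.prune u η S v S).bind fun N _ => Spec.pure trivial).le ?_
  rw [add_zero]
  exact mul_le_mul hS' (by linarith) (by positivity) (by positivity)

end Prog

/-! ### Explicit constants for the running time -/

lemma two_pow_clog_le {n : ℕ} (hn : 1 ≤ n) : (2 : ℝ) ^ Nat.clog 2 n ≤ 2 * n := by
  rcases hn.eq_or_lt with rfl | hn
  · simp
  · have h := Nat.pow_pred_clog_lt_self (b := 2) (by norm_num) hn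
    have hpos := Nat.clog_pos (b := 2) (by norm_num) hn
    have e : 2 ^ Nat.clog 2 n = 2 * 2 ^ (Nat.clog 2 n).pred := by
      rw [← pow_succ']
      congr 1
      exact (Nat.succ_pred_eq_of_pos hpos).symm
    have h2 : 2 ^ Nat.clog 2 n ≤ 2 * n := by omega
    exact_mod_cast h2

lemma clog_le {n : ℕ} (hn : 1 ≤ n) : (Nat.clog 2 n : ℝ) ≤ 2 * Real.log n + 1 := by
  have h := Real.log_le_log (by positivity) (two_pow_clog_le hn)
  have hn1 : (1 : ℝ) ≤ n := by exact_mod_cast hn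
  rw [Real.log_pow, Real.log_mul (by norm_num) (by positivity)] at h
  have h2 := Real.log_two_gt_d9
  have h3 := Real.log_two_lt_d9
  have h4 := Real.log_nonneg hn1
  have h5 := Nat.cast_nonneg (α := ℝ) (Nat.clog 2 n)
  nlinarith

/-- There are at most 5 log(k/δ) runs, each with at most 253√n budget units (overhead included). A
unit takes time at most 29M, since the terms in K and in the number of qubits are absorbed by k ≤ M
and log n ≤ M. -/
lemma findTime_le {n M K : ℕ} {k δ : ℝ} (hk : 5 ≤ k) (hkn : k ≤ n) (hkM : k ≤ M)
    (hnM : Real.log n ≤ M) (hK0 : 1 ≤ K) (hK : (K : ℝ) ≤ 2 * k) (hδ : 0 < δ) (hδ1 : δ < 1) :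
    Prog.findTime M (Nat.clog 2 n) K (δ / (2 * K))
      ≤ 40000 * (M * √n * Real.log (k / δ)) := by
  have hn1 : 1 ≤ n := by
    have : (0 : ℝ) < n := by linarith
    exact_mod_cast this
  have hn1' : (1 : ℝ) ≤ n := by exact_mod_cast hn1
  have hK1 : (1 : ℝ) ≤ K := by exact_mod_cast hK0
  set l := Real.log (k / δ) with hl
  have hkδ : 5 ≤ k / δ := hk.trans (le_div_self (by linarith) hδ hδ1.le)
  have hl1 : 1 ≤ l := by
    rw [hl, Real.le_log_iff_exp_le (by linarith)]
    linarith [Real.exp_one_lt_d9]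
  have h2 := Real.log_two_gt_d9
  have hsn : 1 ≤ √(n : ℝ) := Real.one_le_sqrt.2 hn1'
  have hR : ((⌈Real.logb 2 (1 / (δ / (2 * K)))⌉₊ - 1 : ℕ) : ℝ) + 1 ≤ 5 * l := by
    have e : 1 / (δ / (2 * K)) = 2 * K / δ := by field_simp
    have hle : 2 * K / δ ≤ 4 * (k / δ) := by
      rw [← mul_div_assoc]
      exact div_le_div_of_nonneg_right (by linarith) hδ.le
    have h1 : 1 ≤ 2 * K / δ := (one_le_div hδ).2 (by linarith)
    have h0 : 0 ≤ Real.logb 2 (2 * K / δ) := Real.logb_nonneg (by norm_num) h1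
    have h3 : ((⌈Real.logb 2 (2 * K / δ)⌉₊ - 1 : ℕ) : ℝ) ≤ Real.logb 2 (2 * K / δ) := by
      have h4 := Nat.ceil_lt_add_one h0
      rcases Nat.eq_zero_or_pos ⌈Real.logb 2 (2 * K / δ)⌉₊ with h5 | h5
      · rw [h5]; simpa using h0
      · rw [Nat.cast_sub h5]; push_cast; linarith
    have h4 : Real.logb 2 (2 * K / δ) ≤ 2 + 3 / 2 * l := by
      have h5 : Real.log (2 * K / δ) ≤ 2 * Real.log 2 + l := by
        have h6 := Real.log_le_log (by linarith) hle
        rw [Real.log_mul (by norm_num) (by linarith), show (4 : ℝ) = 2 ^ 2 by norm_num,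
          Real.log_pow] at h6
        exact_mod_cast h6
      rw [Real.logb, div_le_iff₀ (by linarith)]
      nlinarith
    rw [e]
    linarith
  have hsq : 100 * (⌈√(2 ^ Nat.clog 2 n : ℝ)⌉₊ : ℝ) + 3 ≤ 253 * √n := by
    have h5 := Nat.ceil_lt_add_one (Real.sqrt_nonneg (2 ^ Nat.clog 2 n : ℝ))
    have h6 : √(2 ^ Nat.clog 2 n : ℝ) ≤ 3 / 2 * √n := by
      rw [show (3 / 2 : ℝ) = √(9 / 4) by
        rw [show (9 / 4 : ℝ) = (3 / 2) ^ 2 by norm_num, Real.sqrt_sq (by norm_num)],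
        ← Real.sqrt_mul (by norm_num)]
      exact Real.sqrt_le_sqrt ((two_pow_clog_le hn1).trans (by linarith))
    linarith
  have hc : 12 * (M : ℝ) + 2 * K + 2 * Nat.clog 2 n + 33 ≤ 29 * M := by
    linarith [clog_le hn1]
  rw [Prog.findTime]
  calc _ ≤ 5 * l * (253 * √n * (29 * M)) := by
        refine mul_le_mul hR (mul_le_mul hsq hc (by positivity) (by positivity)) (by positivity)
          (by linarith)
    _ = 36685 * (M * √n * l) := by ring
    _ ≤ _ := by
        refine mul_le_mul_of_nonneg_right (by norm_num) (by positivity)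

lemma timeLE_quantumGreedy {n M : ℕ} {k δ : ℝ} (hk : 5 ≤ k) (hkn : k ≤ n) (hkM : k ≤ M)
    (hnM : Real.log n ≤ M) (hδ : 0 < δ) (hδ1 : δ < 1) (u : Fin n) (η : ℝ) :
    (Prog.quantumGreedy M (Nat.clog 2 n) u η ⌈k⌉₊ δ).TimeLE
      (100000 * (M * k ^ 2 + M * k * √n * Real.log (k / δ))) := by
  set K := ⌈k⌉₊ with hKdef
  have hK0 : 1 ≤ K := Nat.ceil_pos.2 (by linarith)
  have hK : (K : ℝ) ≤ 2 * k := by linarith [Nat.ceil_lt_add_one (a := k) (by linarith)]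
  have hfind := findTime_le hk hkn hkM hnM hK0 hK hδ hδ1
  refine ((Prog.Spec.quantumGreedy u η K δ).le ?_).timeLE
  have hkδ : 5 ≤ k / δ := hk.trans (le_div_self (by linarith) hδ hδ1.le)
  have hl0 : 0 ≤ Real.log (k / δ) := Real.log_nonneg (by linarith)
  set F := Prog.findTime M (Nat.clog 2 n) K (δ / (2 * K)) with hF
  set Z := M * √n * Real.log (k / δ) with hZ
  have hZ0 : 0 ≤ Z := by positivity
  have hM : (5 : ℝ) ≤ M := hk.trans hkM
  have hMK : (M : ℝ) * K ≤ 2 * (M * k) := by nlinarith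
  have hMk : 5 * (M : ℝ) ≤ M * k := by nlinarith
  have hkMk : 5 * k ≤ M * k := by nlinarith
  have hK0' : (0 : ℝ) ≤ K := Nat.cast_nonneg K
  have h1 : K * (3 * M + 2 * M * K + K + 4 + F) ≤ 2 * k * (6 * (M * k) + 40000 * Z) := by
    refine (mul_le_mul_of_nonneg_left (b := 3 * M + 2 * M * K + K + 4 + F)
      (c := 6 * (M * k) + 40000 * Z) ?_ hK0').trans
      (mul_le_mul_of_nonneg_right hK (by positivity))
    linarith
  have h2 : (K : ℝ) * (K + (5 * M + 2 * M * K + 5) + 3) ≤ 2 * k * (7 * (M * k)) := by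
    refine (mul_le_mul_of_nonneg_left (b := (K : ℝ) + (5 * M + 2 * M * K + 5) + 3)
      (c := 7 * (M * k)) ?_ hK0').trans
      (mul_le_mul_of_nonneg_right hK (by positivity))
    linarith
  have h3 : (5 * M + 2 * M * K + 5 : ℝ) ≤ 6 * (M * k) := by linarith
  have h4 : (M : ℝ) * k ≤ M * k ^ 2 := by nlinarith
  have e : M * k * √n * Real.log (k / δ) = k * Z := by rw [hZ]; ring
  have hkZ : 0 ≤ k * Z := by positivity
  rw [e]
  nlinarith

/-! ### Assembly of the theorem -/

theorem theorem4 :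
    ∃ C : ℝ, 0 < C ∧
      ∀ (n m M : ℕ) (R : RBM n m) (α β δ η k : ℝ),
        0 < α → 0 < δ → δ < 1 →
        R.Ferromagnetic → R.NonDegenerate α β → 1 ≤ R.twoHopDegree →
        η = etaOf α β →
        k = R.twoHopDegree * Real.log (4 / η) →
        k ≤ n →
        (2 : ℝ) ^ (2 * k + 3) * (R.twoHopDegree / η) ^ 2 *
            (Real.log n + k * Real.log (Real.exp 1 * n / k)) * Real.log (8 / δ) ≤ M →
        ∀ u : Fin n,
          1 - δ ≤ R.successProb (Prog.quantumGreedy M (Nat.clog 2 n) u η ⌈k⌉₊ δ)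
              {R.twoHopNbhd u} ∧
          (Prog.quantumGreedy M (Nat.clog 2 n) u η ⌈k⌉₊ δ).TimeLE
            (C * (M * k ^ 2 + M * k * √n * Real.log (k / δ))) := by
  refine ⟨100000, by norm_num, ?_⟩
  intro n m M R α β δ η k hα hδ hδ1 hR hN hd hη hk hkn hM u
  classical
  set d := R.twoHopDegree with hddef
  have hd1 : (1 : ℝ) ≤ d := by exact_mod_cast hd
  have hη0 : 0 < η := hη ▸ RBM.etaOf_pos hα
  -- Since d₂ ≥ 1, some node has a two-hop neighbor, which bounds η.
  have hη72 : η ≤ 1 / 72 := by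
    by_contra hlt
    have h0 : ∀ v, (R.twoHopNbhd v).card = 0 := by
      intro v
      rw [RBM.twoHopNbhd_eq hα hR hN, Finset.card_eq_zero, Finset.eq_empty_iff_forall_notMem]
      exact fun w hw => hlt (hη ▸ RBM.etaOf_le hα hN hw)
    have : d ≤ 0 := Finset.sup_le fun v _ => (h0 v).le
    omega
  have hlog : 5 ≤ Real.log (4 / η) := by
    have h1 : (288 : ℝ) ≤ 4 / η := by
      rw [le_div_iff₀ hη0]
      linarith
    rw [Real.le_log_iff_exp_le (by linarith)]
    refine le_trans ?_ h1
    have h2 : Real.exp 5 = Real.exp 1 ^ 5 := by rw [← Real.exp_nat_mul]; norm_num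
    rw [h2]
    calc Real.exp 1 ^ 5 ≤ 2.7182818286 ^ 5 :=
          pow_le_pow_left₀ (Real.exp_pos 1).le Real.exp_one_lt_d9.le 5
      _ ≤ 288 := by norm_num
  have hk5 : 5 ≤ k := by rw [hk]; nlinarith
  have hn1 : (1 : ℝ) ≤ n := by linarith
  have hΛ : k + Real.log n ≤ Real.log n + k * Real.log (Real.exp 1 * n / k) := by
    have : 1 ≤ Real.log (Real.exp 1 * n / k) := by
      rw [Real.le_log_iff_exp_le (by positivity), le_div_iff₀ (by linarith)]
      exact mul_le_mul_of_nonneg_left hkn (Real.exp_pos 1).le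
    nlinarith
  have hlogn := Real.log_nonneg hn1
  -- Of the lower bound on M only the logarithmic factor L ≥ k + log n is used here; the other
  -- factors are at least 1.
  have hkM : k + Real.log n ≤ M := by
    refine le_trans ?_ hM
    have h1 : 1 ≤ (2 : ℝ) ^ (2 * k + 3) := Real.one_le_rpow (by norm_num) (by linarith)
    have h2 : 1 ≤ (d / η) ^ 2 := one_le_pow₀ ((one_le_div hη0).2 (by linarith))
    have h3 : 1 ≤ Real.log (8 / δ) := by
      rw [Real.le_log_iff_exp_le (by positivity), le_div_iff₀ hδ]
      nlinarith [Real.exp_one_lt_d9, Real.exp_pos 1]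
    have h4 := one_le_mul_of_one_le_of_one_le h1 h2
    refine hΛ.trans ((le_mul_of_one_le_left (by linarith) h4).trans
      (le_mul_of_one_le_right ?_ h3))
    exact mul_nonneg (by linarith) (by linarith)
  refine ⟨?_, timeLE_quantumGreedy hk5 hkn (by linarith) (by linarith) hδ hδ1 u η⟩
  have hacc := RBM.one_sub_le_sum_accurate hR hd hη0 (by linarith) hδ hδ1 hk5 hkn hM u
  have hdN : (R.commonNbhd u).card ≤ d := by
    rw [← RBM.twoHopNbhd_eq hα hR hN, hddef]
    exact Finset.le_sup (f := fun i => (R.twoHopNbhd i).card) (Finset.mem_univ u)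
  have hprob : ∀ x : Fin M → Config n,
      (1 - δ / 2) * (if R.Accurate x u ⌈k⌉₊ (η / (4 * d)) then 1 else 0)
        ≤ (Prog.quantumGreedy M (Nat.clog 2 n) u η ⌈k⌉₊ δ).prob x {R.twoHopNbhd u} := by
    intro x
    split_ifs with hx
    · rw [RBM.twoHopNbhd_eq hα hR hN, mul_one, hk]
      rw [hk] at hx hk5
      exact RBM.le_prob_quantumGreedy hα hR hN hη hδ hδ1 (Nat.le_pow_clog (by norm_num) n) hd hdN
        (Nat.ceil_pos.2 (by linarith)) hx
    · rw [mul_zero, Prog.prob_eq_expect]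
      exact Prog.expect_nonneg (fun a => by split_ifs <;> norm_num) _
  -- One factor is for the accuracy of the samples, the other for the quantum searches given
  -- accurate samples.
  calc 1 - δ ≤ (1 - δ / 2) * (1 - δ / 2) := by nlinarith
    _ ≤ (1 - δ / 2) * ∑ x : Fin M → Config n, (∏ i, R.visibleProb (x i)) *
        (if R.Accurate x u ⌈k⌉₊ (η / (4 * d)) then 1 else 0) :=
        mul_le_mul_of_nonneg_left hacc (by linarith)
    _ ≤ _ := by
        rw [RBM.successProb, Finset.mul_sum]
        refine Finset.sum_le_sum fun x _ => ?_
        rw [mul_left_comm]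
        exact mul_le_mul_of_nonneg_left (hprob x) (RBM.prod_visibleProb_nonneg x)
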